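/- Let $d\ge 0$ and let $\omega(X,Y)=\sum_k \mathrm{Im}(\overline{X_k}Y_k)$ be the canonical symplectic form of $\mathbf C^d$. Let $\mathcal{HE}_d=\mathbf R Z\oplus\mathbf C^d$ be the Heisenberg algebra, in which $Z$ is central and $[X,Y]=\omega(X,Y)Z$ for $X,Y\in\mathbf C^d$. Let $\widetilde{He}_d$ be the simply connected group with Lie algebra $\mathcal{HE}_d$, i.e. $\mathbf R\times\mathbf C^d$ with the product $(s,X)(t,Y)=(s+t+\tfrac12\omega(X,Y),X+Y)$, and let $p:\widetilde{He}_d\to He_d=\widetilde{He}_d/2\pi\mathbf Z$ be its quotient by the lattice $2\pi\mathbf Z$ of $\mathbf R\times\{0\}$, so that $He_d$ has underlying space $S^1\times\mathbf C^d$. A smooth action of the circle $S^1$ on $He_d$ by automorphisms induces a linear symplectic action of $S^1$ on $\mathbf C^d$ (the quotient of $He_d$ by $S^1\times\{0\}$), which, after conjugation by a linear symplectic transformation of $\mathbf C^d$, is of the form $\theta\cdot X=(\theta^{\lambda_1}X_1,\dots,\theta^{\lambda_d}X_d)$ with integers $\lambda_j$. The $(2d+2)$-dimensional Lie group $G=He_d\rtimes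 S^1$ is called a twisted Heisenberg group if the $\lambda_j$ are all nonzero and of the same sign. A twisted Heisenberg algebra is the Lie algebra of such a group. A Lorentz metric, or form, is one of signature $(1,n-1)$, with one negative direction. A lattice of a topological group $G$ is a discrete subgroup $\Gamma$ such that $G/\Gamma$ carries a nonzero finite $G$-invariant Borel measure. (i) Every twisted Heisenberg group carries a smooth bi-invariant Lorentz metric. Conversely, let $S^1$ act smoothly on $\mathcal{HE}_d$ by Lie algebra automorphisms, with infinitesimal generator the derivation $D$. If the semidirect product $\mathcal{HE}_d\rtimes_D\mathbf R$ (that is, $\mathcal{HE}_d\oplus\mathbf R t$ with $[t,x]=Dx$ for $x\in\mathcal{HE}_d$) admits an $\mathrm{ad}$-invariant Lorentz form, then it is isomorphic to the Lie algebra of a twisted Heisenberg group $He_d\rtimes S^1$. (ii) Let $G=He_d\rtimes S^1$ be a twisted Heisenberg group. Every lattice of $He_d$ is a lattice of $G$. Conversely, if $\Gamma$ is a lattice of $G$, then $\Gamma\cap He_d$ has finite index in $\Gamma$ and is a lattice of $He_d$. If $\Lambda$ is a lattice of $He_d$, then $p^{-1}(\Lambda)$ is a lattice of $\widetilde{He}_d$.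 Conversely, let $\Gamma$ be a lattice of $\widetilde{He}_d$. Then $p(\Gamma)$ is a lattice of $He_d$ if and only if $\Gamma\cap\ker p\neq\{1\}$, and in this case $\Gamma$ has finite index in $p^{-1}(p(\Gamma))$. Moreover there is always an automorphism $\varphi$ of the topological group $\widetilde{He}_d$ such that $p(\varphi(\Gamma))$ is a lattice of $He_d$ and $p^{-1}(p(\varphi(\Gamma)))=\varphi(\Gamma)$. -/

import Mathlib

open scoped Manifold ContDiff

noncomputable section

namespace Heisenberg

/-! ### The symplectic form, the Heisenberg algebra and the Heisenberg groups -/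

/-- The space `ℂ^d`. -/
abbrev Cd (d : ℕ) : Type := Fin d → ℂ

/-- The canonical symplectic form of `ℂ^d`: the imaginary part of the canonical hermitian product
`∑ conj (X k) * Y k`, so that `omega e_k (i e_k) = 1`. -/
def omega {d : ℕ} (X Y : Cd d) : ℝ := ∑ k, (starRingEnd ℂ (X k) * Y k).im

theorem omega_add_left {d : ℕ} (X X' Y : Cd d) : omega (X + X') Y = omega X Y + omega X' Y := by
  rw [omega, omega, omega, ← Finset.sum_add_distrib]
  refine Finset.sum_congr rfl fun k _ => ?_
  simp
  ring

theorem omega_add_right {d : ℕ} (X Y Y' : Cd d) : omega X (Y + Y') = omega X Y + omega X Y' := by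
  rw [omega, omega, omega, ← Finset.sum_add_distrib]
  refine Finset.sum_congr rfl fun k _ => ?_
  simp
  ring

theorem omega_smul_left {d : ℕ} (c : ℝ) (X Y : Cd d) : omega (c • X) Y = c * omega X Y := by
  simp only [omega, Finset.mul_sum]
  refine Finset.sum_congr rfl fun k _ => ?_
  simp
  ring

theorem omega_smul_right {d : ℕ} (c : ℝ) (X Y : Cd d) : omega X (c • Y) = c * omega X Y := by
  simp only [omega, Finset.mul_sum]
  refine Finset.sum_congr rfl fun k _ => ?_
  simp
  ring

theorem omega_self {d : ℕ} (X : Cd d) : omega X X = 0 := by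
  refine Finset.sum_eq_zero fun k _ => ?_
  simp
  ring

@[simp] theorem omega_zero_left {d : ℕ} (Y : Cd d) : omega 0 Y = 0 := by simp [omega]

@[simp] theorem omega_zero_right {d : ℕ} (X : Cd d) : omega X 0 = 0 := by simp [omega]

@[simp] theorem omega_neg_self_left {d : ℕ} (X : Cd d) : omega (-X) X = 0 := by
  rw [show (-X) = (-1 : ℝ) • X by simp, omega_smul_left, omega_self, mul_zero]

/-- The Heisenberg algebra `HE_d`, of dimension `2 d + 1`, with underlying space `ℝ ⊕ ℂ^d`. -/
def HAlg (d : ℕ) : Type := ℝ × Cd d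

namespace HAlg

instance (d : ℕ) : NormedAddCommGroup (HAlg d) := inferInstanceAs (NormedAddCommGroup (ℝ × Cd d))

instance (d : ℕ) : NormedSpace ℝ (HAlg d) := inferInstanceAs (NormedSpace ℝ (ℝ × Cd d))

/-- `[(s, X), (t, Y)] = omega(X, Y) Z`, where `Z = (1, 0)`. -/
instance (d : ℕ) : Bracket (HAlg d) (HAlg d) where
  bracket x y := ((omega x.2 y.2, 0) : ℝ × Cd d)

theorem bracket_def {d : ℕ} (x y : HAlg d) : ⁅x, y⁆ = ((omega x.2 y.2, 0) : ℝ × Cd d) := rfl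

instance (d : ℕ) : LieRing (HAlg d) where
  add_lie x y z := Prod.ext (omega_add_left x.2 y.2 z.2) (by
    change (0 : Cd d) = 0 + 0
    simp)
  lie_add x y z := Prod.ext (omega_add_right x.2 y.2 z.2) (by
    change (0 : Cd d) = 0 + 0
    simp)
  lie_self x := Prod.ext (omega_self x.2) rfl
  leibniz_lie x y z := Prod.ext (by
    change omega x.2 (0 : Cd d) = omega (0 : Cd d) z.2 + omega y.2 (0 : Cd d)
    simp) (by
    change (0 : Cd d) = 0 + 0
    simp)

instance (d : ℕ) : LieAlgebra ℝ (HAlg d) where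
  lie_smul c x y := Prod.ext (omega_smul_right c x.2 y.2) (by
    change (0 : Cd d) = c • (0 : Cd d)
    simp)

end HAlg

/-- The simply connected Heisenberg group, of dimension `2 d + 1`: the group `exp (HE_d)`, with
underlying space `ℝ × ℂ^d`. -/
def SCGroup (d : ℕ) : Type := ℝ × Cd d

namespace SCGroup

instance (d : ℕ) : TopologicalSpace (SCGroup d) := inferInstanceAs (TopologicalSpace (ℝ × Cd d))

instance (d : ℕ) : Mul (SCGroup d) where
  mul x y := ((x.1 + y.1 + omega x.2 y.2 / 2, x.2 + y.2) : ℝ × Cd d)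

instance (d : ℕ) : One (SCGroup d) := ⟨((0, 0) : ℝ × Cd d)⟩

instance (d : ℕ) : Inv (SCGroup d) := ⟨fun x => ((-x.1, -x.2) : ℝ × Cd d)⟩

theorem mul_def {d : ℕ} (x y : SCGroup d) :
    x * y = ((x.1 + y.1 + omega x.2 y.2 / 2, x.2 + y.2) : ℝ × Cd d) := rfl

instance (d : ℕ) : Group (SCGroup d) :=
  Group.ofLeftAxioms
    (fun x y z => Prod.ext (by
        change x.1 + y.1 + omega x.2 y.2 / 2 + z.1 + omega (x.2 + y.2) z.2 / 2
          = x.1 + (y.1 + z.1 + omega y.2 z.2 / 2) + omega x.2 (y.2 + z.2) / 2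
        rw [omega_add_left, omega_add_right]
        ring) (add_assoc x.2 y.2 z.2))
    (fun x => Prod.ext (by
        change 0 + x.1 + omega 0 x.2 / 2 = x.1
        simp) (zero_add x.2))
    (fun x => Prod.ext (by
        change -x.1 + x.1 + omega (-x.2) x.2 / 2 = 0
        simp) (neg_add_cancel x.2))

end SCGroup

/-- The Heisenberg group `He_d` with compact center: the quotient of the simply connected
Heisenberg group by the lattice `2πℤ` of its center `ℝ` (see `proj` and `mem_ker_proj`), with
underlying space `S^1 × ℂ^d`. -/
def HGroup (d : ℕ) : Type := Circle × Cd d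

/-- The model space of `HGroup d`. -/
abbrev HModel (d : ℕ) : Type := ModelProd (EuclideanSpace ℝ (Fin 1)) (Cd d)

/-- The model with corners of `HGroup d`. -/
abbrev HCorners (d : ℕ) :
    ModelWithCorners ℝ (EuclideanSpace ℝ (Fin 1) × Cd d) (HModel d) :=
  (𝓡 1).prod 𝓘(ℝ, Cd d)

namespace HGroup

instance (d : ℕ) : TopologicalSpace (HGroup d) := inferInstanceAs (TopologicalSpace (Circle × Cd d))

instance (d : ℕ) : ChartedSpace (HModel d) (HGroup d) :=
  inferInstanceAs (ChartedSpace (HModel d) (Circle × Cd d))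

instance (d : ℕ) : IsManifold (HCorners d) ∞ (HGroup d) :=
  inferInstanceAs (IsManifold (HCorners d) ∞ (Circle × Cd d))

instance (d : ℕ) : Mul (HGroup d) where
  mul x y := ((x.1 * y.1 * Circle.exp (omega x.2 y.2 / 2), x.2 + y.2) : Circle × Cd d)

instance (d : ℕ) : One (HGroup d) := ⟨((1, 0) : Circle × Cd d)⟩

instance (d : ℕ) : Inv (HGroup d) := ⟨fun x => ((x.1⁻¹, -x.2) : Circle × Cd d)⟩

theorem mul_def {d : ℕ} (x y : HGroup d) :
    x * y = ((x.1 * y.1 * Circle.exp (omega x.2 y.2 / 2), x.2 + y.2) : Circle × Cd d) := rfl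

instance (d : ℕ) : Group (HGroup d) :=
  Group.ofLeftAxioms
    (fun x y z => Prod.ext (by
        change x.1 * y.1 * Circle.exp (omega x.2 y.2 / 2) * z.1
            * Circle.exp (omega (x.2 + y.2) z.2 / 2)
          = x.1 * (y.1 * z.1 * Circle.exp (omega y.2 z.2 / 2))
            * Circle.exp (omega x.2 (y.2 + z.2) / 2)
        rw [omega_add_left, omega_add_right, add_div, add_div, Circle.exp_add, Circle.exp_add]
        simp only [mul_assoc, mul_comm, mul_left_comm]) (add_assoc x.2 y.2 z.2))
    (fun x => Prod.ext (by
        change 1 * x.1 * Circle.exp (omega 0 x.2 / 2) = x.1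
        simp) (zero_add x.2))
    (fun x => Prod.ext (by
        change x.1⁻¹ * x.1 * Circle.exp (omega (-x.2) x.2 / 2) = 1
        simp) (neg_add_cancel x.2))

theorem inv_def {d : ℕ} (x : HGroup d) : x⁻¹ = ((x.1⁻¹, -x.2) : Circle × Cd d) := rfl

theorem contDiff_omega (d : ℕ) : ContDiff ℝ ∞ (fun p : Cd d × Cd d => omega p.1 p.2) := by
  have h : (fun p : Cd d × Cd d => omega p.1 p.2)
      = fun p => ∑ k, ((p.1 k).re * (p.2 k).im - (p.1 k).im * (p.2 k).re) := by
    funext p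
    refine Finset.sum_congr rfl fun k _ => ?_
    simp
    ring
  have hre : ContDiff ℝ ∞ Complex.re := Complex.reCLM.contDiff
  have him : ContDiff ℝ ∞ Complex.im := Complex.imCLM.contDiff
  rw [h]
  refine ContDiff.sum fun k _ => ?_
  have h1 : ContDiff ℝ ∞ (fun p : Cd d × Cd d => p.1 k) := by fun_prop
  have h2 : ContDiff ℝ ∞ (fun p : Cd d × Cd d => p.2 k) := by fun_prop
  exact ((hre.comp h1).mul (him.comp h2)).sub ((him.comp h1).mul (hre.comp h2))

theorem contMDiff_omega_half {d : ℕ} {E : Type*} [NormedAddCommGroup E] [NormedSpace ℝ E]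
    {H : Type*} [TopologicalSpace H] {I : ModelWithCorners ℝ E H} {M : Type*} [TopologicalSpace M]
    [ChartedSpace H M] {f g : M → Cd d} (hf : ContMDiff I 𝓘(ℝ, Cd d) ∞ f)
    (hg : ContMDiff I 𝓘(ℝ, Cd d) ∞ g) :
    ContMDiff I 𝓘(ℝ, ℝ) ∞ (fun x => omega (f x) (g x) / 2) := by
  have h : ContDiff ℝ ∞ (fun p : Cd d × Cd d => omega p.1 p.2 / 2) :=
    (contDiff_omega d).div_const 2
  exact ContDiff.comp_contMDiff (g := fun p : Cd d × Cd d => omega p.1 p.2 / 2)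
    (f := fun x => (f x, g x)) h (hf.prodMk_space hg)

instance (d : ℕ) : LieGroup (HCorners d) ∞ (HGroup d) where
  contMDiff_mul := by
    let P := Circle × Cd d
    have h : ContMDiff ((HCorners d).prod (HCorners d)) (HCorners d) ∞
        (fun p : P × P =>
          ((p.1.1 * p.2.1 * Circle.exp (omega p.1.2 p.2.2 / 2), p.1.2 + p.2.2) : P)) := by
      have h1 : ContMDiff ((HCorners d).prod (HCorners d)) (𝓡 1) ∞
          (fun p : P × P => p.1.1) := contMDiff_fst.comp contMDiff_fst
      have h2 : ContMDiff ((HCorners d).prod (HCorners d)) 𝓘(ℝ, Cd d) ∞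
          (fun p : P × P => p.1.2) := contMDiff_snd.comp contMDiff_fst
      have h3 : ContMDiff ((HCorners d).prod (HCorners d)) (𝓡 1) ∞
          (fun p : P × P => p.2.1) := contMDiff_fst.comp contMDiff_snd
      have h4 : ContMDiff ((HCorners d).prod (HCorners d)) 𝓘(ℝ, Cd d) ∞
          (fun p : P × P => p.2.2) := contMDiff_snd.comp contMDiff_snd
      have h5 : ContMDiff ((HCorners d).prod (HCorners d)) 𝓘(ℝ, ℝ) ∞
          (fun p : P × P => omega p.1.2 p.2.2 / 2) :=
        contMDiff_omega_half h2 h4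
      exact ((h1.mul h3).mul (contMDiff_circleExp.comp h5)).prodMk (h2.add h4)
    exact h
  contMDiff_inv := by
    let P := Circle × Cd d
    have h : ContMDiff (HCorners d) (HCorners d) ∞ (fun p : P => ((p.1⁻¹, -p.2) : P)) := by
      have h1 : ContMDiff (HCorners d) (𝓡 1) ∞ (fun p : P => p.1⁻¹) := contMDiff_fst.inv
      have h2 : ContMDiff (HCorners d) 𝓘(ℝ, Cd d) ∞ (fun p : P => -p.2) := contMDiff_snd.neg
      exact h1.prodMk h2
    exact h

end HGroup

/-- The projection of the simply connected Heisenberg group onto its quotient `He_d`; as a map of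
spaces it is the product of the universal covering `ℝ → S^1` with the identity of `ℂ^d`. -/
def proj (d : ℕ) : SCGroup d →* HGroup d where
  toFun x := ((Circle.exp x.1, x.2) : Circle × Cd d)
  map_one' := Prod.ext Circle.exp_zero rfl
  map_mul' x y := Prod.ext (by
    change Circle.exp (x.1 + y.1 + omega x.2 y.2 / 2)
      = Circle.exp x.1 * Circle.exp y.1 * Circle.exp (omega x.2 y.2 / 2)
    rw [Circle.exp_add, Circle.exp_add]) rfl

theorem proj_surjective (d : ℕ) : Function.Surjective (proj d) := by
  intro x
  exact ⟨((Complex.arg x.1, x.2) : ℝ × Cd d), Prod.ext (Circle.exp_arg x.1) rfl⟩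

theorem mem_ker_proj {d : ℕ} (x : SCGroup d) :
    x ∈ (proj d).ker ↔ (∃ n : ℤ, x.1 = n * (2 * Real.pi)) ∧ x.2 = 0 := by
  rw [MonoidHom.mem_ker, ← Circle.exp_eq_one]
  exact Prod.ext_iff

/-! ### Circle actions and twisted Heisenberg groups -/

/-- A smooth action of the circle `S^1` on the Lie group `He_d` by automorphisms. -/
structure CircleAction (d : ℕ) where
  toHom : Circle →* MulAut (HGroup d)
  smooth : ContMDiff ((𝓡 1).prod (HCorners d)) (HCorners d) ∞
    (fun p : Circle × HGroup d => toHom p.1 p.2)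

/-- The sign condition: after conjugation by a linear symplectic transformation `g` of `ℂ^d`,
the action induced on the quotient `ℂ^d` of `He_d` by its center is diagonal, `θ` acting by
`θ ^ lam j` on the `j`-th coordinate (so that its generator has the eigenvalues `i * lam j`), where
the integers `lam j` are all nonzero and of the same sign. -/
def CircleAction.IsTwisted {d : ℕ} (ψ : CircleAction d) : Prop :=
  ∃ (g : Cd d ≃ₗ[ℝ] Cd d) (lam : Fin d → ℤ),
    (∀ X Y, omega (g X) (g Y) = omega X Y) ∧
    ((∀ j, 0 < lam j) ∨ (∀ j, lam j < 0)) ∧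
    ∀ (θ : Circle) (x : HGroup d) (j : Fin d),
      g (ψ.toHom θ x).2 j = ((θ ^ lam j : Circle) : ℂ) * g x.2 j

/-- The semidirect product `He_d ⋊ S^1` attached to an action of `S^1` on `He_d`. It is a twisted
Heisenberg group when `ψ.IsTwisted` holds. -/
def Semidirect {d : ℕ} (_ψ : CircleAction d) : Type := HGroup d × Circle

/-- The model space of a semidirect product. -/
abbrev SModel (d : ℕ) : Type := ModelProd (HModel d) (EuclideanSpace ℝ (Fin 1))

/-- The model with corners of a semidirect product. -/
abbrev SCorners (d : ℕ) :
    ModelWithCorners ℝ ((EuclideanSpace ℝ (Fin 1) × Cd d) × EuclideanSpace ℝ (Fin 1)) (SModel d) :=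
  (HCorners d).prod (𝓡 1)

namespace Semidirect

variable {d : ℕ} (ψ : CircleAction d)

instance : TopologicalSpace (Semidirect ψ) := inferInstanceAs (TopologicalSpace (HGroup d × Circle))

instance : ChartedSpace (SModel d) (Semidirect ψ) :=
  inferInstanceAs (ChartedSpace (SModel d) (HGroup d × Circle))

instance : IsManifold (SCorners d) ∞ (Semidirect ψ) :=
  inferInstanceAs (IsManifold (SCorners d) ∞ (HGroup d × Circle))

instance : Mul (Semidirect ψ) where
  mul x y := ((x.1 * ψ.toHom x.2 y.1, x.2 * y.2) : HGroup d × Circle)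

instance : One (Semidirect ψ) := ⟨((1, 1) : HGroup d × Circle)⟩

instance : Inv (Semidirect ψ) :=
  ⟨fun x => ((ψ.toHom x.2⁻¹ x.1⁻¹, x.2⁻¹) : HGroup d × Circle)⟩

theorem mul_def (x y : Semidirect ψ) :
    x * y = ((x.1 * ψ.toHom x.2 y.1, x.2 * y.2) : HGroup d × Circle) := rfl

theorem inv_def (x : Semidirect ψ) :
    x⁻¹ = ((ψ.toHom x.2⁻¹ x.1⁻¹, x.2⁻¹) : HGroup d × Circle) := rfl

instance : Group (Semidirect ψ) :=
  Group.ofLeftAxioms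
    (fun x y z => Prod.ext (by
        change x.1 * ψ.toHom x.2 y.1 * ψ.toHom (x.2 * y.2) z.1
          = x.1 * ψ.toHom x.2 (y.1 * ψ.toHom y.2 z.1)
        rw [map_mul, map_mul, MulAut.mul_apply, mul_assoc]) (mul_assoc x.2 y.2 z.2))
    (fun x => Prod.ext (by
        change 1 * ψ.toHom 1 x.1 = x.1
        simp) (one_mul x.2))
    (fun x => Prod.ext (by
        change ψ.toHom x.2⁻¹ x.1⁻¹ * ψ.toHom x.2⁻¹ x.1 = 1
        rw [← map_mul, inv_mul_cancel, map_one]) (inv_mul_cancel x.2))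

instance : LieGroup (SCorners d) ∞ (Semidirect ψ) where
  contMDiff_mul := by
    let P := HGroup d × Circle
    have h : ContMDiff ((SCorners d).prod (SCorners d)) (SCorners d) ∞
        (fun p : P × P => ((p.1.1 * ψ.toHom p.1.2 p.2.1, p.1.2 * p.2.2) : P)) := by
      have h1 : ContMDiff ((SCorners d).prod (SCorners d)) (HCorners d) ∞
          (fun p : P × P => p.1.1) := contMDiff_fst.comp contMDiff_fst
      have h2 : ContMDiff ((SCorners d).prod (SCorners d)) (𝓡 1) ∞
          (fun p : P × P => p.1.2) := contMDiff_snd.comp contMDiff_fst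
      have h3 : ContMDiff ((SCorners d).prod (SCorners d)) (HCorners d) ∞
          (fun p : P × P => p.2.1) := contMDiff_fst.comp contMDiff_snd
      have h4 : ContMDiff ((SCorners d).prod (SCorners d)) (𝓡 1) ∞
          (fun p : P × P => p.2.2) := contMDiff_snd.comp contMDiff_snd
      exact (h1.mul (ψ.smooth.comp (h2.prodMk h3))).prodMk (h2.mul h4)
    exact h
  contMDiff_inv := by
    let P := HGroup d × Circle
    have h : ContMDiff (SCorners d) (SCorners d) ∞
        (fun p : P => ((ψ.toHom p.2⁻¹ p.1⁻¹, p.2⁻¹) : P)) := by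
      have h1 : ContMDiff (SCorners d) (HCorners d) ∞ (fun p : P => p.1⁻¹) :=
        contMDiff_fst.inv
      have h2 : ContMDiff (SCorners d) (𝓡 1) ∞ (fun p : P => p.2⁻¹) := contMDiff_snd.inv
      exact (ψ.smooth.comp (h2.prodMk h1)).prodMk h2
    exact h

instance : LieGroup (SCorners d) (minSmoothness ℝ 3) (Semidirect ψ) := by
  rw [minSmoothness_of_isRCLikeNormedField]
  infer_instance

/-- The inclusion of `He_d` as a normal subgroup. -/
def inl : HGroup d →* Semidirect ψ where
  toFun x := ((x, 1) : HGroup d × Circle)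
  map_one' := rfl
  map_mul' x y := Prod.ext (by
    change x * y = x * ψ.toHom 1 y
    simp) (one_mul (1 : Circle)).symm

end Semidirect

/-! ### Lorentz forms, bi-invariant Lorentz metrics, lattices -/

/-- A symmetric form on a real vector space is Lorentzian, i.e. of signature `(1, n - 1)` with one
negative direction, if it is negative on some vector `v` and positive definite on the orthogonal of
`v`. It is then nondegenerate. -/
def IsLorentzian {V : Type*} [AddCommGroup V] [Module ℝ V] (B : LinearMap.BilinForm ℝ V) : Prop :=
  (∀ v w, B v w = B w v) ∧ ∃ v, B v v < 0 ∧ ∀ w, w ≠ 0 → B v w = 0 → 0 < B w w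

open Bundle in
/-- A smooth bi-invariant Lorentz metric on a Lie group. -/
structure BiinvariantLorentzMetric {E : Type*} [NormedAddCommGroup E] [NormedSpace ℝ E]
    {H : Type*} [TopologicalSpace H] (I : ModelWithCorners ℝ E H)
    (G : Type*) [TopologicalSpace G] [ChartedSpace H G] [Group G] [IsManifold I ∞ G] where
  form : ∀ x : G, TangentSpace I x →L[ℝ] TangentSpace I x →L[ℝ] ℝ
  lorentzian : ∀ x : G, IsLorentzian (V := TangentSpace I x)
    (LinearMap.mk₂ ℝ (fun v w => form x v w) (by simp) (by simp) (by simp) (by simp))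
  contMDiff : ContMDiff I (I.prod 𝓘(ℝ, E →L[ℝ] E →L[ℝ] ℝ)) ∞
    (fun x : G => TotalSpace.mk' (E →L[ℝ] E →L[ℝ] ℝ)
      (E := fun x : G => TangentSpace I x →L[ℝ] TangentSpace I x →L[ℝ] ℝ) x (form x))
  left_invariant : ∀ (a x : G) (v w : TangentSpace I x),
    form (a * x) (mfderiv I I (fun y : G => a * y) x v) (mfderiv I I (fun y : G => a * y) x w)
      = form x v w
  right_invariant : ∀ (a x : G) (v w : TangentSpace I x),
    form (x * a) (mfderiv I I (fun y : G => y * a) x v) (mfderiv I I (fun y : G => y * a) x w)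
      = form x v w

open MeasureTheory in
/-- A lattice of a topological group `G`: a discrete subgroup `Γ` such that `G ⧸ Γ` carries a
nonzero finite Borel measure invariant under `G`. -/
def IsLattice {G : Type*} [Group G] [TopologicalSpace G] (Γ : Subgroup G) : Prop :=
  DiscreteTopology Γ ∧
    ∃ (_ : MeasurableSpace (G ⧸ Γ)) (_ : BorelSpace (G ⧸ Γ)) (μ : Measure (G ⧸ Γ)),
      IsFiniteMeasure μ ∧ μ ≠ 0 ∧ ∀ g : G, μ.map (fun x => g • x) = μ

/-! ### Semidirect products of `S^1` with the Heisenberg algebra -/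

/-- An action of the circle `S^1` on the Lie algebra `HE_d` by automorphisms, with its infinitesimal
generator: the derivation `gen` with `s ↦ ρ(e^{is}) = exp (s gen)`. -/
structure AlgebraCircleAction (d : ℕ) where
  toHom : Circle →* Module.End ℝ (HAlg d)
  map_lie : ∀ (θ : Circle) (x y : HAlg d), toHom θ ⁅x, y⁆ = ⁅toHom θ x, toHom θ y⁆
  gen : LieDerivation ℝ (HAlg d) (HAlg d)
  hasDerivAt : ∀ x : HAlg d, HasDerivAt (fun s : ℝ => toHom (Circle.exp s) x) (gen x) 0

section

/- The commutator bracket of `ℝ`, which is zero: `ℝ` is the Lie algebra of `S^1`. -/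
attribute [local instance] LieRing.ofAssociativeRing

/-- The homomorphism `a ↦ a • gen` from the Lie algebra `ℝ` of `S^1` to the derivations of
`HE_d`. -/
def AlgebraCircleAction.genHom {d : ℕ} (ρ : AlgebraCircleAction d) :
    ℝ →ₗ⁅ℝ⁆ LieDerivation ℝ (HAlg d) (HAlg d) where
  toLinearMap := LinearMap.toSpanSingleton ℝ _ ρ.gen
  map_lie' {a b} := by simp [Ring.lie_def, mul_comm]

/-- The Lie algebra semidirect product of `S^1` with `HE_d`: the space `HE_d ⊕ ℝ t` with
`[t, x] = gen x` for `x` in `HE_d`. -/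
abbrev AlgebraCircleAction.SemidirectAlgebra {d : ℕ} (ρ : AlgebraCircleAction d) : Type :=
  LieAlgebra.SemiDirectSum (HAlg d) ℝ ρ.genHom

end

end Heisenberg

end

/-!
A twisted Heisenberg group is a quotient of the group `ℝ × ℂ^d × ℝ` with the product `coordMul`,
and everything about its Lie algebra is computed there.

*Bi-invariant metrics.* An action of the circle on `He_d` acts trivially on the centre, and it
differs from its induced action on `ℂ^d` by a cocycle of characters, which is a coboundary since the
weights are nonzero (`CircleAction.exists_isNormalForm`). In the resulting coordinates the form
`Σ |X j| ^ 2 / |lam j| + 2 ε s t`, with `ε` the common sign of the weights, is Lorentzian and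
invariant under the adjoint action (`coordForm`), and a form on the Lie algebra invariant under the
adjoint action extends by left translation to a bi-invariant metric
(`nonempty_biinvariantLorentzMetric`).

*Converse.* Let `B` be an invariant Lorentz form on `HE_d ⊕ ℝ t`, and let `D` be the map induced by
the generator on `ℂ^d`. The flow being periodic, the generator kills the central element `Z`
(`AlgebraCircleAction.gen_center`). Invariance makes `Z` an isotropic vector orthogonal to `HE_d`, so
`B` is positive definite on `HE_d` modulo `Z`. From `B ⁅t, x⁆ ⁅t, x⁆ = B t Z * omega x (D x)` the
form `omega x (D x)` is definite (`AlgebraCircleAction.exists_mul_omega_pos`). Hence `D` is diagonal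
in symplectic coordinates, with eigenvalues `i lam j` of one sign
(`exists_symplectic_diagonalization`), and the `lam j` are integers by periodicity.

*Lattices of `He_d` and of its universal covering.* For an open surjective homomorphism with discrete
kernel the quotients by `Λ` and by its preimage are the same (`isLattice_comap_iff`). The projection
to `ℂ^d` of a lattice of the covering group spans `ℂ^d`, as otherwise a linear form would push the
invariant measure to a finite Haar measure of `ℝ`; taking commutators, the lattice meets the centre
(`IsLattice.exists_mem_centralPart`). Its image in `He_d` is discrete exactly when it meets `2πℤ`
(`IsLattice.inf_ker_proj_ne_bot`, `IsLattice.map_proj`), which a dilation achieves.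

*Lattices of `He_d` and of `He_d ⋊ S^1`.* As a space, the quotient of `He_d ⋊ S^1` by a lattice of
`He_d` is the product of `S^1` with a quotient of finite measure, on which the group acts by skew
products (`IsLattice.map_inl`). Conversely a discrete subgroup `Γ` of `He_d ⋊ S^1` has a finite image
in `S^1` because the weights are nonzero (`finite_image_rightHom`). When `Γ` is a lattice, Poincaré
recurrence for the translations by `He_d` shows that the projection of `Γ ∩ He_d` spans `ℂ^d`
(`IsLattice.span_planar_eq_top`). A discrete subgroup of `He_d` with this property is cocompact,
hence a lattice (`isLattice_of_span_eq_top`).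
-/

noncomputable section

open Bundle VectorField

namespace Heisenberg

/-! ### Bi-invariant metrics from invariant forms at the identity -/

section
variable {E : Type*} [NormedAddCommGroup E] [NormedSpace ℝ E]
    {H : Type*} [TopologicalSpace H] {I : ModelWithCorners ℝ E H}
    {G : Type*} [TopologicalSpace G] [ChartedSpace H G] [Group G]

/-- The left Maurer–Cartan form: the derivative at `x` of `y ↦ x⁻¹ * y`. The tangent space at
`x⁻¹ * x = 1` is replaced by the model space `E`, so that the forms at all points `x` take their
values in one and the same space. -/
def leftMaurerCartan (I : ModelWithCorners ℝ E H) (x : G) : TangentSpace I x →L[ℝ] E :=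
  mfderiv I I (fun y : G => x⁻¹ * y) x

/-- The field of bilinear forms obtained from the form `b` on the tangent space at the identity by
left translation. -/
def leftInvariantForm (I : ModelWithCorners ℝ E H) (b : E →L[ℝ] E →L[ℝ] ℝ) (x : G) :
    TangentSpace I x →L[ℝ] TangentSpace I x →L[ℝ] ℝ :=
  b.bilinearComp (E' := E) (F' := E) (leftMaurerCartan I x) (leftMaurerCartan I x)

theorem leftInvariantForm_apply (b : E →L[ℝ] E →L[ℝ] ℝ) (x : G) (v w : TangentSpace I x) :
    leftInvariantForm I b x v w = b (leftMaurerCartan I x v) (leftMaurerCartan I x w) := rfl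

variable [LieGroup I ∞ G]

/-- The Maurer–Cartan form is smooth: it is the partial derivative in `y`, along the diagonal, of the
smooth function `x⁻¹ * y`. The trivialization of the tangent bundle at the identity is the identity
of the model space, whence the absence of a coordinate change in the target. -/
theorem contMDiffAt_leftMaurerCartan (x₀ : G) :
    ContMDiffAt I 𝓘(ℝ, E →L[ℝ] E) ∞ (fun x : G => (leftMaurerCartan I x).comp
      ((trivializationAt E (TangentSpace I) x₀).symmL ℝ x)) x₀ := by
  have hf : ContMDiffAt (I.prod I) I ∞ (Function.uncurry fun x y : G => x⁻¹ * y) (x₀, x₀) :=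
    (contMDiff_fst.inv.mul contMDiff_snd).contMDiffAt
  have : IsManifold I 1 G := .of_le (n := ∞) (by simp)
  have h := ContMDiffAt.mfderiv (I := I) (I' := I) (J := I) (m := ∞) (n := ∞) (x₀ := x₀)
    (fun x y : G => x⁻¹ * y) id hf contMDiffAt_id (by simp)
  refine h.congr_of_eventuallyEq (Filter.Eventually.of_forall fun x => ?_)
  unfold inTangentCoordinates ContinuousLinearMap.inCoordinates
  ext v
  have e1 : x₀⁻¹ * x₀ = 1 := inv_mul_cancel x₀
  have e2 : x⁻¹ * x = 1 := inv_mul_cancel x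
  change leftMaurerCartan I x (((trivializationAt E (TangentSpace I) x₀).symmL ℝ x) v) =
    ((trivializationAt E (TangentSpace I) (x₀⁻¹ * x₀)).continuousLinearMapAt ℝ (x⁻¹ * x))
     (leftMaurerCartan I x (((trivializationAt E (TangentSpace I) x₀).symmL ℝ x) v))
  generalize leftMaurerCartan I x (((trivializationAt E (TangentSpace I) x₀).symmL ℝ x) v) = w
  rw [e1, e2, TangentBundle.continuousLinearMapAt_trivializationAt_eq_core (by simp)]
  exact ((tangentBundleCore I G).coordChange_self (achart H (1 : G)) (1 : G)
    (mem_chart_source H (1 : G)) w).symm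

theorem contMDiff_leftInvariantForm (b : E →L[ℝ] E →L[ℝ] ℝ) :
    ContMDiff I (I.prod 𝓘(ℝ, E →L[ℝ] E →L[ℝ] ℝ)) ∞
    (fun x : G => TotalSpace.mk' (E →L[ℝ] E →L[ℝ] ℝ)
      (E := fun x : G => TangentSpace I x →L[ℝ] TangentSpace I x →L[ℝ] ℝ) x
      (leftInvariantForm I b x)) := by
  intro x₀
  rw [contMDiffAt_section]
  have h := contMDiffAt_leftMaurerCartan (I := I) x₀
  let Θ : G → E →L[ℝ] E := fun x => (leftMaurerCartan I x).comp
      ((trivializationAt E (TangentSpace I) x₀).symmL ℝ x)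
  have h2 : ContMDiffAt I 𝓘(ℝ, E →L[ℝ] E →L[ℝ] ℝ) ∞ (fun x => b.bilinearComp (Θ x) (Θ x)) x₀ := by
    have hc : ContDiff ℝ ∞ (fun T : E →L[ℝ] E => b.bilinearComp T T) := by
      have h3 : ContDiff ℝ ∞ (fun T : E →L[ℝ] E =>
          ((ContinuousLinearMap.compL ℝ E E ℝ).flip T).comp (b.comp T)) := by
        fun_prop
      exact h3
    exact hc.contMDiff.contMDiffAt.comp x₀ h
  refine h2.congr_of_eventuallyEq ?_
  filter_upwards [(trivializationAt E (TangentSpace I) x₀).open_baseSet.mem_nhds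
    (FiberBundle.mem_baseSet_trivializationAt' x₀)] with x hx
  rw [hom_trivializationAt_apply]
  ext v w
  simp [ContinuousLinearMap.inCoordinates]
  have hx' : x ∈ (trivializationAt (E →L[ℝ] ℝ) (fun x => TangentSpace I x →L[ℝ] ℝ) x₀).baseSet := by
    rw [hom_trivializationAt_baseSet]
    exact ⟨hx, Set.mem_univ _⟩
  have := hom_trivializationAt_apply (σ := RingHom.id ℝ) (F₁ := E)
    (E₁ := (TangentSpace I : G → Type _)) (F₂ := ℝ) (E₂ := Bundle.Trivial G ℝ) x₀
    ⟨x, ((leftInvariantForm I b x)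
      ((Trivialization.symmL ℝ (trivializationAt E (TangentSpace I) x₀) x) v))⟩
  rw [Trivialization.coe_linearMapAt_of_mem _ hx']
  have h4 := congrArg (fun p => p.2 w) this
  simp only [ContinuousLinearMap.inCoordinates, ContinuousLinearMap.comp_apply] at h4
  refine h4.trans ?_
  have h5 := Bundle.Trivial.continuousLinearMapAt_trivialization ℝ G ℝ x
  exact congrArg (fun T : ℝ →L[ℝ] ℝ => T (b (Θ x v) (Θ x w))) h5

variable (I) in
/-- The derivative of `y ↦ a * y * a⁻¹` at a point `x`, as an endomorphism of the model space. For
`x = 1` it is the adjoint action of `a`. -/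
def conjDeriv (a x : G) : E →L[ℝ] E := mfderiv I I (fun y : G => a * y * a⁻¹) x

theorem mdifferentiable_mul_left' (a : G) : MDifferentiable I I (fun y : G => a * y) :=
  (contMDiff_mul_left (I := I) (n := ∞) (a := a)).mdifferentiable (by simp)

theorem mdifferentiable_mul_right' (a : G) : MDifferentiable I I (fun y : G => y * a) :=
  (contMDiff_mul_right (I := I) (n := ∞) (a := a)).mdifferentiable (by simp)

theorem leftMaurerCartan_mul_left (a x : G) (v : TangentSpace I x) :
    leftMaurerCartan I (a * x) (mfderiv I I (fun y : G => a * y) x v) = leftMaurerCartan I x v := by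
  have h : (fun y : G => x⁻¹ * y) = (fun y => (a * x)⁻¹ * y) ∘ fun y => a * y := by
    funext y; simp [mul_assoc]
  have h2 : mfderiv I I (fun y : G => x⁻¹ * y) x = _ :=
    h ▸ mfderiv_comp x (mdifferentiable_mul_left' (I := I) (a * x)⁻¹ (a * x))
      (mdifferentiable_mul_left' a x)
  exact (congrArg (fun T : E →L[ℝ] E => T v) h2).symm

theorem leftMaurerCartan_mul_right (a x : G) (v : TangentSpace I x) :
    leftMaurerCartan I (x * a) (mfderiv I I (fun y : G => y * a) x v)
      = conjDeriv I a⁻¹ 1 (leftMaurerCartan I x v) := by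
  have h : ((fun y => (x * a)⁻¹ * y) ∘ fun y => y * a)
      = (fun y => a⁻¹ * y * a⁻¹⁻¹) ∘ fun y : G => x⁻¹ * y := by
    funext y; simp [mul_assoc]
  have h1 : mfderiv I I ((fun y => (x * a)⁻¹ * y) ∘ fun y => y * a) x = _ :=
    mfderiv_comp x (mdifferentiable_mul_left' (I := I) (x * a)⁻¹ (x * a))
      (mdifferentiable_mul_right' a x)
  have h2 : mfderiv I I ((fun y => a⁻¹ * y * a⁻¹⁻¹) ∘ fun y : G => x⁻¹ * y) x = _ :=
    mfderiv_comp x (((mdifferentiable_mul_right' (I := I) (a⁻¹⁻¹)).comp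
      (mdifferentiable_mul_left' (a⁻¹))) (x⁻¹ * x)) (mdifferentiable_mul_left' (I := I) x⁻¹ x)
  rw [h] at h1
  have h3 := h1.symm.trans h2
  have h4 : conjDeriv I a⁻¹ (x⁻¹ * x) = conjDeriv I a⁻¹ 1 := by rw [inv_mul_cancel]
  rw [← h4]
  exact congrArg (fun T : E →L[ℝ] E => T v) h3

theorem leftMaurerCartan_bijective (x : G) : Function.Bijective (leftMaurerCartan I x) := by
  have hl : ∀ v : E, mfderiv I I (fun y : G => x * y) (x⁻¹ * x) (leftMaurerCartan I x v) = v := by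
    have h : (fun y : G => x * y) ∘ (fun y => x⁻¹ * y) = id := by funext y; simp
    have h1 : mfderiv I I ((fun y : G => x * y) ∘ (fun y => x⁻¹ * y)) x = _ :=
      mfderiv_comp x (mdifferentiable_mul_left' (I := I) x (x⁻¹ * x))
        (mdifferentiable_mul_left' (I := I) x⁻¹ x)
    rw [h, mfderiv_id] at h1
    exact fun v => (congrArg (fun T : E →L[ℝ] E => T v) h1).symm
  have hr : ∀ v : TangentSpace I (1 : G),
      leftMaurerCartan I (x * 1) (mfderiv I I (fun y : G => x * y) 1 v) = v := by
    intro v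
    rw [leftMaurerCartan_mul_left]
    have h : (fun y : G => (1 : G)⁻¹ * y) = id := by funext y; simp
    have h1 : mfderiv I I (fun y : G => (1 : G)⁻¹ * y) 1 = mfderiv I I (id : G → G) 1 := by rw [h]
    rw [mfderiv_id] at h1
    exact congrArg (fun T : E →L[ℝ] E => T v) h1
  refine ⟨Function.LeftInverse.injective hl, fun v => ?_⟩
  have hs : ∀ v : E, ∃ w : E, (leftMaurerCartan I (x * 1) : E →L[ℝ] E) w = v :=
    fun v => ⟨_, hr v⟩
  rw [mul_one] at hs
  exact hs v

/-- An `Ad`-invariant Lorentz form on the tangent space at the identity extends to a bi-invariant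
Lorentz metric by left translation. -/
theorem nonempty_biinvariantLorentzMetric (b : E →L[ℝ] E →L[ℝ] ℝ) (hsymm : ∀ v w, b v w = b w v)
    (v₀ : E) (hv₀ : b v₀ v₀ < 0) (hpos : ∀ w, w ≠ 0 → b v₀ w = 0 → 0 < b w w)
    (hinv : ∀ (a : G) (v w : E), b (conjDeriv I a 1 v) (conjDeriv I a 1 w) = b v w) :
    Nonempty (BiinvariantLorentzMetric I G) := by
  refine ⟨⟨leftInvariantForm I b, fun x => ⟨fun v w => hsymm _ _, ?_⟩,
    contMDiff_leftInvariantForm b, fun a x v w => ?_, fun a x v w => ?_⟩⟩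
  · obtain ⟨v, rfl⟩ := (leftMaurerCartan_bijective (I := I) x).2 v₀
    refine ⟨v, hv₀, fun w hw h => hpos _ (fun h0 => hw ?_) h⟩
    exact (leftMaurerCartan_bijective (I := I) x).1 (h0.trans (map_zero (leftMaurerCartan I x)).symm)
  · rw [leftInvariantForm_apply, leftInvariantForm_apply, leftMaurerCartan_mul_left,
      leftMaurerCartan_mul_left]
  · rw [leftInvariantForm_apply, leftInvariantForm_apply, leftMaurerCartan_mul_right,
      leftMaurerCartan_mul_right, hinv]

end

/-! ### Adjoint action and Lie bracket in coordinates around the identity -/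

section
variable {E : Type*} [NormedAddCommGroup E] [NormedSpace ℝ E]
    {H : Type*} [TopologicalSpace H] {I : ModelWithCorners ℝ E H}
    {G : Type*} [TopologicalSpace G] [ChartedSpace H G] [Group G] [LieGroup I ∞ G]
    {V : Type*} [NormedAddCommGroup V] [NormedSpace ℝ V] {F : V → G} {T : V ≃L[ℝ] E}

variable (I) in
/-- The derivative at `p` of a map from a vector space to a manifold, with values in the model
space. -/
def modelDeriv (F : V → G) (p : V) : V →L[ℝ] E := mfderiv 𝓘(ℝ, V) I F p

/-- If the coordinates `F : V → G` carry the map `c` to the conjugation by `a`, they carry the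
derivative of `c` to the adjoint action of `a`. -/
theorem conjDeriv_apply_of_conj (hF : ContMDiff 𝓘(ℝ, V) I ∞ F) (hF0 : F 0 = 1)
    (hT : modelDeriv I F 0 = (T : V →L[ℝ] E)) {a : G} {c : V → V} {C : V →L[ℝ] V}
    (hc : HasFDerivAt c C 0) (hc0 : c 0 = 0) (h : ∀ y, F (c y) = a * F y * a⁻¹) (v : V) :
    conjDeriv I a 1 (T v) = T (C v) := by
  have hd : MDifferentiable 𝓘(ℝ, V) I F := hF.mdifferentiable (by simp)
  have e : F ∘ c = (fun y => a * y * a⁻¹) ∘ F := funext h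
  have h1 : mfderiv 𝓘(ℝ, V) I (F ∘ c) 0 = _ :=
    mfderiv_comp 0 (hd (c 0)) hc.differentiableAt.mdifferentiableAt
  have h2 : mfderiv 𝓘(ℝ, V) I ((fun y => a * y * a⁻¹) ∘ F) 0 = _ :=
    mfderiv_comp 0 (((mdifferentiable_mul_right' (I := I) a⁻¹).comp
      (mdifferentiable_mul_left' a)) (F 0)) (hd 0)
  rw [e] at h1
  have h3 := congrArg (fun S : V →L[ℝ] E => S v) (h1.symm.trans h2)
  have h4 : conjDeriv I a (F 0) = conjDeriv I a 1 := by rw [hF0]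
  have h5 : modelDeriv I F (c 0) = (T : V →L[ℝ] E) := by rw [hc0]; exact hT
  have h6 : (mfderiv 𝓘(ℝ, V) 𝓘(ℝ, V) c 0 : V →L[ℝ] V) = C := by
    rw [mfderiv_eq_fderiv]; exact hc.fderiv
  have h7 : modelDeriv I F (c 0) ((mfderiv 𝓘(ℝ, V) 𝓘(ℝ, V) c 0 : V →L[ℝ] V) v)
      = conjDeriv I a (F 0) (modelDeriv I F 0 v) := h3
  rw [h4, h5, h6, hT] at h7
  exact h7.symm

/-- If the coordinates `F : V → G` carry `m` to the left translation by `F p`, the left-invariant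
vector field with value `T v` at the identity is the image at `F p` of the vector `M v`, where `M`
is the derivative of `m` at the origin. -/
theorem mulInvariantVectorField_comp_eq (hF : ContMDiff 𝓘(ℝ, V) I ∞ F) (hF0 : F 0 = 1)
    (hT : modelDeriv I F 0 = (T : V →L[ℝ] E)) {p : V} {m : V → V} {M : V →L[ℝ] V}
    (hm : HasFDerivAt m M 0) (hm0 : m 0 = p) (h : ∀ y, F (m y) = F p * F y) (v : V) :
    mulInvariantVectorField (I := I) (G := G) (T v) (F p)
      = modelDeriv I F p (M v) := by
  have hd : MDifferentiable 𝓘(ℝ, V) I F := hF.mdifferentiable (by simp)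
  have e : F ∘ m = (fun y => F p * y) ∘ F := funext h
  have h1 : mfderiv 𝓘(ℝ, V) I (F ∘ m) 0 = _ :=
    mfderiv_comp 0 (hd (m 0)) hm.differentiableAt.mdifferentiableAt
  have h2 : mfderiv 𝓘(ℝ, V) I ((fun y => F p * y) ∘ F) 0 = _ :=
    mfderiv_comp 0 ((mdifferentiable_mul_left' (I := I) (F p)) (F 0)) (hd 0)
  rw [e] at h1
  have h3 := congrArg (fun S : V →L[ℝ] E => S v) (h1.symm.trans h2)
  have h4 : (mfderiv I I (fun y => F p * y) (F 0) : E →L[ℝ] E)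
      = (mfderiv I I (fun y => F p * y) (1 : G) : E →L[ℝ] E) := by rw [hF0]
  have h5 : modelDeriv I F (m 0) = modelDeriv I F p := by
    rw [hm0]
  have h6 : (mfderiv 𝓘(ℝ, V) 𝓘(ℝ, V) m 0 : V →L[ℝ] V) = M := by
    rw [mfderiv_eq_fderiv]; exact hm.fderiv
  have h7 : modelDeriv I F (m 0) ((mfderiv 𝓘(ℝ, V) 𝓘(ℝ, V) m 0 : V →L[ℝ] V) v)
      = (mfderiv I I (fun y => F p * y) (F 0) : E →L[ℝ] E)
        (modelDeriv I F 0 v) := h3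
  rw [h4, h5, h6, hT] at h7
  exact h7.symm

theorem mpullback_mulInvariantVectorField_eq [FiniteDimensional ℝ V]
    (hF : ContMDiff 𝓘(ℝ, V) I ∞ F) (hF0 : F 0 = 1)
    (hT : modelDeriv I F 0 = (T : V →L[ℝ] E)) {p : V} {m : V → V} {M : V →L[ℝ] V}
    (hM : Function.Surjective M)
    (hm : HasFDerivAt m M 0) (hm0 : m 0 = p) (h : ∀ y, F (m y) = F p * F y) (v : V) :
    mpullback 𝓘(ℝ, V) I F (mulInvariantVectorField (I := I) (G := G) (T v)) p = M v := by
  have hE : FiniteDimensional ℝ E := T.toLinearEquiv.finiteDimensional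
  have key := mulInvariantVectorField_comp_eq hF hF0 hT hm hm0 h
  set S : V →L[ℝ] E := modelDeriv I F p with hS
  -- `F` is a local diffeomorphism at `p`, being one at the origin: this gives `mpullback`, defined
  -- by means of the inverse of `S`, its meaning.
  have hinj : Function.Injective S := by
    refine (injective_iff_map_eq_zero S).2 fun u hu => ?_
    obtain ⟨w, rfl⟩ := hM u
    have h1 : (mfderiv I I (fun y : G => F p * y) 1 : E →L[ℝ] E) (T w) = 0 := (key w).trans hu
    have h2 := leftMaurerCartan_mul_left (I := I) (F p) 1 (T w)
    have h3 : leftMaurerCartan I (1 : G) (T w) = 0 := by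
      rw [← h2]
      exact (congrArg (leftMaurerCartan I (F p * 1)) h1).trans
        (map_zero (leftMaurerCartan I (F p * 1)))
    have h4 : (T w : E) = 0 := (leftMaurerCartan_bijective (I := I) (1 : G)).1
      (h3.trans (map_zero (leftMaurerCartan I (1 : G))).symm)
    rw [T.map_eq_zero_iff.1 h4, map_zero]
  let e : V ≃L[ℝ] E := (LinearEquiv.ofInjectiveOfFinrankEq S.toLinearMap hinj
    T.toLinearEquiv.finrank_eq).toContinuousLinearEquiv
  have he : S = (e : V →L[ℝ] E) := by ext u; rfl
  change S.inverse (mulInvariantVectorField (I := I) (G := G) (T v) (F p)) = M v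
  rw [key v, he, ContinuousLinearMap.inverse_equiv]
  exact e.symm_apply_apply _

theorem mlieBracket_vectorSpace (A B : ∀ x : V, TangentSpace 𝓘(ℝ, V) x) (x : V) :
    mlieBracket 𝓘(ℝ, V) A B x = lieBracket ℝ A B x := by
  rw [← mlieBracketWithin_univ, mlieBracketWithin_eq_lieBracketWithin]
  exact congrFun (lieBracketWithin_univ (𝕜 := ℝ) (V := A) (W := B)) x

variable [LieGroup I (minSmoothness ℝ 3) G]

/-- The bracket of the Lie algebra of a Lie group, in coordinates `F : V → G` around the identity:
`M p` is the derivative at the origin of the left translation by `p`. -/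
theorem lie_apply_of_coordinates [FiniteDimensional ℝ V]
    (hF : ContMDiff 𝓘(ℝ, V) I ∞ F) (hF0 : F 0 = 1)
    (hT : modelDeriv I F 0 = (T : V →L[ℝ] E)) {m : V → V → V} {M : V → V →L[ℝ] V}
    (hM : ∀ p, Function.Surjective (M p))
    (hm : ∀ p, HasFDerivAt (m p) (M p) 0) (hm0 : ∀ p, m p 0 = p)
    (h : ∀ p y, F (m p y) = F p * F y) (v w : V) :
    @Bracket.bracket (GroupLieAlgebra I G) (GroupLieAlgebra I G) _ (T v) (T w)
      = T (lieBracket ℝ (fun p => M p v) (fun p => M p w) 0) := by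
  have hE : FiniteDimensional ℝ E := T.toLinearEquiv.finiteDimensional
  have hc : CompleteSpace E := FiniteDimensional.complete ℝ E
  have hc' : CompleteSpace V := FiniteDimensional.complete ℝ V
  have h2 := mpullback_mlieBracket (I := 𝓘(ℝ, V)) (I' := I) (n := ∞) (f := F) (x₀ := 0)
    (V := mulInvariantVectorField (I := I) (G := G) (T v))
    (W := mulInvariantVectorField (I := I) (G := G) (T w))
    (mdifferentiableAt_mulInvariantVectorField _) (mdifferentiableAt_mulInvariantVectorField _)
    hF.contMDiffAt (by
      rw [minSmoothness_of_isRCLikeNormedField]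
      exact WithTop.coe_le_coe.2 le_top)
  have e : ∀ u, mpullback 𝓘(ℝ, V) I F (mulInvariantVectorField (I := I) (G := G) (T u))
      = fun p => M p u := fun u => funext fun p =>
    mpullback_mulInvariantVectorField_eq hF hF0 hT (hM p) (hm p) (hm0 p) (h p) u
  have h3 := (congrArg₂ (fun A B => mlieBracket 𝓘(ℝ, V) A B 0) (e v) (e w)).trans
    (mlieBracket_vectorSpace _ _ 0)
  have h4 : (modelDeriv I F 0).inverse (mlieBracket I (mulInvariantVectorField (I := I) (G := G)
      (T v)) (mulInvariantVectorField (I := I) (G := G) (T w)) (F 0))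
      = lieBracket ℝ (fun p => M p v) (fun p => M p w) 0 := h2.trans h3
  rw [hT, ContinuousLinearMap.inverse_equiv, hF0] at h4
  exact (T.symm_apply_eq.1 h4)

end

/-! ### Coordinates on a semidirect product -/

/-- The linear action of the circle on `ℂ^d` with weights `lam`. -/
def rot {d : ℕ} (lam : Fin d → ℤ) (θ : Circle) : Cd d →ₗ[ℝ] Cd d where
  toFun X j := ((θ ^ lam j : Circle) : ℂ) * X j
  map_add' X Y := by ext j; simp [mul_add]
  map_smul' c X := by ext j; simp [mul_left_comm]

theorem rot_apply {d : ℕ} (lam : Fin d → ℤ) (θ : Circle) (X : Cd d) (j : Fin d) :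
    rot lam θ X j = ((θ ^ lam j : Circle) : ℂ) * X j := rfl

theorem rot_mul {d : ℕ} (lam : Fin d → ℤ) (θ η : Circle) (X : Cd d) :
    rot lam (θ * η) X = rot lam θ (rot lam η X) := by
  ext j; simp [rot_apply, mul_zpow, mul_assoc]

@[simp] theorem rot_one {d : ℕ} (lam : Fin d → ℤ) (X : Cd d) : rot lam 1 X = X := by
  ext j; simp [rot_apply]

theorem rot_inv_apply_rot {d : ℕ} (lam : Fin d → ℤ) (θ : Circle) (X : Cd d) :
    rot lam θ⁻¹ (rot lam θ X) = X := by rw [← rot_mul, inv_mul_cancel, rot_one]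

theorem rot_apply_rot_inv {d : ℕ} (lam : Fin d → ℤ) (θ : Circle) (X : Cd d) :
    rot lam θ (rot lam θ⁻¹ X) = X := by rw [← rot_mul, mul_inv_cancel, rot_one]

theorem omega_rot {d : ℕ} (lam : Fin d → ℤ) (θ : Circle) (X Y : Cd d) :
    omega (rot lam θ X) (rot lam θ Y) = omega X Y := by
  refine Finset.sum_congr rfl fun k _ => ?_
  rw [rot_apply, rot_apply, map_mul, mul_mul_mul_comm, ← Complex.normSq_eq_conj_mul_self]
  simp [-Circle.coe_zpow]

/-- The underlying space of the universal covering of a twisted Heisenberg group: the coordinates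
of the centre, of `ℂ^d` and of the circle. -/
abbrev Coord (d : ℕ) : Type := ℝ × Cd d × ℝ

/-- The product `p * y` in the universal covering `ℝ × ℂ^d × ℝ` of the twisted Heisenberg group of
weights `lam`. -/
def coordMul {d : ℕ} (lam : Fin d → ℤ) (p y : Coord d) : Coord d :=
  (p.1 + y.1 + omega p.2.1 (rot lam (Circle.exp p.2.2) y.2.1) / 2,
    p.2.1 + rot lam (Circle.exp p.2.2) y.2.1, p.2.2 + y.2.2)

/-- The element of `He_d` with given components. -/
def HGroup.mk {d : ℕ} (z : Circle) (X : Cd d) : HGroup d := ((z, X) : Circle × Cd d)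

theorem HGroup.continuous_mk {d : ℕ} : Continuous fun p : Circle × Cd d => HGroup.mk p.1 p.2 :=
  continuous_id

theorem HGroup.mk_mul_mk {d : ℕ} (z w : Circle) (X Y : Cd d) :
    HGroup.mk z X * HGroup.mk w Y = HGroup.mk (z * w * Circle.exp (omega X Y / 2)) (X + Y) := rfl

theorem HGroup.mk_zero_mul {d : ℕ} (z w : Circle) (X : Cd d) :
    HGroup.mk z 0 * HGroup.mk w X = HGroup.mk (z * w) X := by
  rw [HGroup.mk_mul_mk]
  simp

theorem HGroup.mk_inj {d : ℕ} {z w : Circle} {X Y : Cd d} :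
    HGroup.mk z X = HGroup.mk w Y ↔ z = w ∧ X = Y := Prod.ext_iff

/-- The parametrization of `He_d ⋊ S^1` by `ℝ × ℂ^d × ℝ` attached to a linear map `h` and a linear
form `μ`. For an action in normal form it is a homomorphism from the covering group, see
`IsNormalForm.coordMap_coordMul`. -/
def coordMap {d : ℕ} (ψ : CircleAction d) (h : Cd d →ₗ[ℝ] Cd d) (μ : Cd d →ₗ[ℝ] ℝ) (p : Coord d) :
    Semidirect ψ :=
  (HGroup.mk (Circle.exp (p.1 + μ p.2.1)) (h p.2.1), Circle.exp p.2.2)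

/-- The action `ψ` is, up to the automorphism `(z, X) ↦ (z * exp (i μ X), h X)` of `He_d`, the
standard action with weights `lam`. -/
structure IsNormalForm {d : ℕ} (ψ : CircleAction d) (lam : Fin d → ℤ) (h : Cd d ≃ₗ[ℝ] Cd d)
    (μ : Cd d →ₗ[ℝ] ℝ) : Prop where
  omega_map : ∀ X Y, omega (h X) (h Y) = omega X Y
  apply_eq : ∀ (θ : Circle) (z : Circle) (X : Cd d),
    ψ.toHom θ (HGroup.mk (z * Circle.exp (μ X)) (h X))
      = HGroup.mk (z * Circle.exp (μ (rot lam θ X))) (h (rot lam θ X))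

section
variable {d : ℕ} {ψ : CircleAction d} {lam : Fin d → ℤ} {h : Cd d ≃ₗ[ℝ] Cd d} {μ : Cd d →ₗ[ℝ] ℝ}

theorem IsNormalForm.coordMap_coordMul (H : IsNormalForm ψ lam h μ) (p y : Coord d) :
    coordMap ψ h.toLinearMap μ (coordMul lam p y)
      = coordMap ψ h.toLinearMap μ p * coordMap ψ h.toLinearMap μ y := by
  rw [Semidirect.mul_def]
  have h1 := H.apply_eq (Circle.exp p.2.2) (Circle.exp y.1) y.2.1
  refine Prod.ext ?_ (Circle.exp_add _ _)
  change _ = (coordMap ψ h.toLinearMap μ p).1 * ψ.toHom (Circle.exp p.2.2)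
    (HGroup.mk (Circle.exp (y.1 + μ y.2.1)) (h y.2.1))
  rw [Circle.exp_add y.1, h1]
  refine Prod.ext ?_ (map_add h _ _)
  change Circle.exp _ = Circle.exp (p.1 + μ p.2.1) * (Circle.exp y.1 * Circle.exp _) *
    Circle.exp (omega (h _) (h _) / 2)
  rw [H.omega_map, ← Circle.exp_add, ← Circle.exp_add, ← Circle.exp_add]
  congr 1
  simp only [coordMul, map_add]
  ring

theorem coordMap_zero : coordMap ψ h.toLinearMap μ 0 = 1 := by
  refine Prod.ext (Prod.ext ?_ ?_) ?_
  · change Circle.exp (0 + μ 0) = 1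
    simp
  · exact map_zero h
  · exact Circle.exp_zero

theorem coordMap_surjective : Function.Surjective (coordMap ψ h.toLinearMap μ) := by
  intro x
  refine ⟨(Complex.arg x.1.1 - μ (h.symm x.1.2), h.symm x.1.2, Complex.arg x.2), ?_⟩
  refine Prod.ext (Prod.ext ?_ ?_) ?_
  · change Circle.exp (_ - _ + _) = _
    rw [sub_add_cancel, Circle.exp_arg]
  · exact h.apply_symm_apply _
  · exact Circle.exp_arg _

theorem contMDiff_coordMap :
    ContMDiff 𝓘(ℝ, Coord d) (SCorners d) ∞ (coordMap ψ h.toLinearMap μ) := by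
  have hh : ContDiff ℝ ∞ h := (LinearMap.toContinuousLinearMap h.toLinearMap).contDiff
  have hμ : ContDiff ℝ ∞ μ := (LinearMap.toContinuousLinearMap μ).contDiff
  have h1 : ContMDiff 𝓘(ℝ, Coord d) 𝓘(ℝ, ℝ) ∞ fun p : Coord d => p.1 + μ p.2.1 := by
    rw [contMDiff_iff_contDiff]; fun_prop
  have h2 : ContMDiff 𝓘(ℝ, Coord d) 𝓘(ℝ, Cd d) ∞ fun p : Coord d => h p.2.1 := by
    rw [contMDiff_iff_contDiff]; fun_prop
  have h3 : ContMDiff 𝓘(ℝ, Coord d) 𝓘(ℝ, ℝ) ∞ fun p : Coord d => p.2.2 := by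
    rw [contMDiff_iff_contDiff]; fun_prop
  exact ((contMDiff_circleExp.comp h1).prodMk h2).prodMk (contMDiff_circleExp.comp h3)

theorem contMDiff_circle_coe : ContMDiff (𝓡 1) 𝓘(ℝ, ℂ) ∞ (fun z : Circle => (z : ℂ)) :=
  let _ : Fact (Module.finrank ℝ ℂ = 1 + 1) := finrank_real_complex_fact'
  contMDiff_coe_sphere

theorem modelDeriv_coordMap_injective :
    Function.Injective (modelDeriv (SCorners d) (coordMap ψ h.toLinearMap μ) 0) := by
  -- Composed with the embedding `Φ` into a vector space, the parametrization is explicit.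
  let Φ : Semidirect ψ → ℂ × Cd d × ℂ := fun x => ((x.1.1 : ℂ), x.1.2, (x.2 : ℂ))
  have hΦ : ContMDiff (SCorners d) 𝓘(ℝ, ℂ × Cd d × ℂ) ∞ Φ := by
    let P := (Circle × Cd d) × Circle
    have h1 : ContMDiff (SCorners d) (𝓡 1) ∞ (fun p : P => p.1.1) :=
      contMDiff_fst.comp contMDiff_fst
    have h2 : ContMDiff (SCorners d) 𝓘(ℝ, Cd d) ∞ (fun p : P => p.1.2) :=
      contMDiff_snd.comp contMDiff_fst
    have h3 : ContMDiff (SCorners d) (𝓡 1) ∞ (fun p : P => p.2) := contMDiff_snd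
    exact (contMDiff_circle_coe.comp h1).prodMk_space
      (h2.prodMk_space (contMDiff_circle_coe.comp h3))
  have hd := mfderiv_comp (I := 𝓘(ℝ, Coord d)) (I' := SCorners d) (I'' := 𝓘(ℝ, ℂ × Cd d × ℂ)) 0
    (hΦ.mdifferentiable (by simp) _)
    ((contMDiff_coordMap (ψ := ψ) (h := h) (μ := μ)).mdifferentiable (by simp) 0)
  rw [mfderiv_eq_fderiv] at hd
  let pr : Coord d →L[ℝ] Cd d :=
    (ContinuousLinearMap.fst ℝ (Cd d) ℝ).comp (ContinuousLinearMap.snd ℝ ℝ (Cd d × ℝ))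
  let L₁ : Coord d →L[ℝ] ℝ :=
    ContinuousLinearMap.fst ℝ ℝ (Cd d × ℝ) + (LinearMap.toContinuousLinearMap μ).comp pr
  let L₂ : Coord d →L[ℝ] Cd d := (LinearMap.toContinuousLinearMap h.toLinearMap).comp pr
  let L₃ : Coord d →L[ℝ] ℝ :=
    (ContinuousLinearMap.snd ℝ (Cd d) ℝ).comp (ContinuousLinearMap.snd ℝ ℝ (Cd d × ℝ))
  have hd2 : HasFDerivAt (Φ ∘ coordMap ψ h.toLinearMap μ)
      ((L₁.smulRight Complex.I).prod (L₂.prod (L₃.smulRight Complex.I))) 0 := by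
    have hexp : ∀ (L : Coord d →L[ℝ] ℝ), HasFDerivAt
        (fun p => ((Circle.exp (L p) : Circle) : ℂ)) (L.smulRight Complex.I) 0 := by
      intro L
      have h1 : HasDerivAt (fun s : ℝ => Complex.exp (s * Complex.I)) (Complex.I) (L 0) := by
        have := ((Complex.ofRealCLM.hasDerivAt (x := L 0)).mul_const Complex.I).cexp
        simpa using this
      have h2 := h1.hasFDerivAt.comp (0 : Coord d) L.hasFDerivAt
      refine h2.congr_fderiv ?_
      ext <;> simp
    exact (hexp L₁).prodMk (L₂.hasFDerivAt.prodMk (hexp L₃))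
  refine (injective_iff_map_eq_zero _).2 fun v hv => ?_
  have h5 := (congrArg (fun S : Coord d →L[ℝ] (ℂ × Cd d × ℂ) => S v)
    (hd2.fderiv.symm.trans hd)).trans
    ((congrArg (mfderiv (SCorners d) 𝓘(ℝ, ℂ × Cd d × ℂ) Φ (coordMap ψ h.toLinearMap μ 0)) hv).trans
      (map_zero _))
  have h6 : h v.2.1 = 0 := congrArg (fun q : ℂ × Cd d × ℂ => q.2.1) h5
  have h7 : (v.1 + μ v.2.1) • Complex.I = 0 := congrArg (fun q : ℂ × Cd d × ℂ => q.1) h5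
  have h8 : v.2.2 • Complex.I = 0 := congrArg (fun q : ℂ × Cd d × ℂ => q.2.2) h5
  have h9 : v.2.1 = 0 := by simpa using h6
  simp [h9] at h7 h8
  exact Prod.ext h7 (Prod.ext h9 h8)

/-- The derivative of the parametrization at the origin, as an isomorphism onto the Lie algebra. -/
theorem exists_coordEquiv (ψ : CircleAction d) (h : Cd d ≃ₗ[ℝ] Cd d) (μ : Cd d →ₗ[ℝ] ℝ) :
    ∃ T : Coord d ≃L[ℝ] (EuclideanSpace ℝ (Fin 1) × Cd d) × EuclideanSpace ℝ (Fin 1),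
    modelDeriv (SCorners d) (coordMap ψ h.toLinearMap μ) 0 = (T : Coord d →L[ℝ] _) := by
  refine ⟨(LinearEquiv.ofInjectiveOfFinrankEq _ (modelDeriv_coordMap_injective
    (ψ := ψ) (h := h) (μ := μ)) ?_).toContinuousLinearEquiv, ?_⟩
  · simp only [Module.finrank_prod, finrank_euclideanSpace_fin, Module.finrank_self]
    ring
  · ext u <;> rfl

end

/-! ### Left translations and conjugations in the covering group -/

/-- The symplectic form as a continuous bilinear map. -/
def omegaL (d : ℕ) : Cd d →L[ℝ] Cd d →L[ℝ] ℝ :=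
  LinearMap.toContinuousLinearMap ((LinearMap.toContinuousLinearMap (𝕜 := ℝ)
    (E := Cd d) (F' := ℝ)).toLinearMap ∘ₗ LinearMap.mk₂ ℝ omega omega_add_left
    (fun c X Y => omega_smul_left c X Y) omega_add_right (fun c X Y => omega_smul_right c X Y))

theorem omegaL_apply {d : ℕ} (X Y : Cd d) : omegaL d X Y = omega X Y := rfl

theorem omega_sub_left {d : ℕ} (X X' Y : Cd d) : omega (X - X') Y = omega X Y - omega X' Y :=
  congrArg (fun T : Cd d →L[ℝ] ℝ => T Y) (map_sub (omegaL d) X X')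

theorem omega_swap {d : ℕ} (X Y : Cd d) : omega Y X = -omega X Y := by
  have h := omega_self (X + Y)
  rw [omega_add_left, omega_add_right, omega_add_right, omega_self, omega_self] at h
  linarith

theorem hasFDerivAt_omega {d : ℕ} {V : Type*} [NormedAddCommGroup V] [NormedSpace ℝ V]
    {f g : V → Cd d} {f' g' : V →L[ℝ] Cd d} {x : V} (hf : HasFDerivAt f f' x)
    (hg : HasFDerivAt g g' x) :
    HasFDerivAt (fun y => omega (f y) (g y))
      ((omegaL d (f x)).comp g' + ((omegaL d).flip (g x)).comp f') x := by
  refine ((omegaL d).hasFDerivAt_of_bilinear hf hg).congr_fderiv ?_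
  ext v
  simp

/-- The infinitesimal generator of the action of the circle on `ℂ^d` with weights `lam`. -/
def rotGen {d : ℕ} (lam : Fin d → ℤ) : Cd d →ₗ[ℝ] Cd d where
  toFun X j := Complex.I * lam j * X j
  map_add' X Y := by ext j; simp [mul_add]
  map_smul' c X := by ext j; simp [mul_left_comm]

theorem rotGen_apply {d : ℕ} (lam : Fin d → ℤ) (X : Cd d) (j : Fin d) :
    rotGen lam X j = Complex.I * lam j * X j := rfl

section
variable {d : ℕ} (lam : Fin d → ℤ)

theorem hasFDerivAt_rot {V : Type*} [NormedAddCommGroup V] [NormedSpace ℝ V] (l : V →L[ℝ] ℝ)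
    (X : Cd d) :
    HasFDerivAt (fun p => rot lam (Circle.exp (l p)) X) (l.smulRight (rotGen lam X)) 0 := by
  rw [hasFDerivAt_pi']
  intro j
  have h1 : HasDerivAt (fun s : ℝ => Complex.exp (lam j * (s * Complex.I)) * X j)
      (rotGen lam X j) (l 0) := by
    have := ((((Complex.ofRealCLM.hasDerivAt (x := l 0)).mul_const Complex.I).const_mul
      (lam j : ℂ)).cexp).mul_const (X j)
    refine this.congr_deriv ?_
    simp [rotGen_apply]
    exact Or.inl (mul_comm _ _)
  refine ((h1.hasFDerivAt.comp (0 : V) l.hasFDerivAt).congr_fderiv ?_).congr_of_eventuallyEq ?_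
  · ext; simp
  · refine Filter.Eventually.of_forall fun p => ?_
    simp [rot_apply, Complex.exp_int_mul]

/-- The derivative at the origin of a left translation of the covering group. -/
def coordMulDeriv (p : Coord d) : Coord d →L[ℝ] Coord d :=
  LinearMap.toContinuousLinearMap
    { toFun := fun v => (v.1 + omega p.2.1 (rot lam (Circle.exp p.2.2) v.2.1) / 2,
        rot lam (Circle.exp p.2.2) v.2.1, v.2.2)
      map_add' := fun v w => by
        refine Prod.ext ?_ (Prod.ext (map_add _ _ _) rfl)
        simp only [Prod.fst_add, Prod.snd_add, map_add, omega_add_right]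
        ring
      map_smul' := fun c v => by
        refine Prod.ext ?_ (Prod.ext (map_smul _ _ _) rfl)
        simp only [Prod.smul_fst, Prod.smul_snd, map_smul, omega_smul_right, RingHom.id_apply,
          smul_eq_mul]
        ring }

theorem coordMulDeriv_apply (p v : Coord d) : coordMulDeriv lam p v
    = (v.1 + omega p.2.1 (rot lam (Circle.exp p.2.2) v.2.1) / 2,
        rot lam (Circle.exp p.2.2) v.2.1, v.2.2) := rfl

theorem coordMul_eq (p y : Coord d) : coordMul lam p y = p + coordMulDeriv lam p y := by
  refine Prod.ext ?_ rfl
  simp [coordMul, coordMulDeriv_apply, add_assoc]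

theorem hasFDerivAt_coordMul (p : Coord d) :
    HasFDerivAt (coordMul lam p) (coordMulDeriv lam p) 0 := by
  rw [show coordMul lam p = fun y => p + coordMulDeriv lam p y from funext (coordMul_eq lam p)]
  exact (coordMulDeriv lam p).hasFDerivAt.const_add p

theorem coordMul_zero (p : Coord d) : coordMul lam p 0 = p := by simp [coordMul_eq]

theorem coordMulDeriv_surjective (p : Coord d) : Function.Surjective (coordMulDeriv lam p) := by
  intro v
  refine ⟨(v.1 - omega p.2.1 v.2.1 / 2, rot lam (Circle.exp p.2.2)⁻¹ v.2.1, v.2.2), ?_⟩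
  simp [coordMulDeriv_apply, rot_apply_rot_inv]

theorem hasFDerivAt_coordMulDeriv (v : Coord d) :
    ∃ S : Coord d →L[ℝ] Coord d, HasFDerivAt (fun p => coordMulDeriv lam p v) S 0 ∧
      ∀ u, S u = (omega u.2.1 v.2.1 / 2, u.2.2 • rotGen lam v.2.1, 0) := by
  have h1 := hasFDerivAt_rot lam
    ((ContinuousLinearMap.snd ℝ (Cd d) ℝ).comp (ContinuousLinearMap.snd ℝ ℝ (Cd d × ℝ))) v.2.1
  have h2 := ((ContinuousLinearMap.fst ℝ (Cd d) ℝ).comp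
    (ContinuousLinearMap.snd ℝ ℝ (Cd d × ℝ))).hasFDerivAt (x := 0)
  have h3 := hasFDerivAt_omega h2 h1
  refine ⟨_, ((h3.mul_const (1 / 2)).const_add v.1).prodMk
    (h1.prodMk (hasFDerivAt_const v.2.2 (0 : Coord d))) |>.congr_of_eventuallyEq
    (Filter.Eventually.of_forall fun p => ?_), fun u => ?_⟩
  · simp [coordMulDeriv_apply, div_eq_mul_inv]
  · simp [omegaL_apply, div_eq_inv_mul]

/-- The bracket of the left-invariant vector fields of the covering group, at the origin. -/
theorem lieBracket_coordMulDeriv (v w : Coord d) :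
    lieBracket ℝ (fun p => coordMulDeriv lam p v) (fun p => coordMulDeriv lam p w) 0
      = (omega v.2.1 w.2.1, v.2.2 • rotGen lam w.2.1 - w.2.2 • rotGen lam v.2.1, 0) := by
  obtain ⟨S, hS, hS'⟩ := hasFDerivAt_coordMulDeriv lam v
  obtain ⟨S₂, hS₂, hS₂'⟩ := hasFDerivAt_coordMulDeriv lam w
  rw [lieBracket, hS.fderiv, hS₂.fderiv, hS', hS₂']
  simp [coordMulDeriv_apply, omega_swap v.2.1 w.2.1]
  ring

/-- Conjugation by `a` in the covering group. -/
def coordConj (a y : Coord d) : Coord d :=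
  (y.1 + omega a.2.1 (rot lam (Circle.exp a.2.2) y.2.1) / 2
      - omega (a.2.1 + rot lam (Circle.exp a.2.2) y.2.1) (rot lam (Circle.exp y.2.2) a.2.1) / 2,
    a.2.1 + rot lam (Circle.exp a.2.2) y.2.1 - rot lam (Circle.exp y.2.2) a.2.1, y.2.2)

theorem coordMul_coordConj (a y : Coord d) :
    coordMul lam (coordConj lam a y) a = coordMul lam a y := by
  refine Prod.ext ?_ (Prod.ext ?_ ?_)
  · simp only [coordMul, coordConj, omega_sub_left, omega_self]
    ring
  · simp [coordMul, coordConj]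
  · simp [coordMul, coordConj, add_comm]

theorem coordConj_zero (a : Coord d) : coordConj lam a 0 = 0 := by
  simp [coordConj, omega_self]

theorem hasFDerivAt_coordConj (a : Coord d) :
    ∃ C : Coord d →L[ℝ] Coord d, HasFDerivAt (coordConj lam a) C 0 ∧
      ∀ v, C v = (v.1 + omega a.2.1 (rot lam (Circle.exp a.2.2) v.2.1)
          - v.2.2 * omega a.2.1 (rotGen lam a.2.1) / 2,
        rot lam (Circle.exp a.2.2) v.2.1 - v.2.2 • rotGen lam a.2.1, v.2.2) := by
  have h1 := hasFDerivAt_rot lam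
    ((ContinuousLinearMap.snd ℝ (Cd d) ℝ).comp (ContinuousLinearMap.snd ℝ ℝ (Cd d × ℝ))) a.2.1
  have h2 := ((LinearMap.toContinuousLinearMap (rot lam (Circle.exp a.2.2))).comp
    ((ContinuousLinearMap.fst ℝ (Cd d) ℝ).comp
    (ContinuousLinearMap.snd ℝ ℝ (Cd d × ℝ)))).hasFDerivAt (x := 0)
  have h3 := hasFDerivAt_omega (h2.const_add a.2.1) h1
  have h4 := ((omegaL d a.2.1).hasFDerivAt).comp (0 : Coord d) h2
  have h5 := (ContinuousLinearMap.fst ℝ ℝ (Cd d × ℝ)).hasFDerivAt (x := 0)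
  have h6 := ((ContinuousLinearMap.snd ℝ (Cd d) ℝ).comp
    (ContinuousLinearMap.snd ℝ ℝ (Cd d × ℝ))).hasFDerivAt (x := 0)
  refine ⟨_, ((h5.add (h4.mul_const (1 / 2))).sub (h3.mul_const (1 / 2))).prodMk
    (((h2.const_add a.2.1).sub h1).prodMk h6) |>.congr_of_eventuallyEq
    (Filter.Eventually.of_forall fun p => ?_), fun u => ?_⟩
  · simp [coordConj, omegaL_apply, div_eq_mul_inv, omega_add_left]
  · simp [omegaL_apply, omega_swap (rot lam (Circle.exp a.2.2) u.2.1) a.2.1]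
    ring

end

/-! ### The invariant Lorentz form of a twisted Heisenberg algebra -/

/-- The form `∑ ε * Re (conj (X j) * Y j) / lam j` on `ℂ^d`. -/
def weightForm {d : ℕ} (lam : Fin d → ℤ) (ε : ℝ) : LinearMap.BilinForm ℝ (Cd d) :=
  LinearMap.mk₂ ℝ (fun X Y => ∑ j, ε * (starRingEnd ℂ (X j) * Y j).re / lam j)
    (fun X X' Y => by
      simp only [← Finset.sum_add_distrib]
      refine Finset.sum_congr rfl fun j _ => ?_
      simp; ring)
    (fun c X Y => by
      simp only [smul_eq_mul, Finset.mul_sum]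
      refine Finset.sum_congr rfl fun j _ => ?_
      simp; ring)
    (fun X Y Y' => by
      simp only [← Finset.sum_add_distrib]
      refine Finset.sum_congr rfl fun j _ => ?_
      simp; ring)
    (fun c X Y => by
      simp only [smul_eq_mul, Finset.mul_sum]
      refine Finset.sum_congr rfl fun j _ => ?_
      simp; ring)

theorem weightForm_apply {d : ℕ} (lam : Fin d → ℤ) (ε : ℝ) (X Y : Cd d) :
    weightForm lam ε X Y = ∑ j, ε * (starRingEnd ℂ (X j) * Y j).re / lam j := rfl

theorem weightForm_comm {d : ℕ} (lam : Fin d → ℤ) (ε : ℝ) (X Y : Cd d) :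
    weightForm lam ε X Y = weightForm lam ε Y X := by
  rw [weightForm_apply, weightForm_apply]
  refine Finset.sum_congr rfl fun j _ => ?_
  simp; ring

theorem weightForm_rot {d : ℕ} (lam : Fin d → ℤ) (ε : ℝ) (θ : Circle) (X Y : Cd d) :
    weightForm lam ε (rot lam θ X) (rot lam θ Y) = weightForm lam ε X Y := by
  rw [weightForm_apply, weightForm_apply]
  refine Finset.sum_congr rfl fun k _ => ?_
  rw [rot_apply, rot_apply, map_mul, mul_mul_mul_comm, ← Complex.normSq_eq_conj_mul_self]
  simp [-Circle.coe_zpow]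

/-- This identity is what makes `coordForm` invariant under the adjoint action of `ℂ^d`. -/
theorem weightForm_rotGen {d : ℕ} {lam : Fin d → ℤ} (hlam : ∀ j, lam j ≠ 0) (ε : ℝ) (X Y : Cd d) :
    weightForm lam ε (rotGen lam X) Y = ε * omega X Y := by
  rw [weightForm_apply, omega, Finset.mul_sum]
  refine Finset.sum_congr rfl fun j _ => ?_
  have : (lam j : ℝ) ≠ 0 := Int.cast_ne_zero.2 (hlam j)
  simp [rotGen_apply]
  field_simp
  ring

theorem weightForm_pos {d : ℕ} {lam : Fin d → ℤ} {ε : ℝ} (hlam : ∀ j, 0 < ε * lam j) {X : Cd d}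
    (hX : X ≠ 0) : 0 < weightForm lam ε X X := by
  have h : ∀ j, 0 < ε / lam j := fun j => by
    have h1 := hlam j
    have h0 : (lam j : ℝ) ≠ 0 := by rintro h; simp [h] at h1
    rw [show ε / lam j = ε * lam j / (lam j * lam j) by field_simp]
    exact div_pos h1 (mul_self_pos.2 h0)
  have e : ∀ j, ε * (starRingEnd ℂ (X j) * X j).re / lam j = ε / lam j * Complex.normSq (X j) := by
    intro j
    rw [← Complex.normSq_eq_conj_mul_self, Complex.ofReal_re]
    ring
  rw [weightForm_apply]
  simp only [e]
  obtain ⟨j, hj⟩ := Function.ne_iff.1 hX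
  exact Finset.sum_pos' (fun i _ => mul_nonneg (h i).le (Complex.normSq_nonneg _))
    ⟨j, Finset.mem_univ j, mul_pos (h j) (Complex.normSq_pos.2 hj)⟩

/-- The `Ad`-invariant Lorentz form: the centre and the circle direction span a hyperbolic plane,
orthogonal to `ℂ^d` endowed with `weightForm`. -/
def coordForm {d : ℕ} (lam : Fin d → ℤ) (ε : ℝ) : Coord d →L[ℝ] Coord d →L[ℝ] ℝ :=
  LinearMap.toContinuousLinearMap ((LinearMap.toContinuousLinearMap (𝕜 := ℝ)
    (E := Coord d) (F' := ℝ)).toLinearMap ∘ₗ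
    LinearMap.mk₂ ℝ (fun v w => weightForm lam ε v.2.1 w.2.1 + ε * (v.1 * w.2.2 + v.2.2 * w.1))
    (fun v v' w => by simp; ring) (fun c v w => by simp; ring)
    (fun v w w' => by simp; ring) (fun c v w => by simp; ring))

theorem coordForm_apply {d : ℕ} (lam : Fin d → ℤ) (ε : ℝ) (v w : Coord d) :
    coordForm lam ε v w
      = weightForm lam ε v.2.1 w.2.1 + ε * (v.1 * w.2.2 + v.2.2 * w.1) := rfl

/-- A sign, given by the real number `ε`, that makes all the weights positive. -/
theorem exists_sign {d : ℕ} {lam : Fin d → ℤ} (h : (∀ j, 0 < lam j) ∨ (∀ j, lam j < 0)) :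
    ∃ ε : ℝ, ε * ε = 1 ∧ ∀ j, 0 < ε * lam j := by
  rcases h with h | h
  · exact ⟨1, by norm_num, fun j => by simpa using h j⟩
  · exact ⟨-1, by norm_num, fun j => by simpa using h j⟩

section
variable {d : ℕ} {ψ : CircleAction d} {lam : Fin d → ℤ} {h : Cd d ≃ₗ[ℝ] Cd d} {μ : Cd d →ₗ[ℝ] ℝ}

theorem IsNormalForm.coordMap_coordConj (H : IsNormalForm ψ lam h μ) (a y : Coord d) :
    coordMap ψ h.toLinearMap μ (coordConj lam a y) = coordMap ψ h.toLinearMap μ a *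
      coordMap ψ h.toLinearMap μ y * (coordMap ψ h.toLinearMap μ a)⁻¹ := by
  rw [eq_mul_inv_iff_mul_eq, ← H.coordMap_coordMul, ← H.coordMap_coordMul, coordMul_coordConj]

theorem IsNormalForm.nonempty_metric (H : IsNormalForm ψ lam h μ)
    (hlam : (∀ j, 0 < lam j) ∨ (∀ j, lam j < 0)) :
    Nonempty (BiinvariantLorentzMetric (SCorners d) (Semidirect ψ)) := by
  obtain ⟨ε, hε, hpos⟩ := exists_sign hlam
  have hne : ∀ j, lam j ≠ 0 := fun j h0 => by simpa [h0] using hpos j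
  obtain ⟨T, hT⟩ := exists_coordEquiv ψ h μ
  let S : ((EuclideanSpace ℝ (Fin 1) × Cd d) × EuclideanSpace ℝ (Fin 1)) →L[ℝ] Coord d := T.symm
  -- The negative direction is `(1, 0, -ε)`, in the hyperbolic plane of the centre and the circle.
  refine nonempty_biinvariantLorentzMetric (I := SCorners d) (G := Semidirect ψ)
    ((coordForm lam ε).bilinearComp S S) (fun v w => ?_) (T (1, 0, -ε)) ?_ (fun w hw hw' => ?_)
    (fun a v w => ?_)
  · simp only [ContinuousLinearMap.bilinearComp_apply, coordForm_apply]
    rw [weightForm_comm]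
    ring
  · simp [S, coordForm_apply]
    linarith
  · obtain ⟨u, rfl⟩ := T.surjective w
    have hu : u ≠ 0 := by rintro rfl; simp at hw
    have h1 : u.2.2 = ε * u.1 := by
      simp [S, coordForm_apply] at hw'
      rcases hw' with h | h
      · simp [h] at hε
      · linarith
    simp only [S, coordForm_apply, ContinuousLinearMap.bilinearComp_apply,
      ContinuousLinearEquiv.coe_coe, ContinuousLinearEquiv.symm_apply_apply, h1]
    have e : ε * (u.1 * (ε * u.1) + ε * u.1 * u.1) = 2 * (ε * ε) * (u.1 * u.1) := by ring
    rw [e, hε]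
    by_cases h2 : u.2.1 = 0
    · have h3 : u.1 ≠ 0 := fun h3 => hu (Prod.ext h3 (Prod.ext h2 (by rw [h1, h3]; simp)))
      have : 0 < u.1 * u.1 := mul_self_pos.2 h3
      rw [h2]
      simpa using this
    · have := weightForm_pos hpos h2
      have := mul_self_nonneg u.1
      linarith
  · obtain ⟨p, rfl⟩ := coordMap_surjective (ψ := ψ) (h := h) (μ := μ) a
    obtain ⟨v, rfl⟩ := T.surjective v
    obtain ⟨w, rfl⟩ := T.surjective w
    obtain ⟨C, hC, hC'⟩ := hasFDerivAt_coordConj lam p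
    have key := conjDeriv_apply_of_conj contMDiff_coordMap coordMap_zero hT hC
      (coordConj_zero lam p) (H.coordMap_coordConj p)
    rw [key, key]
    simp only [S, coordForm_apply, ContinuousLinearMap.bilinearComp_apply,
      ContinuousLinearEquiv.coe_coe, ContinuousLinearEquiv.symm_apply_apply, hC', map_sub,
      map_smul, LinearMap.sub_apply, LinearMap.smul_apply, weightForm_rot, smul_eq_mul,
      weightForm_comm lam ε (rot lam _ _) (rotGen lam _), weightForm_rotGen hne]
    ring

end

/-! ### Normal form of twisted circle actions -/

/-- A continuous character of a real normed space is the exponential of a linear form. -/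
theorem exists_eq_exp_of_continuous {V : Type*} [NormedAddCommGroup V] [NormedSpace ℝ V]
    {χ : V → Circle} (hc : Continuous χ) (hχ : ∀ x y, χ (x + y) = χ x * χ y) :
    ∃ l : V →L[ℝ] ℝ, ∀ x, χ x = Circle.exp (l x) := by
  have h0 : χ 0 = 1 := by
    have := hχ 0 0
    rwa [add_zero, left_eq_mul] at this
  have hsc : SimplyConnectedSpace V := inferInstance
  obtain ⟨f, ⟨hf0, hf⟩, -⟩ := Circle.isCoveringMap_exp.existsUnique_continuousMap_lifts
    ⟨χ, hc⟩ (0 : V) (0 : ℝ) (by simp [h0])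
  have hf' : ∀ x, Circle.exp (f x) = χ x := fun x => congrFun hf x
  have hadd : ∀ x y, f (x + y) = f x + f y := by
    intro x y
    -- Both sides are lifts of `y ↦ χ (x + y)` which take the value `f x` at the origin.
    have := Circle.isCoveringMap_exp.eq_of_comp_eq (A := V)
      (g₁ := fun y => f (x + y)) (g₂ := fun y => f x + f y) (by fun_prop) (by fun_prop) ?_ 0 ?_
    · exact congrFun this y
    · funext y
      simp [Circle.exp_add, hf', hχ]
    · simp [hf0]
  exact ⟨(AddMonoidHom.mk' f hadd).toRealLinearMap f.continuous, fun x => (hf' x).symm⟩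

theorem HGroup.mul_eq_commutator_mul {d : ℕ} (a b : HGroup d) :
    a * b = HGroup.mk (Circle.exp (omega a.2 b.2)) 0 * (b * a) := by
  obtain ⟨z, X⟩ := a
  obtain ⟨w, Y⟩ := b
  change HGroup.mk z X * HGroup.mk w Y
    = HGroup.mk (Circle.exp (omega X Y)) 0 * (HGroup.mk w Y * HGroup.mk z X)
  rw [HGroup.mk_mul_mk, HGroup.mk_mul_mk, HGroup.mk_zero_mul, omega_swap X Y, HGroup.mk_inj]
  refine ⟨?_, add_comm _ _⟩
  rw [mul_left_comm, ← Circle.exp_add, mul_comm z w]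
  congr 2
  ring

theorem CircleAction.continuous_toHom {d : ℕ} (ψ : CircleAction d) :
    Continuous fun p : Circle × HGroup d => ψ.toHom p.1 p.2 := ψ.smooth.continuous

theorem exists_omega_eq {d : ℕ} (hd : 0 < d) (s : ℝ) : ∃ X Y : Cd d, omega X Y = s := by
  refine ⟨Pi.single ⟨0, hd⟩ (s : ℂ), Pi.single ⟨0, hd⟩ Complex.I, ?_⟩
  rw [omega, Finset.sum_eq_single ⟨0, hd⟩]
  · simp
  · intro j _ hj
    simp [hj]
  · simp

theorem exp_mul_left_injective {a b : ℝ} (h : ∀ s : ℝ, Circle.exp (a * s) = Circle.exp (b * s)) :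
    a = b := by
  by_contra hab
  have hab' : a - b ≠ 0 := sub_ne_zero.2 hab
  have h1 := h (Real.pi / (a - b))
  rw [← mul_inv_eq_one, ← Circle.exp_neg, ← Circle.exp_add,
    show a * (Real.pi / (a - b)) + -(b * (Real.pi / (a - b))) = Real.pi by field_simp; ring] at h1
  exact Circle.exp_pi_ne_one h1

/-- For `d = 0`, the circle acts trivially by automorphisms of the circle `He_0`: the automorphisms of the
circle are `± 1`, and every element of the circle is a square. -/
theorem CircleAction.apply_fst_of_eq_zero {d : ℕ} (ψ : CircleAction d) (hd : d = 0) (θ z : Circle) :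
    (ψ.toHom θ (HGroup.mk z (0 : Cd d))).1 = z := by
  subst hd
  have hsub : ∀ X : Cd 0, X = 0 := fun X => Subsingleton.elim _ _
  have key : ∀ θ, ∃ n : ℤ, ∀ s : ℝ,
      (ψ.toHom θ (HGroup.mk (Circle.exp s) (0 : Cd 0))).1 = Circle.exp (n * s) := by
    intro θ
    have hc : Continuous fun s : ℝ => (ψ.toHom θ (HGroup.mk (Circle.exp s) (0 : Cd 0))).1 := by
      have h1 : Continuous fun s : ℝ => (θ, HGroup.mk (Circle.exp s) (0 : Cd 0)) :=
        continuous_const.prodMk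
          (HGroup.continuous_mk.comp (Circle.exp.continuous.prodMk continuous_const))
      exact continuous_fst.comp (ψ.continuous_toHom.comp h1)
    obtain ⟨l, hl⟩ := exists_eq_exp_of_continuous hc (fun s t => by
      have h1 : HGroup.mk (Circle.exp (s + t)) (0 : Cd 0)
          = HGroup.mk (Circle.exp s) (0 : Cd 0)
            * HGroup.mk (Circle.exp t) (0 : Cd 0) := by
        rw [HGroup.mk_zero_mul, Circle.exp_add]
      rw [h1, map_mul, HGroup.mul_def]
      change _ * _ * Circle.exp (omega _ _ / 2) = _
      rw [hsub (ψ.toHom θ (HGroup.mk (Circle.exp s) (0 : Cd 0))).2, omega_zero_left, zero_div,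
        Circle.exp_zero, mul_one])
    have hl' : ∀ s, l s = l 1 * s := fun s => by
      rw [show l s = l (s • 1) by simp, map_smul, smul_eq_mul, mul_comm]
    have h2 := hl (2 * Real.pi)
    rw [Circle.exp_two_pi] at h2
    have h3 : (ψ.toHom θ (HGroup.mk 1 (0 : Cd 0))).1 = 1 :=
      congrArg Prod.fst (map_one (ψ.toHom θ))
    obtain ⟨n, hn⟩ := Circle.exp_eq_one.1 (h2.symm.trans h3)
    rw [hl'] at hn
    have h4 : l 1 = n := mul_right_cancel₀ (by positivity) hn
    exact ⟨n, fun s => by rw [hl s, hl', h4]⟩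
  choose n hn using key
  have hn' : ∀ θ s, ψ.toHom θ (HGroup.mk (Circle.exp s) (0 : Cd 0))
      = (HGroup.mk (Circle.exp (n θ * s)) (0 : Cd 0)) := fun θ s => Prod.ext (hn θ s) (hsub _)
  have hmul : ∀ θ η, n (θ * η) = n θ * n η := by
    intro θ η
    have : ((n (θ * η) : ℤ) : ℝ) = n θ * n η := by
      refine exp_mul_left_injective fun s => ?_
      rw [← hn, map_mul, MulAut.mul_apply, hn', hn', mul_assoc]
      rfl
    exact_mod_cast this
  have hone : n 1 = 1 := by
    have : ((n 1 : ℤ) : ℝ) = 1 := by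
      refine exp_mul_left_injective fun s => ?_
      rw [← hn, map_one, one_mul]
      rfl
    exact_mod_cast this
  have hθ : n θ = 1 := by
    obtain ⟨s, rfl⟩ := Circle.exp_surjective θ
    have h1 : Circle.exp s = Circle.exp (s / 2) * Circle.exp (s / 2) := by
      rw [← Circle.exp_add, add_halves]
    have h2 := hmul (Circle.exp (s / 2)) (Circle.exp (s / 2))⁻¹
    rw [mul_inv_cancel, hone] at h2
    rw [h1, hmul]
    rcases Int.isUnit_iff.1 (IsUnit.of_mul_eq_one _ h2.symm) with h | h <;> simp [h]
  obtain ⟨s, rfl⟩ := Circle.exp_surjective z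
  rw [hn', hθ, Int.cast_one, one_mul]
  rfl

section
variable {d : ℕ} {ψ : CircleAction d} {lam : Fin d → ℤ} {h : Cd d ≃ₗ[ℝ] Cd d}

/-- For `d > 0` the centre consists of commutators, on which the action is determined by the induced
symplectic action on `ℂ^d`. -/
theorem CircleAction.apply_center (ψ : CircleAction d)
    (hh : ∀ X Y, omega (h X) (h Y) = omega X Y)
    (hψ : ∀ θ x, (ψ.toHom θ x).2 = h (rot lam θ (h.symm x.2))) (θ z : Circle) :
    ψ.toHom θ (HGroup.mk z (0 : Cd d)) = (HGroup.mk z (0 : Cd d)) := by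
  rcases Nat.eq_zero_or_pos d with hd | hd
  · refine Prod.ext (ψ.apply_fst_of_eq_zero hd θ z) ?_
    rw [hψ]
    change h (rot lam θ (h.symm 0)) = 0
    simp
  · obtain ⟨s, rfl⟩ := Circle.exp_surjective z
    obtain ⟨X, Y, rfl⟩ := exists_omega_eq hd s
    have h1 := HGroup.mul_eq_commutator_mul (HGroup.mk 1 (X : Cd d)) (HGroup.mk 1 (Y : Cd d))
    have h2 := congrArg (ψ.toHom θ) h1
    rw [map_mul, map_mul, map_mul, HGroup.mul_eq_commutator_mul (ψ.toHom θ _)] at h2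
    have h3 := mul_right_cancel h2
    change ψ.toHom θ (HGroup.mk (Circle.exp (omega (HGroup.mk 1 X).2 (HGroup.mk 1 Y).2)) 0) = _
    rw [← h3, hψ, hψ, hh, omega_rot]
    change HGroup.mk (Circle.exp (omega (h.symm X) (h.symm Y))) 0 = _
    have h4 := hh (h.symm X) (h.symm Y)
    rw [h.apply_symm_apply, h.apply_symm_apply] at h4
    rw [← h4]

/-- The number `exp i` is not a root of unity, since `π` is irrational. -/
theorem exp_one_zpow_ne_one {n : ℤ} (hn : n ≠ 0) : Circle.exp 1 ^ n ≠ 1 := by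
  rw [← Circle.exp_zsmul]
  intro h1
  obtain ⟨m, hm⟩ := Circle.exp_eq_one.1 h1
  simp at hm
  have hm0 : m ≠ 0 := by
    rintro rfl
    simp at hm
    exact hn hm
  refine irrational_pi ⟨(n / (m * 2) : ℚ), ?_⟩
  have : (m : ℝ) ≠ 0 := Int.cast_ne_zero.2 hm0
  push_cast
  rw [hm]
  field_simp

/-- The action on `He_d` differs from the induced action on `ℂ^d` by characters `κ θ` of `ℂ^d`,
which form a cocycle. Since the circle is commutative and `rot lam (exp i) - 1` is invertible, this
cocycle is the coboundary of a character `exp (i μ)`. -/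
theorem CircleAction.exists_isNormalForm (ψ : CircleAction d) (hlam : ∀ j, lam j ≠ 0)
    (hh : ∀ X Y, omega (h X) (h Y) = omega X Y)
    (hψ : ∀ θ x, (ψ.toHom θ x).2 = h (rot lam θ (h.symm x.2))) :
    ∃ μ, IsNormalForm ψ lam h μ := by
  let κ : Circle → Cd d → Circle := fun θ Y => (ψ.toHom θ (HGroup.mk 1 (h Y))).1
  have hκ : ∀ θ z Y, ψ.toHom θ (HGroup.mk z (h Y))
      = HGroup.mk (z * κ θ Y) (h (rot lam θ Y)) := by
    intro θ z Y
    have h1 := HGroup.mk_zero_mul z 1 (h Y)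
    rw [mul_one] at h1
    rw [← h1, map_mul, ψ.apply_center hh hψ]
    have h2 : ψ.toHom θ (HGroup.mk 1 (h Y))
        = HGroup.mk (κ θ Y) (h (rot lam θ Y)) := by
      refine Prod.ext rfl ?_
      rw [hψ]
      change h (rot lam θ (h.symm (h Y))) = h (rot lam θ Y)
      rw [h.symm_apply_apply]
    rw [h2, HGroup.mk_zero_mul]
  have hadd : ∀ θ X Y, κ θ (X + Y) = κ θ X * κ θ Y := by
    intro θ X Y
    have h1 := congrArg (ψ.toHom θ) (HGroup.mk_mul_mk 1 1 (h X) (h Y))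
    rw [map_mul, hκ, hκ, HGroup.mk_mul_mk, ← map_add h, ← map_add h, hκ] at h1
    have h2 : 1 * κ θ X * (1 * κ θ Y) * Circle.exp (omega (h (rot lam θ X)) (h (rot lam θ Y)) / 2)
      = 1 * 1 * Circle.exp (omega (h X) (h Y) / 2) * κ θ (X + Y) := congrArg Prod.fst h1
    rw [hh, hh, omega_rot, one_mul, one_mul, one_mul, one_mul, mul_comm] at h2
    exact (mul_left_cancel h2).symm
  have hcomp : ∀ θ η Y, κ (θ * η) Y = κ θ (rot lam η Y) * κ η Y := by
    intro θ η Y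
    have h1 : ψ.toHom (θ * η) (HGroup.mk 1 (h Y))
        = ψ.toHom θ (ψ.toHom η (HGroup.mk 1 (h Y))) := by rw [map_mul]; rfl
    rw [hκ, hκ, hκ] at h1
    have h2 : 1 * κ (θ * η) Y = 1 * κ η Y * κ θ (rot lam η Y) := congrArg Prod.fst h1
    rw [one_mul, one_mul] at h2
    rw [h2, mul_comm]
  have hcont : Continuous (κ (Circle.exp 1)) := by
    have h0 : Continuous h := h.toLinearMap.continuous_of_finiteDimensional
    have h1 : Continuous fun Y : Cd d => (Circle.exp 1, HGroup.mk 1 (h Y)) :=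
      continuous_const.prodMk (HGroup.continuous_mk.comp (continuous_const.prodMk h0))
    exact continuous_fst.comp (ψ.continuous_toHom.comp h1)
  obtain ⟨l, hl⟩ := exists_eq_exp_of_continuous hcont (hadd _)
  -- The inverse of `rot lam (exp 1) - 1`.
  let S : Cd d →ₗ[ℝ] Cd d :=
    { toFun := fun X j => ((Circle.exp 1 ^ lam j : Circle) - 1 : ℂ)⁻¹ * X j
      map_add' := fun X Y => by ext j; simp [mul_add]
      map_smul' := fun c X => by ext j; simp [mul_left_comm] }
  have hS : ∀ X, rot lam (Circle.exp 1) (S X) = S X + X := by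
    intro X
    ext j
    have h1 : ((Circle.exp 1 ^ lam j : Circle) - 1 : ℂ) ≠ 0 := by
      rw [sub_ne_zero, Ne, Circle.coe_eq_one]
      exact exp_one_zpow_ne_one (hlam j)
    change ((Circle.exp 1 ^ lam j : Circle) : ℂ)
      * (((Circle.exp 1 ^ lam j : Circle) - 1 : ℂ)⁻¹ * X j) = ((Circle.exp 1 ^ lam j : Circle) - 1 : ℂ)⁻¹ * X j + X j
    field_simp
    ring
  have hSrot : ∀ θ X, rot lam θ (S X) = S (rot lam θ X) := by
    intro θ X
    ext j
    exact mul_left_comm _ _ _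
  refine ⟨l.toLinearMap ∘ₗ S, hh, fun θ z X => ?_⟩
  have h1 := (hcomp θ (Circle.exp 1) (S X)).symm.trans
    ((congrArg (fun t => κ t (S X)) (mul_comm θ (Circle.exp 1))).trans (hcomp _ _ _))
  rw [hS, hadd, mul_assoc, mul_comm (κ θ X), ← mul_assoc, mul_comm, mul_comm (κ θ (S X)),
    ← mul_assoc] at h1
  have h2 := mul_right_cancel h1
  rw [hl, hl, hSrot] at h2
  rw [hκ, mul_assoc]
  refine Prod.ext (congrArg (z * ·) ?_) rfl
  change Circle.exp (l (S X)) * κ θ X = Circle.exp (l (S (rot lam θ X)))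
  rw [← h2, mul_comm]

theorem CircleAction.IsTwisted.exists_isNormalForm (hψ : ψ.IsTwisted) :
    ∃ (lam : Fin d → ℤ) (h : Cd d ≃ₗ[ℝ] Cd d) (μ : Cd d →ₗ[ℝ] ℝ),
      ((∀ j, 0 < lam j) ∨ (∀ j, lam j < 0)) ∧ IsNormalForm ψ lam h μ := by
  obtain ⟨g, lam, hg, hlam, heq⟩ := hψ
  have hh : ∀ X Y, omega (g.symm X) (g.symm Y) = omega X Y := fun X Y => by
    rw [← hg, g.apply_symm_apply, g.apply_symm_apply]
  have hne : ∀ j, lam j ≠ 0 := fun j => hlam.elim (fun H => (H j).ne') (fun H => (H j).ne)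
  obtain ⟨μ, hμ⟩ := ψ.exists_isNormalForm (h := g.symm) hne hh (fun θ x => by
    rw [LinearEquiv.eq_symm_apply]
    ext j
    exact heq θ x j)
  exact ⟨lam, g.symm, μ, hlam, hμ⟩

theorem CircleAction.IsTwisted.nonempty_metric (hψ : ψ.IsTwisted) :
    Nonempty (BiinvariantLorentzMetric (SCorners d) (Semidirect ψ)) := by
  obtain ⟨lam, h, μ, hlam, H⟩ := hψ.exists_isNormalForm
  exact H.nonempty_metric hlam

end

/-! ### The Lie algebra of a twisted Heisenberg group -/

theorem contMDiff_circle_zpow (n : ℤ) : ContMDiff (𝓡 1) (𝓡 1) ∞ fun z : Circle => z ^ n := by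
  cases n with
  | ofNat n => simpa using contMDiff_pow n
  | negSucc n => simpa using (contMDiff_pow (I := 𝓡 1) (n := ∞) (G := Circle) (n + 1)).inv

theorem contMDiff_rot {d : ℕ} (lam : Fin d → ℤ) :
    ContMDiff ((𝓡 1).prod 𝓘(ℝ, Cd d)) 𝓘(ℝ, Cd d) ∞
      fun p : Circle × Cd d => rot lam p.1 p.2 := by
  rw [contMDiff_pi_space]
  intro j
  have h1 : ContMDiff ((𝓡 1).prod 𝓘(ℝ, Cd d)) 𝓘(ℝ, ℂ) ∞
      fun p : Circle × Cd d => ((p.1 ^ lam j : Circle) : ℂ) :=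
    contMDiff_circle_coe.comp ((contMDiff_circle_zpow _).comp contMDiff_fst)
  have h2 : ContMDiff ((𝓡 1).prod 𝓘(ℝ, Cd d)) 𝓘(ℝ, ℂ) ∞ fun p : Circle × Cd d => p.2 j :=
    (contMDiff_pi_space.1 contMDiff_id j).comp contMDiff_snd
  have h3 : ContDiff ℝ ∞ fun q : ℂ × ℂ => q.1 * q.2 := by fun_prop
  exact h3.contMDiff.comp (h1.prodMk_space h2)

/-- The action of the circle on `He_d` with weights `lam`. -/
def stdAction {d : ℕ} (lam : Fin d → ℤ) : CircleAction d where
  toHom :=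
    { toFun := fun θ =>
        { toFun := fun x => HGroup.mk x.1 (rot lam θ x.2)
          invFun := fun x => HGroup.mk x.1 (rot lam θ⁻¹ x.2)
          left_inv := fun x => Prod.ext rfl (rot_inv_apply_rot lam θ x.2)
          right_inv := fun x => Prod.ext rfl (rot_apply_rot_inv lam θ x.2)
          map_mul' := fun x y => by
            rw [HGroup.mk_mul_mk, omega_rot, ← map_add]
            rfl }
      map_one' := by
        ext x : 1
        exact Prod.ext rfl (rot_one lam x.2)
      map_mul' := fun θ η => by
        ext x : 1
        exact Prod.ext rfl (rot_mul lam θ η x.2) }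
  smooth := by
    let P := Circle × (Circle × Cd d)
    have h1 : ContMDiff ((𝓡 1).prod (HCorners d)) (𝓡 1) ∞ (fun p : P => p.2.1) :=
      contMDiff_fst.comp contMDiff_snd
    have h2 : ContMDiff ((𝓡 1).prod (HCorners d)) ((𝓡 1).prod 𝓘(ℝ, Cd d)) ∞
        (fun p : P => (p.1, p.2.2)) := contMDiff_fst.prodMk (contMDiff_snd.comp contMDiff_snd)
    exact h1.prodMk ((contMDiff_rot lam).comp h2)

theorem stdAction_apply {d : ℕ} (lam : Fin d → ℤ) (θ : Circle) (z : Circle) (X : Cd d) :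
    (stdAction lam).toHom θ (HGroup.mk z X) = HGroup.mk z (rot lam θ X) := rfl

theorem stdAction_isTwisted {d : ℕ} {lam : Fin d → ℤ}
    (h : (∀ j, 0 < lam j) ∨ (∀ j, lam j < 0)) : (stdAction lam).IsTwisted :=
  ⟨LinearEquiv.refl ℝ _, lam, fun _ _ => rfl, h, fun _ _ _ => rfl⟩

theorem stdAction_isNormalForm {d : ℕ} (lam : Fin d → ℤ) :
    IsNormalForm (stdAction lam) lam (LinearEquiv.refl ℝ _) 0 :=
  ⟨fun _ _ => rfl, fun θ z X => by simp [stdAction_apply]⟩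

theorem IsNormalForm.exists_lie_eq {d : ℕ} {ψ : CircleAction d} {lam : Fin d → ℤ}
    {h : Cd d ≃ₗ[ℝ] Cd d} {μ : Cd d →ₗ[ℝ] ℝ} (H : IsNormalForm ψ lam h μ) :
    ∃ T : Coord d ≃ₗ[ℝ] GroupLieAlgebra (SCorners d) (Semidirect ψ), ∀ v w, ⁅T v, T w⁆
      = T (omega v.2.1 w.2.1, v.2.2 • rotGen lam w.2.1 - w.2.2 • rotGen lam v.2.1, 0) := by
  obtain ⟨T, hT⟩ := exists_coordEquiv ψ h μ
  refine ⟨T.toLinearEquiv, fun v w => ?_⟩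
  have := lie_apply_of_coordinates contMDiff_coordMap coordMap_zero hT
    (coordMulDeriv_surjective lam) (hasFDerivAt_coordMul lam) (coordMul_zero lam)
    H.coordMap_coordMul v w
  rw [lieBracket_coordMulDeriv] at this
  exact this

/-- A Lie algebra with the structure constants of a twisted Heisenberg algebra is isomorphic to the
Lie algebra of the corresponding twisted Heisenberg group. -/
theorem nonempty_lieEquiv_of_lie_eq {d : ℕ} (lam : Fin d → ℤ) {L : Type*} [LieRing L]
    [LieAlgebra ℝ L] (S : Coord d ≃ₗ[ℝ] L)
    (hS : ∀ v w, ⁅S v, S w⁆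
      = S (omega v.2.1 w.2.1, v.2.2 • rotGen lam w.2.1 - w.2.2 • rotGen lam v.2.1, 0)) :
    Nonempty (GroupLieAlgebra (SCorners d) (Semidirect (stdAction lam)) ≃ₗ⁅ℝ⁆ L) := by
  obtain ⟨T, hT⟩ := (stdAction_isNormalForm lam).exists_lie_eq
  refine ⟨{ T.symm.trans S with
    map_lie' := fun {x y} => ?_ }⟩
  obtain ⟨v, rfl⟩ := T.surjective x
  obtain ⟨w, rfl⟩ := T.surjective y
  change S (T.symm ⁅T v, T w⁆) = ⁅S (T.symm (T v)), S (T.symm (T w))⁆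
  rw [hT, T.symm_apply_apply, T.symm_apply_apply, T.symm_apply_apply, hS]

/-! ### Diagonalization of definite elements of the symplectic Lie algebra -/

/-- The spectral theorem, for a positive definite form which is not the inner product of a normed
space. -/
theorem exists_eigenvector_of_symmetric {V : Type*} [AddCommGroup V] [Module ℝ V]
    [FiniteDimensional ℝ V] [Nontrivial V] (q : LinearMap.BilinForm ℝ V)
    (hsymm : ∀ x y, q x y = q y x) (hpos : ∀ x, x ≠ 0 → 0 < q x x) (T : V →ₗ[ℝ] V)
    (hT : ∀ x y, q (T x) y = q x (T y)) : ∃ (ν : ℝ) (e : V), e ≠ 0 ∧ T e = ν • e := by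
  let core : InnerProductSpace.Core ℝ V :=
    { inner := fun x y => q x y
      conj_inner_symm := fun x y => hsymm y x
      re_inner_nonneg := fun x => by
        rcases eq_or_ne x 0 with rfl | hx
        · simp
        · exact (hpos x hx).le
      add_left := fun x y z => by simp
      smul_left := fun x y r => by simp
      definite := fun x hx => by
        by_contra h
        exact (hpos x h).ne' hx }
  let _ : NormedAddCommGroup V := core.toNormedAddCommGroup
  let _ : InnerProductSpace ℝ V := InnerProductSpace.ofCore core.toCore
  have hs : T.IsSymmetric := fun x y => hT x y
  obtain ⟨e, he⟩ := hs.hasEigenvalue_iSup_of_finiteDimensional.exists_hasEigenvector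
  exact ⟨_, e, he.2, he.apply_eq_smul⟩

/-- A linear map `D`, skew with respect to the alternating form `σ` and such that `σ x (D x)` is
positive definite, is diagonal in suitable symplectic coordinates. The eigenplanes are split off
one at a time. -/
theorem exists_symplectic_diagonalization (m : ℕ) : ∀ {V : Type*} [AddCommGroup V] [Module ℝ V]
    [FiniteDimensional ℝ V] (σ : LinearMap.BilinForm ℝ V) (D : V →ₗ[ℝ] V),
    Module.finrank ℝ V ≤ m → (∀ x y, σ x y = -σ y x) → (∀ x y, σ (D x) y = -σ x (D y)) →
    (∀ x, x ≠ 0 → 0 < σ x (D x)) →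
    ∃ (n : ℕ) (lam : Fin n → ℝ) (g : V ≃ₗ[ℝ] Cd n), (∀ j, 0 < lam j) ∧
      (∀ x y, omega (g x) (g y) = σ x y) ∧ ∀ x j, g (D x) j = Complex.I * lam j * g x j := by
  induction m with
  | zero =>
    intro V _ _ _ σ D hm _ _ _
    have hV : Subsingleton V := Module.finrank_zero_iff.1 (Nat.le_zero.1 hm)
    refine ⟨0, Fin.elim0, LinearEquiv.ofFinrankEq _ _ ?_, fun j => j.elim0, fun x y => ?_,
      fun x j => j.elim0⟩
    · rw [Nat.le_zero.1 hm, Module.finrank_zero_of_subsingleton]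
    · rw [Subsingleton.elim x 0, map_zero, omega_zero_left, map_zero, LinearMap.zero_apply]
  | succ m ih =>
    intro V _ _ _ σ D hm halt hD hpos
    rcases subsingleton_or_nontrivial V with hV | hV
    · exact ih σ D (by rw [Module.finrank_zero_of_subsingleton]; exact Nat.zero_le m) halt hD hpos
    have hself : ∀ x, σ x x = 0 := fun x => by linarith [halt x x]
    -- `D ∘ D` is symmetric for the positive definite form `σ x (D y)`.
    obtain ⟨ν, e₀, he₀, heq⟩ := exists_eigenvector_of_symmetric (σ.compl₂ D)
      (fun x y => by simp only [LinearMap.compl₂_apply]; rw [halt, hD]; ring_nf)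
      (fun x hx => hpos x hx) (D ∘ₗ D)
      (fun x y => by simp only [LinearMap.compl₂_apply, LinearMap.comp_apply, hD, neg_neg])
    rw [LinearMap.comp_apply] at heq
    have hν : ν < 0 := by
      have h1 := hpos e₀ he₀
      have h2 : D e₀ ≠ 0 := fun h => by simp [h] at h1
      have h3 := hpos _ h2
      rw [heq, map_smul, smul_eq_mul, halt] at h3
      nlinarith
    -- The normalized eigenplane, spanned by `e` and `f`, with `D e = κ f` and `D f = - κ e`.
    obtain ⟨κ, hκ, hκν⟩ : ∃ κ : ℝ, 0 < κ ∧ κ * κ = -ν :=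
      ⟨√(-ν), Real.sqrt_pos.2 (by linarith), Real.mul_self_sqrt (by linarith)⟩
    have hr : 0 < σ e₀ (D e₀) / κ := div_pos (hpos e₀ he₀) hκ
    obtain ⟨r, hr0, hrr⟩ : ∃ r : ℝ, 0 < r ∧ r * r = σ e₀ (D e₀) / κ :=
      ⟨√(σ e₀ (D e₀) / κ), Real.sqrt_pos.2 hr, Real.mul_self_sqrt hr.le⟩
    obtain ⟨e, he⟩ : ∃ e, e = r⁻¹ • e₀ := ⟨_, rfl⟩
    obtain ⟨f, hf⟩ : ∃ f, f = κ⁻¹ • D e := ⟨_, rfl⟩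
    have hDe : D e = κ • f := by rw [hf, smul_smul, mul_inv_cancel₀ hκ.ne', one_smul]
    have hDf : D f = -(κ • e) := by
      rw [hf, map_smul, he, map_smul, map_smul, heq, smul_smul, smul_smul, smul_smul, ← neg_smul]
      congr 1
      have : ν = -(κ * κ) := by linarith
      rw [this]
      field_simp
    have hef : σ e f = 1 := by
      rw [hf, he]
      simp only [map_smul, LinearMap.smul_apply, smul_eq_mul]
      have : σ e₀ (D e₀) = r * r * κ := by rw [hrr]; field_simp
      rw [this]
      field_simp
    have hfe : σ f e = -1 := by rw [halt, hef]
    -- The orthogonal of the eigenplane for `σ`, to which the induction hypothesis applies.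
    let W : Submodule ℝ V := LinearMap.ker (σ e) ⊓ LinearMap.ker (σ f)
    have hW : ∀ x, x ∈ W ↔ σ e x = 0 ∧ σ f x = 0 := fun x => by simp [W]
    have hDW : ∀ x ∈ W, D x ∈ W := by
      intro x hx
      rw [hW] at hx ⊢
      have h1 := hD e x
      have h2 := hD f x
      rw [hDe, map_smul, LinearMap.smul_apply, hx.2, smul_zero] at h1
      rw [hDf, map_neg, map_smul, LinearMap.neg_apply, LinearMap.smul_apply, hx.1, smul_zero] at h2
      constructor <;> linarith
    have hWlt : Module.finrank ℝ W ≤ m := by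
      have : W < ⊤ := by
        refine lt_top_iff_ne_top.2 fun h => ?_
        have h1 : e ∈ W := h ▸ Submodule.mem_top
        rw [hW, hfe] at h1
        norm_num at h1
      have := Submodule.finrank_lt this.ne
      omega
    obtain ⟨n, lam, g, hlam, hg, hgD⟩ := ih (σ.domRestrict₁₂ W W) (D.restrict hDW) hWlt
      (fun x y => halt _ _) (fun x y => hD _ _)
      (fun x hx => hpos x (by simpa using hx))
    -- The projection onto `W` along the eigenplane.
    let P : V →ₗ[ℝ] W := LinearMap.codRestrict W
      (LinearMap.id - (σ.flip f).smulRight e - (σ e).smulRight f) (fun x => by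
        rw [hW]
        simp [hself, hef, hfe, halt x f])
    have hP : ∀ x, (P x : V) = x - σ x f • e - σ e x • f := fun x => rfl
    let G : V →ₗ[ℝ] Cd (n + 1) :=
      { toFun := fun x => Fin.cons ((σ x f : ℂ) + σ e x * Complex.I) (g (P x))
        map_add' := fun x y => by
          refine funext (Fin.cases ?_ fun j => ?_)
          · simp; ring
          · simp
        map_smul' := fun c x => by
          refine funext (Fin.cases ?_ fun j => ?_)
          · simp; ring
          · simp }
    have hG0 : ∀ x, G x 0 = (σ x f : ℂ) + σ e x * Complex.I := fun x => rfl
    have hGs : ∀ x (j : Fin n), G x j.succ = g (P x) j := fun x j => rfl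
    have hdec : ∀ x, x = σ x f • e + σ e x • f + P x := fun x => by rw [hP]; abel
    have hinj : Function.Injective G := by
      refine (injective_iff_map_eq_zero G).2 fun x hx => ?_
      have h0 : (σ x f : ℂ) + σ e x * Complex.I = 0 := congrFun hx 0
      have h1 : σ x f = 0 := by simpa using congrArg Complex.re h0
      have h2 : σ e x = 0 := by simpa using congrArg Complex.im h0
      have h3 : g (P x) = 0 := funext fun j => congrFun hx j.succ
      rw [hdec x, h1, h2, g.map_eq_zero_iff.1 h3]
      simp
    have hsurj : Function.Surjective G := by
      intro c
      obtain ⟨w, hw⟩ := g.surjective (Fin.tail c)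
      have hw' := (hW w).1 w.2
      have hx1 : σ ((c 0).re • e + (c 0).im • f + w) f = (c 0).re := by
        have : σ w f = 0 := by rw [halt, hw'.2, neg_zero]
        simp [hef, hself, this]
      have hx2 : σ e ((c 0).re • e + (c 0).im • f + w) = (c 0).im := by
        simp [hef, hself, hw'.1]
      refine ⟨(c 0).re • e + (c 0).im • f + w, funext (Fin.cases ?_ fun j => ?_)⟩
      · rw [hG0, hx1, hx2, Complex.re_add_im]
      · rw [hGs]
        have : P ((c 0).re • e + (c 0).im • f + w) = w := by
          refine Subtype.ext ?_
          rw [hP, hx1, hx2]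
          abel
        rw [this, hw]
        rfl
    refine ⟨n + 1, Fin.cons κ lam, LinearEquiv.ofBijective G ⟨hinj, hsurj⟩,
      Fin.cases hκ hlam, fun x y => ?_, fun x => ?_⟩
    · have h1 : omega (G x) (G y) = (σ x f * σ e y - σ e x * σ y f) + σ (P x) (P y) := by
        rw [omega, Fin.sum_univ_succ]
        refine congrArg₂ _ ?_ (hg (P x) (P y))
        rw [hG0, hG0]
        simp
        ring
      change omega (G x) (G y) = _
      rw [h1, hP, hP]
      simp [hself, hef, hfe, halt f y, halt x e]
      ring
    · change ∀ j, G (D x) j = _ * G x j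
      have hx1 : σ (D x) f = -(κ * σ e x) := by
        rw [hD, hDf, map_neg, map_smul, halt x e, smul_eq_mul]; ring
      have hx2 : σ e (D x) = κ * σ x f := by
        rw [← neg_eq_iff_eq_neg.2 (hD e x), hDe, map_smul, LinearMap.smul_apply, halt f x,
          smul_eq_mul]
        ring
      refine Fin.cases ?_ fun j => ?_
      · rw [hG0, hG0, hx1, hx2]
        simp
        linear_combination (-(κ * σ e x) : ℂ) * Complex.I_sq
      · rw [hGs, hGs]
        have : P (D x) = D.restrict hDW (P x) := by
          refine Subtype.ext ?_
          rw [LinearMap.coe_restrict_apply, hP, hP, hx1, hx2, map_sub, map_sub, map_smul, map_smul,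
            hDe, hDf]
          module
        rw [this, hgD]
        rfl

/-! ### Semidirect sums carrying an invariant Lorentz form -/

instance (d : ℕ) : FiniteDimensional ℝ (HAlg d) :=
  inferInstanceAs (FiniteDimensional ℝ (ℝ × Cd d))

/-- The element of `HE_d` with given components. -/
def HAlg.mk {d : ℕ} (s : ℝ) (X : Cd d) : HAlg d := ((s, X) : ℝ × Cd d)

/-- The inclusion of `ℂ^d` in `HE_d`. -/
def HAlg.inrₗ (d : ℕ) : Cd d →ₗ[ℝ] HAlg d := LinearMap.inr ℝ ℝ (Cd d)

/-- The projection of `HE_d` onto its centre along `ℂ^d`. -/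
def HAlg.fstₗ (d : ℕ) : HAlg d →ₗ[ℝ] ℝ := LinearMap.fst ℝ ℝ (Cd d)

/-- The projection of `HE_d` onto `ℂ^d`. -/
def HAlg.sndₗ (d : ℕ) : HAlg d →ₗ[ℝ] Cd d := LinearMap.snd ℝ ℝ (Cd d)

theorem exists_omega_eq_of_ne_zero {d : ℕ} {X : Cd d} (hX : X ≠ 0) (s : ℝ) :
    ∃ Y, omega X Y = s := by
  obtain ⟨j, hj⟩ := Function.ne_iff.1 hX
  have hj' : starRingEnd ℂ (X j) ≠ 0 := (map_ne_zero _).2 hj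
  refine ⟨Pi.single j (s * Complex.I / starRingEnd ℂ (X j)), ?_⟩
  rw [omega, Finset.sum_eq_single j]
  · rw [Pi.single_eq_same, mul_div_cancel₀ _ hj']
    simp
  · intro k _ hk
    simp [hk]
  · simp

namespace AlgebraCircleAction

variable {d : ℕ} (ρ : AlgebraCircleAction d)

theorem hasDerivAt_exp (x : HAlg d) (s : ℝ) :
    HasDerivAt (fun s : ℝ => ρ.toHom (Circle.exp s) x) (ρ.gen (ρ.toHom (Circle.exp s) x)) s := by
  have h := HasDerivAt.comp_sub_const (f := fun u : ℝ =>
    ρ.toHom (Circle.exp u) (ρ.toHom (Circle.exp s) x)) s s (by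
      rw [sub_self]; exact ρ.hasDerivAt (ρ.toHom (Circle.exp s) x))
  refine h.congr_of_eventuallyEq (Filter.Eventually.of_forall fun u => ?_)
  change _ = (ρ.toHom (Circle.exp (u - s)) * ρ.toHom (Circle.exp s)) x
  rw [← map_mul, ← Circle.exp_add, sub_add_cancel]

/-- Since the flow of the generator is `2π`-periodic, its eigenvalues lie in `iℤ`. -/
theorem exists_eigenvalue_eq {α : HAlg d →ₗ[ℝ] ℂ} {c : ℂ} {x : HAlg d} (hx : α x ≠ 0)
    (h : ∀ θ, α (ρ.gen (ρ.toHom θ x)) = c * α (ρ.toHom θ x)) : ∃ n : ℤ, c = n * Complex.I := by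
  let α' : HAlg d →L[ℝ] ℂ := LinearMap.toContinuousLinearMap α
  have hu : ∀ s : ℝ, HasDerivAt (fun s : ℝ => α (ρ.toHom (Circle.exp s) x))
      (c * α (ρ.toHom (Circle.exp s) x)) s := fun s => by
    rw [← h]
    exact α'.hasFDerivAt.comp_hasDerivAt s (ρ.hasDerivAt_exp x s)
  have hv : ∀ s : ℝ, HasDerivAt
      (fun s : ℝ => α (ρ.toHom (Circle.exp s) x) * Complex.exp (-(c * (s : ℂ)))) 0 s := fun s => by
    have h1 : HasDerivAt (fun s : ℝ => -(c * (s : ℂ))) (-(c * 1)) s :=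
      ((Complex.ofRealCLM.hasDerivAt (x := s)).const_mul c).neg
    have h2 := (hu s).mul h1.cexp
    refine h2.congr_deriv ?_
    ring
  have hconst := is_const_of_deriv_eq_zero (fun s => (hv s).differentiableAt)
    (fun s => (hv s).deriv) (2 * Real.pi) 0
  simp only [Circle.exp_two_pi, Circle.exp_zero, map_one, Module.End.one_apply] at hconst
  have h3 : Complex.exp (-(c * ((2 * Real.pi : ℝ) : ℂ))) = 1 := by
    refine mul_left_cancel₀ hx (hconst.trans ?_)
    simp
  obtain ⟨n, hn⟩ := Complex.exp_eq_one_iff.1 h3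
  refine ⟨-n, ?_⟩
  have h4 : (2 * Real.pi : ℂ) ≠ 0 := by
    simp [Real.pi_ne_zero]
  refine mul_right_cancel₀ h4 ?_
  push_cast at hn ⊢
  linear_combination -hn

/-- The centre is an eigenline of the generator, with a real eigenvalue, hence the eigenvalue `0`. -/
theorem gen_center (s : ℝ) : ρ.gen (HAlg.mk s (0 : Cd d)) = 0 := by
  -- Both the group and the generator preserve the centre.
  have key : ∀ f : Module.End ℝ (HAlg d),
      (∀ x y : HAlg d, HAlg.sndₗ d (f ⁅x, y⁆) = 0) → ∀ s, HAlg.sndₗ d (f (HAlg.mk s 0)) = 0 := by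
    intro f hf s
    rcases isEmpty_or_nonempty (Fin d) with hd | ⟨⟨j⟩⟩
    · exact Subsingleton.elim _ _
    · obtain ⟨X, Y, hXY⟩ := exists_omega_eq j.pos s
      have := hf (HAlg.mk 0 X) (HAlg.mk 0 Y)
      rw [← hXY]
      exact this
  have h1 : ∀ θ s, HAlg.sndₗ d (ρ.toHom θ (HAlg.mk s 0)) = 0 := fun θ =>
    key _ fun x y => by rw [ρ.map_lie]; rfl
  have h2 : ∀ s, HAlg.sndₗ d (ρ.gen (HAlg.mk s 0)) = 0 :=
    key (ρ.gen : HAlg d →ₗ[ℝ] HAlg d) fun x y => by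
      change HAlg.sndₗ d (ρ.gen ⁅x, y⁆) = 0
      rw [LieDerivation.apply_lie_eq_add]
      exact add_zero (0 : Cd d)
  obtain ⟨c, hc⟩ : ∃ c, c = HAlg.fstₗ d (ρ.gen (HAlg.mk 1 (0 : Cd d))) := ⟨_, rfl⟩
  have h3 : ∀ x : HAlg d, HAlg.sndₗ d x = 0 → x = HAlg.fstₗ d x • HAlg.mk 1 (0 : Cd d) :=
    fun x hx => Prod.ext (mul_one x.1).symm (hx.trans (smul_zero x.1).symm)
  have h4 : ρ.gen (HAlg.mk 1 (0 : Cd d)) = c • HAlg.mk 1 (0 : Cd d) := by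
    rw [hc]; exact h3 _ (h2 1)
  obtain ⟨n, hn⟩ := ρ.exists_eigenvalue_eq (α := Complex.ofRealCLM.toLinearMap ∘ₗ HAlg.fstₗ d)
    (c := c) (x := HAlg.mk 1 0) (Complex.ofReal_ne_zero.2 one_ne_zero) (fun θ => by
      rw [h3 _ (h1 θ 1)]
      generalize HAlg.fstₗ d (ρ.toHom θ (HAlg.mk 1 0)) = r
      rw [map_smul, h4]
      change ((r * (c * 1) : ℝ) : ℂ) = (c : ℂ) * ((r * 1 : ℝ) : ℂ)
      push_cast
      ring)
  have hc0 : c = 0 := by simpa using congrArg Complex.re hn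
  rw [h3 (HAlg.mk s 0) rfl, map_smul, h4, hc0, zero_smul, smul_zero]

/-- The map induced by the generator on `ℂ^d`. -/
def genQuot : Cd d →ₗ[ℝ] Cd d :=
  HAlg.sndₗ d ∘ₗ (ρ.gen : HAlg d →ₗ[ℝ] HAlg d) ∘ₗ HAlg.inrₗ d

/-- The central component of the generator. -/
def genCenter : Cd d →ₗ[ℝ] ℝ :=
  HAlg.fstₗ d ∘ₗ (ρ.gen : HAlg d →ₗ[ℝ] HAlg d) ∘ₗ HAlg.inrₗ d

theorem gen_apply (x : HAlg d) : ρ.gen x = HAlg.mk (ρ.genCenter x.2) (ρ.genQuot x.2) := by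
  have h : x = HAlg.mk x.1 0 + HAlg.mk 0 x.2 :=
    Prod.ext (add_zero x.1).symm (zero_add x.2).symm
  conv_lhs => rw [h]
  rw [map_add, gen_center, zero_add]
  rfl

theorem omega_genQuot (X Y : Cd d) : omega (ρ.genQuot X) Y = -omega X (ρ.genQuot Y) := by
  have h := ρ.gen.apply_lie_eq_add (HAlg.mk 0 X) (HAlg.mk 0 Y)
  have h1 : ρ.gen ⁅HAlg.mk 0 X, HAlg.mk 0 Y⁆ = 0 := ρ.gen_center (omega X Y)
  rw [h1, gen_apply, gen_apply] at h
  have h2 : 0 = omega X (ρ.genQuot Y) + omega (ρ.genQuot X) Y := congrArg Prod.fst h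
  linarith

section Form

attribute [local instance] LieRing.ofAssociativeRing

/-- The inclusion of `HE_d` into the semidirect sum. -/
def incl : HAlg d →ₗ⁅ℝ⁆ ρ.SemidirectAlgebra := LieAlgebra.SemiDirectSum.inl ρ.genHom

theorem lie_inr_incl (x : HAlg d) :
    ⁅(⟨0, 1⟩ : ρ.SemidirectAlgebra), ρ.incl x⁆ = ρ.incl (ρ.gen x) := by
  refine LieAlgebra.SemiDirectSum.ext ?_ ?_
  · change ⁅(0 : HAlg d), x⁆ + (1 : ℝ) • ρ.gen x - ((0 : ℝ) • ρ.gen) 0 = ρ.gen x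
    simp
  · change ⁅(1 : ℝ), (0 : ℝ)⁆ = 0
    simp

/-- An invariant Lorentz form restricts on `HE_d` to a semidefinite form with kernel the centre, so
that the generator is definite on `ℂ^d`. -/
theorem exists_mul_omega_pos {B : LinearMap.BilinForm ℝ ρ.SemidirectAlgebra} (hB : IsLorentzian B)
    (hinv : B.lieInvariant ρ.SemidirectAlgebra) :
    ∃ β : ℝ, ∀ X : Cd d, X ≠ 0 → 0 < β * omega X (ρ.genQuot X) := by
  rcases subsingleton_or_nontrivial (Cd d) with hd | hd
  · exact ⟨0, fun X hX => (hX (Subsingleton.elim _ _)).elim⟩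
  obtain ⟨hsymm, v, hv, hpos⟩ := hB
  obtain ⟨Z, hZ⟩ : ∃ Z, Z = ρ.incl (HAlg.mk 1 0) := ⟨_, rfl⟩
  have hlie : ∀ x y : HAlg d, ⁅ρ.incl x, ρ.incl y⁆ = omega x.2 y.2 • Z := fun x y => by
    rw [← LieHom.map_lie, hZ, ← map_smul]
    congr 1
    exact Prod.ext (mul_one _).symm (smul_zero _).symm
  have hZ0 : Z ≠ 0 := by
    rw [hZ]
    intro h
    have h1 : (HAlg.mk 1 (0 : Cd d)) = 0 := congrArg LieAlgebra.SemiDirectSum.left h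
    exact one_ne_zero (congrArg Prod.fst h1 : (1 : ℝ) = 0)
  -- `Z` is orthogonal to `x` because `B x ⁅x, y⁆ = -B ⁅x, x⁆ y = 0`.
  have hperp : ∀ x : HAlg d, x.2 ≠ 0 → B (ρ.incl x) Z = 0 := fun x hx => by
    obtain ⟨Y, hY⟩ := exists_omega_eq_of_ne_zero hx 1
    have h := hinv (ρ.incl x) (ρ.incl x) (ρ.incl (HAlg.mk 0 Y))
    rw [hlie, hlie, omega_self, zero_smul, map_zero, LinearMap.zero_apply] at h
    change 0 = -B (ρ.incl x) (omega x.2 Y • Z) at h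
    rw [hY, one_smul] at h
    linarith
  obtain ⟨X₀, hX₀⟩ := exists_ne (0 : Cd d)
  have hZZ : B Z Z = 0 := by
    have h1 := hperp (HAlg.mk 0 X₀) hX₀
    have h2 := hperp (HAlg.mk 0 X₀ + HAlg.mk 1 0) (by
      change X₀ + 0 ≠ 0
      rwa [add_zero])
    rw [map_add, map_add, LinearMap.add_apply, h1, zero_add, ← hZ] at h2
    exact h2
  have hperp' : ∀ x : HAlg d, B (ρ.incl x) Z = 0 := fun x => by
    by_cases hx : x.2 = 0
    · have : x = x.1 • HAlg.mk 1 0 := Prod.ext (mul_one x.1).symm (hx.trans (smul_zero x.1).symm)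
      rw [this, map_smul, map_smul, LinearMap.smul_apply, ← hZ, hZZ, smul_zero]
    · exact hperp x hx
  have hvZ : B v Z ≠ 0 := fun h => (hpos Z hZ0 h).ne' hZZ
  -- Subtracting a multiple of the isotropic vector `Z` makes `x` orthogonal to the negative
  -- direction `v`.
  have hincl : ∀ x : HAlg d, x.2 ≠ 0 → 0 < B (ρ.incl x) (ρ.incl x) := fun x hx => by
    have h1 := hpos (ρ.incl x - (B v (ρ.incl x) / B v Z) • Z) (fun h => hx (by
      have h2 : x - (B v (ρ.incl x) / B v Z) • HAlg.mk 1 0 = 0 :=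
        congrArg LieAlgebra.SemiDirectSum.left ((congrArg (_ - _ • ·) hZ.symm).trans h)
      have h3 : x.2 - (B v (ρ.incl x) / B v Z) • (0 : Cd d) = 0 := congrArg Prod.snd h2
      simpa using h3)) (by
      rw [map_sub, map_smul, smul_eq_mul, div_mul_cancel₀ _ hvZ, sub_self])
    simpa only [map_sub, map_smul, LinearMap.sub_apply, LinearMap.smul_apply, hperp', hZZ,
      hsymm Z, smul_zero, sub_zero] using h1
  have hgen : ∀ x y : HAlg d,
      B (ρ.incl (ρ.gen x)) (ρ.incl y) = B ⟨0, 1⟩ Z * omega x.2 y.2 := fun x y => by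
    have h := hinv (ρ.incl x) ⟨0, 1⟩ (ρ.incl y)
    rw [hlie, ← lie_skew, lie_inr_incl, map_neg, LinearMap.neg_apply, neg_inj, map_smul] at h
    rw [h, smul_eq_mul, mul_comm]
  have hβ : B ⟨0, 1⟩ Z ≠ 0 := fun h => hvZ (by
    have h1 : v = ρ.incl v.left + v.right • ⟨0, 1⟩ := LieAlgebra.SemiDirectSum.ext
      (by change v.left = v.left + v.right • (0 : HAlg d); simp)
      (by change v.right = 0 + v.right • (1 : ℝ); simp)
    rw [h1, map_add, map_smul, LinearMap.add_apply, LinearMap.smul_apply, h, hperp', smul_zero,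
      add_zero])
  refine ⟨B ⟨0, 1⟩ Z, fun X hX => ?_⟩
  have h1 : ρ.genQuot X ≠ 0 := fun h => by
    obtain ⟨Y, hY⟩ := exists_omega_eq_of_ne_zero hX 1
    have h2 := hgen (HAlg.mk 0 X) (HAlg.mk 0 Y)
    have h3 : ρ.gen (HAlg.mk 0 X) = ρ.genCenter X • HAlg.mk 1 0 := by
      rw [gen_apply]
      exact Prod.ext (mul_one _).symm (h.trans (smul_zero _).symm)
    rw [h3, map_smul, map_smul, ← hZ, LinearMap.smul_apply, hsymm, hperp', smul_zero] at h2
    change 0 = _ * omega X Y at h2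
    rw [hY, mul_one] at h2
    exact hβ h2.symm
  have h2 := hgen (HAlg.mk 0 X) (ρ.gen (HAlg.mk 0 X))
  have h3 := hincl (ρ.gen (HAlg.mk 0 X)) (by rw [gen_apply]; exact h1)
  rw [h2] at h3
  rwa [gen_apply] at h3

/-- In symplectic coordinates which diagonalize the generator, the semidirect sum has the structure
constants of a twisted Heisenberg algebra; periodicity makes the weights integers. -/
theorem exists_isTwisted_of_isLorentzian {B : LinearMap.BilinForm ℝ ρ.SemidirectAlgebra}
    (hB : IsLorentzian B) (hinv : B.lieInvariant ρ.SemidirectAlgebra) :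
    ∃ ψ : CircleAction d, ψ.IsTwisted ∧
      Nonempty (GroupLieAlgebra (SCorners d) (Semidirect ψ) ≃ₗ⁅ℝ⁆ ρ.SemidirectAlgebra) := by
  obtain ⟨β, hβ⟩ := ρ.exists_mul_omega_pos hB hinv
  obtain ⟨ε, hε, hεpos⟩ : ∃ ε : ℝ, (ε = 1 ∨ ε = -1) ∧
      ∀ X : Cd d, X ≠ 0 → 0 < omega X ((ε • ρ.genQuot) X) := by
    rcases le_or_gt 0 β with h | h
    · refine ⟨1, Or.inl rfl, fun X hX => ?_⟩
      rw [one_smul]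
      exact pos_of_mul_pos_right (hβ X hX) h
    · refine ⟨-1, Or.inr rfl, fun X hX => ?_⟩
      rw [LinearMap.smul_apply, omega_smul_right]
      nlinarith [hβ X hX]
  obtain ⟨n, lam', g, hlam', hg, hgD⟩ := exists_symplectic_diagonalization _
    (LinearMap.mk₂ ℝ omega omega_add_left omega_smul_left omega_add_right omega_smul_right)
    (ε • ρ.genQuot) le_rfl (fun X Y => omega_swap Y X)
    (fun X Y => by
      rw [LinearMap.mk₂_apply, LinearMap.mk₂_apply, LinearMap.smul_apply, LinearMap.smul_apply]
      change omega (ε • ρ.genQuot X) Y = -omega X (ε • ρ.genQuot Y)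
      rw [omega_smul_left, omega_smul_right, omega_genQuot]; ring) hεpos
  obtain rfl : n = d := by
    have := g.finrank_eq
    simp [Module.finrank_pi_fintype, Complex.finrank_real_complex] at this
    omega
  have hεε : ε * ε = 1 := by rcases hε with rfl | rfl <;> norm_num
  have hgD' : ∀ X j, g (ρ.genQuot X) j = Complex.I * (ε * lam' j : ℝ) * g X j := fun X j => by
    have h1 : ρ.genQuot X = ε • (ε • ρ.genQuot) X := by
      rw [LinearMap.smul_apply, smul_smul, hεε, one_smul]
    rw [h1, map_smul, Pi.smul_apply, hgD, Complex.real_smul]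
    push_cast
    ring
  have hint : ∀ j, ∃ m : ℤ, (m : ℝ) = ε * lam' j := fun j => by
    obtain ⟨m, hm⟩ := ρ.exists_eigenvalue_eq
      (α := (LinearMap.proj j : Cd n →ₗ[ℝ] ℂ) ∘ₗ g.toLinearMap ∘ₗ HAlg.sndₗ n)
      (c := Complex.I * (ε * lam' j : ℝ)) (x := HAlg.mk 0 (g.symm (Pi.single j 1)))
      (by
        change g (g.symm (Pi.single j 1)) j ≠ 0
        simp)
      (fun θ => by
        rw [gen_apply]
        exact hgD' _ j)
    refine ⟨m, ?_⟩
    have := congrArg Complex.im hm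
    simpa using this.symm
  choose lam hlam using hint
  have hsign : (∀ j, 0 < lam j) ∨ (∀ j, lam j < 0) := by
    rcases hε with rfl | rfl
    · refine Or.inl fun j => ?_
      have : (0 : ℝ) < lam j := by rw [hlam]; linarith [hlam' j]
      exact_mod_cast this
    · refine Or.inr fun j => ?_
      have : (lam j : ℝ) < 0 := by rw [hlam]; linarith [hlam' j]
      exact_mod_cast this
  have hrot : ∀ X, ρ.genQuot (g.symm X) = g.symm (rotGen lam X) := fun X => by
    refine g.injective (funext fun j => ?_)
    rw [hgD', g.apply_symm_apply, g.apply_symm_apply, rotGen_apply, ← hlam]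
    push_cast
    ring
  have hinj : Function.Injective ρ.genQuot := by
    refine (injective_iff_map_eq_zero _).2 fun X hX => ?_
    by_contra h
    have := hεpos X h
    rw [LinearMap.smul_apply, hX, smul_zero, omega_zero_right] at this
    exact this.false
  -- The central component of the generator is removed by the change of coordinates `κ`.
  obtain ⟨κ, hκ⟩ : ∃ κ : Cd n →ₗ[ℝ] ℝ, ∀ X, κ (ρ.genQuot X) = ρ.genCenter X :=
    ⟨ρ.genCenter ∘ₗ (LinearEquiv.ofInjectiveEndo ρ.genQuot hinj).symm.toLinearMap, fun X =>
      congrArg ρ.genCenter ((LinearEquiv.ofInjectiveEndo ρ.genQuot hinj).symm_apply_apply X)⟩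
  let S : Coord n ≃ₗ[ℝ] ρ.SemidirectAlgebra :=
    { toFun := fun v => ⟨HAlg.mk (v.1 + κ (g.symm v.2.1)) (g.symm v.2.1), v.2.2⟩
      invFun := fun x => (HAlg.fstₗ n x.left - κ (HAlg.sndₗ n x.left), g (HAlg.sndₗ n x.left),
        x.right)
      map_add' := fun v w => LieAlgebra.SemiDirectSum.ext (Prod.ext (by
        change v.1 + w.1 + κ (g.symm (v.2.1 + w.2.1))
          = v.1 + κ (g.symm v.2.1) + (w.1 + κ (g.symm w.2.1))
        rw [map_add, map_add]; ring) (map_add g.symm _ _)) rfl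
      map_smul' := fun c v => LieAlgebra.SemiDirectSum.ext (Prod.ext (by
        change c * v.1 + κ (g.symm (c • v.2.1)) = c * (v.1 + κ (g.symm v.2.1))
        rw [map_smul, map_smul, smul_eq_mul]; ring) (map_smul g.symm _ _)) rfl
      left_inv := fun v => by
        refine Prod.ext ?_ (Prod.ext (g.apply_symm_apply _) rfl)
        exact add_sub_cancel_right v.1 (κ (g.symm v.2.1))
      right_inv := fun x => by
        refine LieAlgebra.SemiDirectSum.ext (Prod.ext ?_ (g.symm_apply_apply _)) rfl
        change HAlg.fstₗ n x.left - κ (HAlg.sndₗ n x.left)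
          + κ (g.symm (g (HAlg.sndₗ n x.left))) = HAlg.fstₗ n x.left
        rw [g.symm_apply_apply, sub_add_cancel] }
  refine ⟨stdAction lam, stdAction_isTwisted hsign, nonempty_lieEquiv_of_lie_eq lam S
    fun v w => LieAlgebra.SemiDirectSum.ext ?_ ?_⟩
  · change ⁅HAlg.mk (v.1 + κ (g.symm v.2.1)) (g.symm v.2.1),
        HAlg.mk (w.1 + κ (g.symm w.2.1)) (g.symm w.2.1)⁆
      + v.2.2 • ρ.gen (HAlg.mk (w.1 + κ (g.symm w.2.1)) (g.symm w.2.1))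
      - w.2.2 • ρ.gen (HAlg.mk (v.1 + κ (g.symm v.2.1)) (g.symm v.2.1))
      = HAlg.mk (omega v.2.1 w.2.1
          + κ (g.symm (v.2.2 • rotGen lam w.2.1 - w.2.2 • rotGen lam v.2.1)))
        (g.symm (v.2.2 • rotGen lam w.2.1 - w.2.2 • rotGen lam v.2.1))
    rw [gen_apply, gen_apply]
    refine Prod.ext ?_ ?_
    · change omega (g.symm v.2.1) (g.symm w.2.1) + v.2.2 * ρ.genCenter (g.symm w.2.1)
        - w.2.2 * ρ.genCenter (g.symm v.2.1) = omega v.2.1 w.2.1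
          + κ (g.symm (v.2.2 • rotGen lam w.2.1 - w.2.2 • rotGen lam v.2.1))
      have h1 := hg (g.symm v.2.1) (g.symm w.2.1)
      rw [g.apply_symm_apply, g.apply_symm_apply] at h1
      rw [map_sub, map_smul, map_smul, ← hrot, ← hrot, map_sub, map_smul, map_smul, hκ, hκ, h1,
        smul_eq_mul, smul_eq_mul]
      change _ = omega (g.symm v.2.1) (g.symm w.2.1) + _
      ring
    · change (0 : Cd n) + v.2.2 • ρ.genQuot (g.symm w.2.1) - w.2.2 • ρ.genQuot (g.symm v.2.1)
        = g.symm (v.2.2 • rotGen lam w.2.1 - w.2.2 • rotGen lam v.2.1)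
      rw [zero_add, map_sub, map_smul, map_smul, ← hrot, ← hrot]
  · change ⁅v.2.2, w.2.2⁆ = 0
    rw [Ring.lie_def, mul_comm, sub_self]

end Form

end AlgebraCircleAction

end Heisenberg

end

noncomputable section

open MeasureTheory Set

namespace Heisenberg

/-! ### Lattices in topological groups -/

/-- The space `X` carries a nonzero finite Borel measure invariant under `G`. -/
def HasFiniteInvariantMeasure (G X : Type*) [TopologicalSpace X] [SMul G X] : Prop :=
  ∃ (_ : MeasurableSpace X) (_ : BorelSpace X) (μ : Measure X),
    IsFiniteMeasure μ ∧ μ ≠ 0 ∧ ∀ g : G, μ.map (fun x => g • x) = μ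

/-- Invariant measures can be pushed forward along a continuous map which carries the action of
suitable elements of `G` to the action of any given element of `H`. -/
theorem HasFiniteInvariantMeasure.map {G H X Y : Type*} [TopologicalSpace X] [TopologicalSpace Y]
    [SMul G X] [SMul H Y] [ContinuousConstSMul G X] [ContinuousConstSMul H Y] {e : X → Y}
    (hX : HasFiniteInvariantMeasure G X) (he : Continuous e)
    (h : ∀ b : H, ∃ a : G, ∀ x, e (a • x) = b • e x) : HasFiniteInvariantMeasure H Y := by
  obtain ⟨_, _, μ, _, hμ0, hμ⟩ := hX
  borelize Y
  refine ⟨inferInstance, inferInstance, μ.map e, inferInstance,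
    (Measure.map_ne_zero_iff he.aemeasurable).2 hμ0, fun b => ?_⟩
  obtain ⟨a, ha⟩ := h b
  conv_rhs => rw [← hμ a]
  rw [Measure.map_map (continuous_const_smul b).measurable he.measurable,
    Measure.map_map he.measurable (continuous_const_smul a).measurable]
  congr 1
  exact funext fun x => (ha x).symm

section Discrete

variable {G : Type*} [Group G] [TopologicalSpace G]

theorem discreteTopology_iff_exists_isOpen [IsTopologicalGroup G] {Γ : Subgroup G} :
    DiscreteTopology Γ ↔ ∃ U : Set G, IsOpen U ∧ 1 ∈ U ∧ ∀ x ∈ U, x ∈ Γ → x = 1 := by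
  rw [discreteTopology_iff_isOpen_singleton_one, isOpen_induced_iff]
  constructor
  · rintro ⟨U, hU, h⟩
    refine ⟨U, hU, ?_, fun x hx hxΓ => ?_⟩
    · have : (1 : Γ) ∈ Subtype.val ⁻¹' U := by rw [h]; rfl
      exact this
    · have : (⟨x, hxΓ⟩ : Γ) ∈ Subtype.val ⁻¹' U := hx
      rw [h] at this
      exact congrArg Subtype.val this
  · rintro ⟨U, hU, h1, h⟩
    refine ⟨U, hU, Set.ext fun x => ⟨fun hx => Subtype.ext (h x hx x.2), ?_⟩⟩
    rintro rfl
    exact h1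

theorem finite_inter_of_isCompact [IsTopologicalGroup G] [T2Space G] {Γ : Subgroup G}
    [DiscreteTopology Γ] {K : Set G} (hK : IsCompact K) : (K ∩ Γ).Finite := by
  have hΓ : IsDiscrete (Γ : Set G) := isDiscrete_iff_discreteTopology.2 ‹_›
  exact (hK.inter_right Subgroup.isClosed_of_discrete).finite (hΓ.mono inter_subset_right)

end Discrete

section Lattice

variable {G H : Type*} [Group G] [TopologicalSpace G] [IsTopologicalGroup G] [Group H]
  [TopologicalSpace H] [IsTopologicalGroup H]

theorem IsLattice.of_le {Γ Γ' : Subgroup G} (h : IsLattice Γ) (hle : Γ ≤ Γ')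
    (hd : DiscreteTopology Γ') : IsLattice Γ' := by
  refine ⟨hd, HasFiniteInvariantMeasure.map (G := G) (H := G) (X := G ⧸ Γ) h.2
    (e := Subgroup.quotientMapOfLE hle) ?_
    fun g => ⟨g, fun x => ?_⟩⟩
  · rw [← QuotientGroup.isOpenQuotientMap_mk.continuous_comp_iff]
    exact QuotientGroup.continuous_mk
  · obtain ⟨x, rfl⟩ := QuotientGroup.mk_surjective x
    rfl

/-- For an open surjective homomorphism `f` with discrete kernel, the quotients `G ⧸ f⁻¹(Λ)` and
`H ⧸ Λ` are identified. -/
theorem isLattice_comap_iff {f : G →* H} (hf : Continuous f) (hopen : IsOpenMap f)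
    (hsurj : Function.Surjective f) (hker : DiscreteTopology f.ker) {Λ : Subgroup H} :
    IsLattice (Λ.comap f) ↔ IsLattice Λ := by
  let e : G ⧸ Λ.comap f → H ⧸ Λ := Quotient.lift (fun g => (f g : H ⧸ Λ)) fun a b hab => by
    have hab' : a⁻¹ * b ∈ Λ.comap f := QuotientGroup.leftRel_apply.1 hab
    refine QuotientGroup.eq.2 ?_
    rwa [Subgroup.mem_comap, map_mul, map_inv] at hab'
  have he : ∀ g : G, e (g : G ⧸ Λ.comap f) = (f g : H ⧸ Λ) := fun g => rfl
  have hecont : Continuous e := by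
    rw [← QuotientGroup.isOpenQuotientMap_mk.continuous_comp_iff]
    exact QuotientGroup.continuous_mk.comp hf
  have hesmul : ∀ (g : G) x, e (g • x) = f g • e x := fun g x => by
    obtain ⟨x, rfl⟩ := QuotientGroup.mk_surjective x
    exact congrArg _ (map_mul f g x)
  have hebij : Function.Bijective e := by
    refine ⟨fun x y hxy => ?_, fun y => ?_⟩
    · obtain ⟨x, rfl⟩ := QuotientGroup.mk_surjective x
      obtain ⟨y, rfl⟩ := QuotientGroup.mk_surjective y
      rw [he, he, QuotientGroup.eq, ← map_inv, ← map_mul] at hxy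
      exact QuotientGroup.eq.2 hxy
    · obtain ⟨y, rfl⟩ := QuotientGroup.mk_surjective y
      obtain ⟨g, rfl⟩ := hsurj y
      exact ⟨g, rfl⟩
  have heopen : IsOpenMap e := fun U hU => by
    have : e '' U = (fun h : H => (h : H ⧸ Λ)) ''
        (f '' ((fun g : G => (g : G ⧸ Λ.comap f)) ⁻¹' U)) := by
      ext y
      constructor
      · rintro ⟨x, hx, rfl⟩
        obtain ⟨g, rfl⟩ := QuotientGroup.mk_surjective x
        exact ⟨_, ⟨g, hx, rfl⟩, rfl⟩
      · rintro ⟨_, ⟨g, hg, rfl⟩, rfl⟩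
        exact ⟨_, hg, rfl⟩
    rw [this]
    exact QuotientGroup.isOpenMap_coe _ (hopen _ (hU.preimage QuotientGroup.continuous_mk))
  let E : (G ⧸ Λ.comap f) ≃ₜ (H ⧸ Λ) :=
    (Equiv.ofBijective e hebij).toHomeomorphOfContinuousOpen hecont heopen
  have hE : ∀ x, E x = e x := fun x => rfl
  refine and_congr ?_ ⟨fun h => ?_, fun h => ?_⟩
  · rw [discreteTopology_iff_exists_isOpen, discreteTopology_iff_exists_isOpen]
    constructor
    · rintro ⟨U, hU, h1, h⟩
      refine ⟨f '' U, hopen U hU, ⟨1, h1, map_one f⟩, ?_⟩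
      rintro _ ⟨x, hx, rfl⟩ hxΛ
      rw [h x hx hxΛ, map_one]
    · rintro ⟨U, hU, h1, h⟩
      obtain ⟨V, hV, hV1, hVk⟩ := discreteTopology_iff_exists_isOpen.1 hker
      refine ⟨V ∩ f ⁻¹' U, hV.inter (hU.preimage hf), ⟨hV1, by simpa using h1⟩, fun x hx hxΛ => ?_⟩
      exact hVk x hx.1 (f.mem_ker.2 (h _ hx.2 hxΛ))
  · exact HasFiniteInvariantMeasure.map (G := G) (H := H) h hecont fun b => by
      obtain ⟨a, rfl⟩ := hsurj b
      exact ⟨a, hesmul a⟩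
  · refine HasFiniteInvariantMeasure.map (G := H) (H := G) h E.symm.continuous fun a =>
      ⟨f a, fun x => ?_⟩
    rw [E.symm_apply_eq, hE, hesmul, ← hE, E.apply_symm_apply]

theorem discreteTopology_map_of_isInducing {f : G →* H} (hf : Topology.IsInducing f)
    {Γ : Subgroup G} (h : DiscreteTopology Γ) : DiscreteTopology (Γ.map f) := by
  rw [discreteTopology_iff_exists_isOpen] at h ⊢
  obtain ⟨U, hU, h1, h⟩ := h
  obtain ⟨V, hV, rfl⟩ := hf.isOpen_iff.1 hU
  refine ⟨V, hV, by simpa using h1, ?_⟩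
  rintro _ hx ⟨x, hxΓ, rfl⟩
  rw [h x hx hxΓ, map_one]

theorem discreteTopology_comap_of_injective {f : G →* H} (hf : Continuous f)
    (hinj : Function.Injective f) {Γ : Subgroup H} (h : DiscreteTopology Γ) :
    DiscreteTopology (Γ.comap f) := by
  rw [discreteTopology_iff_exists_isOpen] at h ⊢
  obtain ⟨U, hU, h1, h⟩ := h
  exact ⟨f ⁻¹' U, hU.preimage hf, by simpa using h1, fun x hx hxΓ =>
    hinj ((h _ hx hxΓ).trans (map_one f).symm)⟩

/-- A continuous function on the quotient by a lattice cannot be translated by all constants, since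
it would push the invariant measure to a finite Haar measure of the real line. -/
theorem IsLattice.false_of_translation {Γ : Subgroup G} (h : IsLattice Γ) {F : G → ℝ}
    (hF : Continuous F) (hΓ : ∀ x, ∀ γ ∈ Γ, F (x * γ) = F x)
    (htr : ∀ c, ∃ g, ∀ x, F (g * x) = F x + c) : False := by
  let e : G ⧸ Γ → ℝ := Quotient.lift F fun a b hab => by
    have hab' : a⁻¹ * b ∈ Γ := QuotientGroup.leftRel_apply.1 hab
    rw [← hΓ a _ hab', mul_inv_cancel_left]
  have he : Continuous e := by
    rw [← QuotientGroup.isOpenQuotientMap_mk.continuous_comp_iff]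
    exact hF
  obtain ⟨_, _, μ, _, hμ0, hμ⟩ := h.2
  have hinv : ∀ c : ℝ, (μ.map e).map (c + ·) = μ.map e := fun c => by
    obtain ⟨g, hg⟩ := htr c
    conv_rhs => rw [← hμ g]
    rw [Measure.map_map (measurable_const_add c) he.measurable,
      Measure.map_map he.measurable (continuous_const_smul g).measurable]
    congr 1
    funext x
    obtain ⟨x, rfl⟩ := QuotientGroup.mk_surjective x
    exact (add_comm _ _).trans (hg x).symm
  have : (μ.map e).IsAddLeftInvariant := ⟨hinv⟩
  have : NeZero (μ.map e) := ⟨(Measure.map_ne_zero_iff he.aemeasurable).2 hμ0⟩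
  have : (μ.map e).IsOpenPosMeasure := isOpenPosMeasure_of_addLeftInvariant_of_regular
  exact measure_ne_top (μ.map e) univ (measure_univ_of_isAddLeftInvariant _)

end Lattice

/-! ### Cocompact discrete subgroups -/

section Cocompact

variable {G : Type*} [Group G] [TopologicalSpace G] [IsTopologicalGroup G]

/-- A cocompact discrete subgroup has a Borel fundamental domain covered by finitely many
translates of a given small neighbourhood of the identity. -/
theorem exists_measurableSet_existsUnique [MeasurableSpace G] [BorelSpace G] {Γ : Subgroup G}
    {U : Set G} (hU : IsOpen U) (h1 : (1 : G) ∈ U) (hUΓ : ∀ x ∈ U, ∀ y ∈ U, x⁻¹ * y ∈ Γ → x = y)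
    {K : Set G} (hK : IsCompact K) (hKΓ : ∀ x, ∃ γ ∈ Γ, x * γ ∈ K) :
    ∃ (n : ℕ) (g : Fin n → G) (D : Set G), MeasurableSet D ∧ (D ⊆ ⋃ i, (g i * ·) ⁻¹' U) ∧
      ∀ x : G, ∃! γ : Γ, x * (γ : G) ∈ D := by
  obtain ⟨t, ht⟩ := hK.elim_finite_subcover (fun g : G => (g * ·) ⁻¹' U)
    (fun g => hU.preimage (continuous_const_mul g))
    (fun x _ => mem_iUnion.2 ⟨x⁻¹, by simpa using h1⟩)
  obtain ⟨n, g, hg⟩ : ∃ (n : ℕ) (g : Fin n → G), ∀ a ∈ t, ∃ i, g i = a :=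
    ⟨t.card, fun i => t.equivFin.symm i, fun a ha => ⟨t.equivFin ⟨a, ha⟩, by simp⟩⟩
  let V : Fin n → Set G := fun i => (g i * ·) ⁻¹' U
  have hV : ∀ i, IsOpen (V i) := fun i => hU.preimage (continuous_const_mul _)
  let W : Fin n → Set G := fun i => ⋃ γ : Γ, (· * (γ : G)) ⁻¹' V i
  have hW : ∀ i, IsOpen (W i) := fun i =>
    isOpen_iUnion fun γ => (hV i).preimage (continuous_mul_const _)
  have hWΓ : ∀ i (x : G) (γ : Γ), x * (γ : G) ∈ W i → x ∈ W i := fun i x γ h => by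
    obtain ⟨δ, hδ⟩ := mem_iUnion.1 h
    exact mem_iUnion.2 ⟨γ * δ, by simpa [mul_assoc] using hδ⟩
  -- From each translate `V i`, the orbits which meet an earlier translate are removed.
  let D : Set G := ⋃ i, V i \ ⋃ j, ⋃ _ : j < i, W j
  have hDmem : ∀ y, y ∈ D ↔ ∃ i, y ∈ V i ∧ ∀ j < i, y ∉ W j := fun y => by simp [D]
  refine ⟨n, g, D, MeasurableSet.iUnion fun i => (hV i).measurableSet.diff
    (MeasurableSet.iUnion fun j => MeasurableSet.iUnion fun _ => (hW j).measurableSet),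
    iUnion_mono fun i => sdiff_subset, fun x => ?_⟩
  have hex : ∃ i, x ∈ W i := by
    obtain ⟨γ, hγ, hx⟩ := hKΓ x
    obtain ⟨a, ha⟩ := mem_iUnion.1 (ht hx)
    obtain ⟨hat, ha⟩ := mem_iUnion.1 ha
    obtain ⟨i, rfl⟩ := hg a hat
    exact ⟨i, mem_iUnion.2 ⟨⟨γ, hγ⟩, ha⟩⟩
  have huniq : ∀ (γ δ : Γ) (i j : Fin n), x * (γ : G) ∈ V i → (∀ k < j, x * (δ : G) ∉ W k) →
      ¬ i < j := by
    intro γ δ i j hγ hδ hij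
    refine hδ i hij (mem_iUnion.2 ⟨δ⁻¹ * γ, ?_⟩)
    simpa [mul_assoc] using hγ
  obtain ⟨i, hi, hmin⟩ := WellFounded.has_min (wellFounded_lt (α := Fin n)) {i | x ∈ W i} hex
  obtain ⟨γ, hγ⟩ := mem_iUnion.1 hi
  have hγD : ∀ j < i, x * (γ : G) ∉ W j := fun j hj h => hmin j (hWΓ j x γ h) hj
  refine ⟨γ, (hDmem _).2 ⟨i, hγ, hγD⟩, fun δ hδ => ?_⟩
  obtain ⟨j, hj, hjmin⟩ := (hDmem _).1 hδ
  have hij : i = j :=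
    le_antisymm (not_lt.1 (huniq δ γ j i hj hγD)) (not_lt.1 (huniq γ δ i j hγ hjmin))
  subst hij
  have := hUΓ _ hj _ hγ (by
    have : (g i * (x * δ))⁻¹ * (g i * (x * γ)) = ((δ⁻¹ * γ : Γ) : G) := by
      push_cast; group
    rw [this]
    exact (δ⁻¹ * γ).2)
  exact Subtype.ext (mul_left_cancel (mul_left_cancel this))

/-- A cocompact discrete subgroup of a unimodular group is a lattice. -/
theorem isLattice_of_cocompact [T2Space G] [SecondCountableTopology G] [MeasurableSpace G]
    [BorelSpace G] (ν : Measure G) [IsLocallyFiniteMeasure ν] [ν.IsMulLeftInvariant]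
    [ν.IsMulRightInvariant] (hν : ν ≠ 0) {Γ : Subgroup G} (hΓ : DiscreteTopology Γ) {K : Set G}
    (hK : IsCompact K) (hKΓ : ∀ x, ∃ γ ∈ Γ, x * γ ∈ K) : IsLattice Γ := by
  have : Countable Γ := TopologicalSpace.separableSpace_iff_countable.1 inferInstance
  obtain ⟨U₁, hU₁, h1U₁, hU₁Γ⟩ := discreteTopology_iff_exists_isOpen.1 hΓ
  obtain ⟨U₂, hU₂, hU₂Γ⟩ : ∃ U₂ ∈ nhds (1 : G), ∀ x ∈ U₂, ∀ y ∈ U₂, x⁻¹ * y ∈ U₁ := by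
    have hc : Filter.Tendsto (fun p : G × G => p.1⁻¹ * p.2) (nhds 1 ×ˢ nhds 1) (nhds 1) := by
      rw [← nhds_prod_eq]
      have : Continuous fun p : G × G => p.1⁻¹ * p.2 := by fun_prop
      simpa using this.tendsto (1, 1)
    obtain ⟨U₂, hU₂, h⟩ := Filter.mem_prod_same_iff.1 (hc (hU₁.mem_nhds h1U₁))
    exact ⟨U₂, hU₂, fun x hx y hy => h (mk_mem_prod hx hy)⟩
  obtain ⟨U₃, hU₃, hfin⟩ := ν.finiteAt_nhds (1 : G)
  obtain ⟨U, hUsub, hU, h1U⟩ := mem_nhds_iff.1 (Filter.inter_mem hU₂ hU₃)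
  have hνU : ν U < ⊤ := (measure_mono (hUsub.trans inter_subset_right)).trans_lt hfin
  obtain ⟨n, g, D, hD, hDU, hDuniq⟩ := exists_measurableSet_existsUnique (Γ := Γ) hU h1U
    (fun x hx y hy hxy => inv_mul_eq_one.1
      (hU₁Γ _ (hU₂Γ x (hUsub hx).1 y (hUsub hy).1) hxy)) hK hKΓ
  have hνD : ν D < ⊤ := by
    refine (measure_mono hDU).trans_lt ((measure_iUnion_le _).trans_lt ?_)
    rw [tsum_fintype]
    exact ENNReal.sum_lt_top.2 fun i _ => by rwa [measure_preimage_mul]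
  have hfund : ∀ a : G, IsFundamentalDomain Γ.op ((a * ·) ⁻¹' D) ν := fun a => by
    refine IsFundamentalDomain.mk' (hD.preimage (measurable_const_mul a)).nullMeasurableSet
      fun x => ?_
    obtain ⟨γ, hγ, huniq⟩ := hDuniq (a * x)
    refine ⟨⟨MulOpposite.op γ, γ.2⟩, ?_, ?_⟩
    · change a * (x * γ) ∈ D
      rwa [← mul_assoc]
    · rintro ⟨δ, hδ⟩ hδD
      have h1 : a * x * δ.unop ∈ D := by
        rw [mul_assoc]
        exact hδD
      have h2 : (⟨δ.unop, hδ⟩ : Γ) = γ := huniq ⟨δ.unop, hδ⟩ h1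
      refine Subtype.ext (MulOpposite.unop_injective ?_)
      exact congrArg Subtype.val h2
  -- The image of the restriction of `ν` to `D` does not depend on the fundamental domain `D`, in
  -- particular it does not change when `D` is translated on the left.
  let _ : MeasurableSpace (G ⧸ Γ) := borel _
  have _ : BorelSpace (G ⧸ Γ) := ⟨rfl⟩
  have hπ : Measurable (fun x : G => (x : G ⧸ Γ)) := QuotientGroup.continuous_mk.measurable
  have : IsFiniteMeasure (ν.restrict D) := ⟨by rwa [Measure.restrict_apply_univ]⟩
  have hfund1 : IsFundamentalDomain Γ.op D ν := by simpa using hfund 1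
  have : SMulInvariantMeasure Γ.op G ν := ⟨fun γ s _ => measure_preimage_mul_right ν γ.1.unop s⟩
  refine ⟨hΓ, inferInstance, inferInstance, (ν.restrict D).map (fun x : G => (x : G ⧸ Γ)),
    inferInstance, ?_, fun a => ?_⟩
  · rw [Ne, Measure.map_eq_zero_iff hπ.aemeasurable, Measure.restrict_eq_zero]
    exact hfund1.measure_ne_zero hν
  · rw [Measure.map_map (continuous_const_smul a).measurable hπ]
    ext A hA
    rw [Measure.map_apply hπ hA,
      Measure.map_apply ((continuous_const_smul a).measurable.comp hπ) hA,
      Measure.restrict_apply (hπ hA),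
      Measure.restrict_apply (((continuous_const_smul a).measurable.comp hπ) hA)]
    have h1 : ((fun x => a • x) ∘ fun x : G => (x : G ⧸ Γ)) ⁻¹' A ∩ D
        = (a * ·) ⁻¹' ((fun x : G => (x : G ⧸ Γ)) ⁻¹' A ∩ (a⁻¹ * ·) ⁻¹' D) := by
      ext x
      simp
    rw [h1, measure_preimage_mul]
    refine (hfund a⁻¹).measure_set_eq hfund1 (hπ hA) fun γ => ?_
    ext x
    have : ((γ • x : G) : G ⧸ Γ) = x := (QuotientGroup.eq.2 (by
      change x⁻¹ * (x * γ.1.unop) ∈ Γ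
      rw [inv_mul_cancel_left]
      exact γ.2)).symm
    rw [mem_preimage, mem_preimage, this, mem_preimage]

end Cocompact

/-! ### Lattices of the Heisenberg group and of its universal covering -/

theorem continuous_omega (d : ℕ) : Continuous fun p : Cd d × Cd d => omega p.1 p.2 :=
  (HGroup.contDiff_omega d).continuous

instance (d : ℕ) : IsTopologicalGroup (HGroup d) := topologicalGroup_of_lieGroup (HCorners d) ∞

instance (d : ℕ) : T2Space (HGroup d) := inferInstanceAs (T2Space (Circle × Cd d))

instance (d : ℕ) : SecondCountableTopology (HGroup d) :=
  inferInstanceAs (SecondCountableTopology (Circle × Cd d))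

instance (d : ℕ) : T2Space (SCGroup d) := inferInstanceAs (T2Space (ℝ × Cd d))

instance (d : ℕ) : IsTopologicalGroup (SCGroup d) where
  continuous_mul := by
    have h : Continuous fun p : (ℝ × Cd d) × (ℝ × Cd d) =>
        ((p.1.1 + p.2.1 + omega p.1.2 p.2.2 / 2, p.1.2 + p.2.2) : ℝ × Cd d) := by
      have h1 : Continuous fun p : (ℝ × Cd d) × (ℝ × Cd d) => omega p.1.2 p.2.2 :=
        (continuous_omega d).comp ((continuous_snd.comp continuous_fst).prodMk
          (continuous_snd.comp continuous_snd))
      fun_prop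
    exact h
  continuous_inv := by
    have h : Continuous fun p : ℝ × Cd d => ((-p.1, -p.2) : ℝ × Cd d) := by fun_prop
    exact h

/-- The element of the simply connected Heisenberg group with given components. -/
def SCGroup.mk {d : ℕ} (s : ℝ) (X : Cd d) : SCGroup d := ((s, X) : ℝ × Cd d)

theorem SCGroup.mk_mul {d : ℕ} (s : ℝ) (X : Cd d) (x : SCGroup d) :
    SCGroup.mk s X * x = SCGroup.mk (s + x.1 + omega X x.2 / 2) (X + x.2) := rfl

theorem SCGroup.mk_zero_mul {d : ℕ} (s t : ℝ) (X : Cd d) :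
    SCGroup.mk s 0 * SCGroup.mk t X = SCGroup.mk (s + t) X := by
  rw [SCGroup.mk_mul]
  change SCGroup.mk (s + t + omega 0 X / 2) (0 + X) = _
  simp

theorem SCGroup.mul_eq_commutator_mul {d : ℕ} (x y : SCGroup d) :
    x * y = SCGroup.mk (omega x.2 y.2) 0 * (y * x) := by
  refine Prod.ext ?_ ?_
  · change x.1 + y.1 + omega x.2 y.2 / 2
      = omega x.2 y.2 + (y.1 + x.1 + omega y.2 x.2 / 2) + omega 0 (y.2 + x.2) / 2
    rw [omega_swap x.2 y.2, omega_zero_left]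
    ring
  · change x.2 + y.2 = 0 + (y.2 + x.2)
    abel

/-- The intersection of a subgroup with the centre `ℝ`. -/
def SCGroup.centralPart {d : ℕ} (Γ : Subgroup (SCGroup d)) : AddSubgroup ℝ where
  carrier := {s | SCGroup.mk s 0 ∈ Γ}
  zero_mem' := Γ.one_mem
  add_mem' {s t} hs ht := by
    have := Γ.mul_mem hs ht
    rwa [SCGroup.mk_zero_mul] at this
  neg_mem' {s} hs := by
    have h : SCGroup.mk (-s) (-0 : Cd d) ∈ Γ := Γ.inv_mem hs
    rwa [neg_zero] at h

theorem SCGroup.mem_centralPart {d : ℕ} {Γ : Subgroup (SCGroup d)} {s : ℝ} :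
    s ∈ SCGroup.centralPart Γ ↔ SCGroup.mk s 0 ∈ Γ := Iff.rfl

theorem continuous_proj (d : ℕ) : Continuous (proj d) := by
  have h : Continuous fun p : ℝ × Cd d => ((Circle.exp p.1, p.2) : Circle × Cd d) := by fun_prop
  exact h

theorem isOpenMap_proj (d : ℕ) : IsOpenMap (proj d) := by
  have h : IsOpenMap (Prod.map Circle.exp (id : Cd d → Cd d)) :=
    isLocalHomeomorph_circleExp.isOpenMap.prodMap IsOpenMap.id
  exact h

theorem discreteTopology_ker_proj (d : ℕ) : DiscreteTopology (proj d).ker := by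
  rw [discreteTopology_iff_exists_isOpen]
  have hc : Continuous fun x : SCGroup d => x.1 := continuous_fst (X := ℝ) (Y := Cd d)
  refine ⟨(fun x : SCGroup d => x.1) ⁻¹' Ioo (-(2 * Real.pi)) (2 * Real.pi),
    isOpen_Ioo.preimage hc, ?_, fun x hx hxk => ?_⟩
  · change (0 : ℝ) ∈ Ioo (-(2 * Real.pi)) (2 * Real.pi)
    constructor <;> linarith [Real.pi_pos]
  · obtain ⟨⟨n, hn⟩, h2⟩ := (mem_ker_proj x).1 hxk
    have hx' : -(2 * Real.pi) < x.1 ∧ x.1 < 2 * Real.pi := hx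
    rw [hn] at hx'
    have h3 : (n : ℝ) < 1 := by nlinarith [Real.pi_pos]
    have h4 : (-1 : ℝ) < n := by nlinarith [Real.pi_pos]
    have hn0 : n = 0 := by
      have : n < 1 := by exact_mod_cast h3
      have : -1 < n := by exact_mod_cast h4
      omega
    refine Prod.ext ?_ h2
    rw [hn, hn0]
    simp
    rfl

theorem isLattice_comap_proj_iff {d : ℕ} {Λ : Subgroup (HGroup d)} :
    IsLattice (Λ.comap (proj d)) ↔ IsLattice Λ :=
  isLattice_comap_iff (continuous_proj d) (isOpenMap_proj d) (proj_surjective d)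
    (discreteTopology_ker_proj d)

section
variable {d : ℕ} {Γ : Subgroup (SCGroup d)}

/-- A linear form vanishing on the projection of a lattice would descend to the quotient. -/
theorem IsLattice.span_snd_eq_top (h : IsLattice Γ) :
    Submodule.span ℝ {X : Cd d | ∃ γ ∈ Γ, γ.2 = X} = ⊤ := by
  by_contra hne
  obtain ⟨f, hf0, hf⟩ := Submodule.exists_le_ker_of_lt_top _ (lt_top_iff_ne_top.2 hne)
  obtain ⟨v, hv⟩ : ∃ v, f v = 1 := LinearMap.surjective hf0 1
  have hc : Continuous fun x : SCGroup d => f x.2 :=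
    (LinearMap.continuous_of_finiteDimensional f).comp (continuous_snd (X := ℝ) (Y := Cd d))
  refine h.false_of_translation hc (fun x γ hγ => ?_) fun c => ⟨SCGroup.mk 0 (c • v), fun x => ?_⟩
  · change f (x.2 + γ.2) = f x.2
    rw [map_add, LinearMap.mem_ker.1 (hf (Submodule.subset_span ⟨γ, hγ, rfl⟩)), add_zero]
  · change f (c • v + x.2) = f x.2 + c
    rw [map_add, map_smul, hv, smul_eq_mul, mul_one, add_comm]

/-- A lattice of the simply connected Heisenberg group meets the centre: otherwise it would be
abelian, while it spans. -/
theorem IsLattice.exists_mem_centralPart (h : IsLattice Γ) :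
    ∃ r ∈ SCGroup.centralPart Γ, r ≠ 0 := by
  by_contra! hne
  rcases Nat.eq_zero_or_pos d with rfl | hd
  · have hc : Continuous fun x : SCGroup 0 => x.1 := continuous_fst (X := ℝ) (Y := Cd 0)
    refine h.false_of_translation hc (fun x γ hγ => ?_) fun c => ⟨SCGroup.mk c 0, fun x => ?_⟩
    · have h1 : γ = SCGroup.mk γ.1 0 := Prod.ext rfl (Subsingleton.elim _ _)
      have h2 : γ = SCGroup.mk 0 0 := by
        rw [h1] at hγ ⊢
        rw [hne _ hγ]
      rw [h2]
      exact congrArg Prod.fst (mul_one x)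
    · change c + x.1 + omega 0 x.2 / 2 = x.1 + c
      rw [omega_zero_left]
      ring
  · have hω : ∀ γ ∈ Γ, ∀ δ ∈ Γ, omega γ.2 δ.2 = 0 := fun γ hγ δ hδ => hne _ (by
      rw [SCGroup.mem_centralPart, ← mul_inv_eq_iff_eq_mul.2 (SCGroup.mul_eq_commutator_mul γ δ)]
      exact Γ.mul_mem (Γ.mul_mem hγ hδ) (Γ.inv_mem (Γ.mul_mem hδ hγ)))
    have h1 : ∀ γ ∈ Γ, ∀ Y, omega γ.2 Y = 0 := fun γ hγ Y => by
      have : Submodule.span ℝ {X : Cd d | ∃ γ ∈ Γ, γ.2 = X}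
          ≤ LinearMap.ker (omegaL d γ.2).toLinearMap :=
        Submodule.span_le.2 (by rintro _ ⟨δ, hδ, rfl⟩; exact hω γ hγ δ hδ)
      rw [h.span_snd_eq_top] at this
      exact this (Submodule.mem_top (x := Y))
    have h2 : ∀ X Y : Cd d, omega X Y = 0 := fun X Y => by
      have : Submodule.span ℝ {X : Cd d | ∃ γ ∈ Γ, γ.2 = X}
          ≤ LinearMap.ker ((omegaL d).flip Y).toLinearMap :=
        Submodule.span_le.2 (by rintro _ ⟨δ, hδ, rfl⟩; exact h1 δ hδ Y)
      rw [h.span_snd_eq_top] at this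
      exact this (Submodule.mem_top (x := X))
    obtain ⟨X, Y, hXY⟩ := exists_omega_eq hd 1
    exact one_ne_zero (hXY.symm.trans (h2 X Y))

theorem inf_ker_proj_ne_bot_iff :
    Γ ⊓ (proj d).ker ≠ ⊥ ↔ ∃ n : ℤ, n ≠ 0 ∧ n * (2 * Real.pi) ∈ SCGroup.centralPart Γ := by
  rw [Subgroup.ne_bot_iff_exists_ne_one]
  constructor
  · rintro ⟨⟨x, hx, hxk⟩, hx1⟩
    obtain ⟨⟨n, hn⟩, h2⟩ := (mem_ker_proj x).1 hxk
    have hxe : x = SCGroup.mk (n * (2 * Real.pi)) 0 := Prod.ext hn h2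
    refine ⟨n, fun h0 => hx1 (Subtype.ext ?_), by rw [SCGroup.mem_centralPart, ← hxe]; exact hx⟩
    change x = 1
    rw [hxe, h0, Int.cast_zero, zero_mul]
    rfl
  · rintro ⟨n, hn, h⟩
    refine ⟨⟨SCGroup.mk (n * (2 * Real.pi)) 0, h, (mem_ker_proj _).2 ⟨⟨n, rfl⟩, rfl⟩⟩, fun h1 => ?_⟩
    have h2 : (n : ℝ) * (2 * Real.pi) = 0 := congrArg (fun x => x.1.1) h1
    have := Real.pi_pos
    have h3 : (n : ℝ) = 0 := by
      rcases mul_eq_zero.1 h2 with h | h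
      · exact h
      · linarith
    exact hn (by exact_mod_cast h3)

/-- If `Γ` contains the element `2πn` of the centre, the elements `2πi` with `0 ≤ i < |n|` represent
all cosets of `Γ` in `p⁻¹(p(Γ))`. -/
theorem isFiniteRelIndex_comap_map_proj (h : Γ ⊓ (proj d).ker ≠ ⊥) :
    Γ.IsFiniteRelIndex ((Γ.map (proj d)).comap (proj d)) := by
  obtain ⟨n, hn, hnΓ⟩ := inf_ker_proj_ne_bot_iff.1 h
  rw [Subgroup.isFiniteRelIndex_iff_finiteIndex]
  have hmem : ∀ m : ℤ, SCGroup.mk (m * (2 * Real.pi)) 0 ∈ (Γ.map (proj d)).comap (proj d) :=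
    fun m => by
      rw [Subgroup.mem_comap, (proj d).mem_ker.1 ((mem_ker_proj _).2 ⟨⟨m, rfl⟩, rfl⟩)]
      exact Subgroup.one_mem _
  let F : ℤ → ((Γ.map (proj d)).comap (proj d)) ⧸ Γ.subgroupOf ((Γ.map (proj d)).comap (proj d)) :=
    fun m => ((⟨_, hmem m⟩ : (Γ.map (proj d)).comap (proj d)) : _ ⧸ _)
  have hF : F '' Ico 0 |n| = univ := by
    refine eq_univ_of_forall fun y => ?_
    obtain ⟨⟨x, hx⟩, rfl⟩ := QuotientGroup.mk_surjective y
    obtain ⟨γ, hγ, hγx⟩ := hx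
    have hk : x * γ⁻¹ ∈ (proj d).ker := by
      rw [(proj d).mem_ker, map_mul, map_inv, hγx, mul_inv_cancel]
    obtain ⟨⟨m, hm⟩, h2⟩ := (mem_ker_proj _).1 hk
    have hxe : x = SCGroup.mk (m * (2 * Real.pi)) 0 * γ :=
      mul_inv_eq_iff_eq_mul.1 (Prod.ext hm h2)
    refine ⟨m % n, ⟨Int.emod_nonneg m hn, Int.emod_lt_abs m hn⟩, ?_⟩
    refine QuotientGroup.eq.2 ?_
    change (SCGroup.mk ((m % n : ℤ) * (2 * Real.pi)) 0)⁻¹ * x ∈ Γ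
    have hs : SCGroup.mk ((m : ℝ) * (2 * Real.pi)) (0 : Cd d)
        = SCGroup.mk ((m % n : ℤ) * (2 * Real.pi)) 0
          * SCGroup.mk ((m / n : ℤ) • (n * (2 * Real.pi))) 0 := by
      rw [SCGroup.mk_zero_mul]
      congr 1
      have : ((m % n + n * (m / n) : ℤ) : ℝ) = m := by rw [Int.emod_add_mul_ediv]
      rw [← this]
      push_cast
      rw [zsmul_eq_mul]
      ring
    rw [hxe, hs, mul_assoc, inv_mul_cancel_left]
    exact Γ.mul_mem ((SCGroup.centralPart Γ).zsmul_mem hnΓ _) hγ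
  have : Finite (((Γ.map (proj d)).comap (proj d))
      ⧸ Γ.subgroupOf ((Γ.map (proj d)).comap (proj d))) := by
    rw [← Set.finite_univ_iff, ← hF]
    exact (Set.finite_Ico 0 |n|).image F
  exact Subgroup.finiteIndex_of_finite_quotient

theorem IsLattice.map_proj (h : IsLattice Γ) (hne : Γ ⊓ (proj d).ker ≠ ⊥) :
    IsLattice (Γ.map (proj d)) := by
  have := isFiniteRelIndex_comap_map_proj hne
  have hle := Subgroup.le_comap_map (proj d) Γ
  exact isLattice_comap_proj_iff.1
    (h.of_le hle ((Subgroup.discreteTopology_iff_of_isFiniteRelIndex hle).1 h.1))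

/-- If the image of a lattice is discrete, it meets the compact centre in a finite group. -/
theorem IsLattice.inf_ker_proj_ne_bot (h : IsLattice Γ) (hd : DiscreteTopology (Γ.map (proj d))) :
    Γ ⊓ (proj d).ker ≠ ⊥ := by
  obtain ⟨r, hr, hr0⟩ := h.exists_mem_centralPart
  have hK : IsCompact (range fun z : Circle => HGroup.mk z (0 : Cd d)) :=
    isCompact_range (HGroup.continuous_mk.comp (Continuous.prodMk_left 0))
  have hfin := finite_inter_of_isCompact (Γ := Γ.map (proj d)) hK
  have hmaps : ∀ n : ℤ, proj d (SCGroup.mk (n • r) 0)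
      ∈ range (fun z : Circle => HGroup.mk z (0 : Cd d)) ∩ (Γ.map (proj d)) := fun n =>
    ⟨⟨Circle.exp (n • r), rfl⟩, _, (SCGroup.centralPart Γ).zsmul_mem hr n, rfl⟩
  have hninj : ¬ Function.Injective fun n : ℤ => proj d (SCGroup.mk (n • r) (0 : Cd d)) :=
    fun hinj => Set.infinite_range_of_injective hinj (hfin.subset (range_subset_iff.2 hmaps))
  rw [Function.not_injective_iff] at hninj
  obtain ⟨a, b, hab, hne⟩ := hninj
  rw [Subgroup.ne_bot_iff_exists_ne_one]
  refine ⟨⟨SCGroup.mk ((a - b) • r) 0, (SCGroup.centralPart Γ).zsmul_mem hr _,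
    (mem_ker_proj _).2 ⟨?_, rfl⟩⟩, fun h1 => ?_⟩
  · have h1 : Circle.exp (a • r) = Circle.exp (b • r) := congrArg Prod.fst hab
    obtain ⟨m, hm⟩ := Circle.exp_eq_exp.1 h1
    refine ⟨m, ?_⟩
    change (a - b) • r = _
    rw [sub_smul, hm]
    ring
  · have h2 : (a - b) • r = 0 := congrArg (fun x => x.1.1) h1
    rcases smul_eq_zero.1 h2 with h | h
    · exact hne (sub_eq_zero.1 h)
    · exact hr0 h

end

/-- The dilations of the simply connected Heisenberg group. -/
def SCGroup.dilation (d : ℕ) (c : ℝ) (hc : c ≠ 0) : SCGroup d ≃ₜ* SCGroup d where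
  toFun x := SCGroup.mk (c ^ 2 * x.1) (c • x.2)
  invFun x := SCGroup.mk (c⁻¹ ^ 2 * x.1) (c⁻¹ • x.2)
  left_inv x := Prod.ext (by
    change c⁻¹ ^ 2 * (c ^ 2 * x.1) = x.1
    field_simp) (inv_smul_smul₀ hc x.2)
  right_inv x := Prod.ext (by
    change c ^ 2 * (c⁻¹ ^ 2 * x.1) = x.1
    field_simp) (smul_inv_smul₀ hc x.2)
  map_mul' x y := Prod.ext (by
    change c ^ 2 * (x.1 + y.1 + omega x.2 y.2 / 2)
      = c ^ 2 * x.1 + c ^ 2 * y.1 + omega (c • x.2) (c • y.2) / 2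
    rw [omega_smul_left, omega_smul_right]
    ring) (smul_add c x.2 y.2)
  continuous_toFun := by
    have h : Continuous fun x : ℝ × Cd d => ((c ^ 2 * x.1, c • x.2) : ℝ × Cd d) := by fun_prop
    exact h
  continuous_invFun := by
    have h : Continuous fun x : ℝ × Cd d => ((c⁻¹ ^ 2 * x.1, c⁻¹ • x.2) : ℝ × Cd d) := by fun_prop
    exact h

theorem IsLattice.map_equiv {d : ℕ} {Γ : Subgroup (SCGroup d)} (h : IsLattice Γ)
    (φ : SCGroup d ≃ₜ* SCGroup d) : IsLattice (Γ.map φ.toMonoidHom) := by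
  have h1 : Γ.map φ.toMonoidHom = Γ.comap φ.symm.toMonoidHom :=
    Subgroup.map_equiv_eq_comap_symm' φ.toMulEquiv Γ
  have hinj : Function.Injective φ.symm.toMonoidHom := φ.symm.injective
  rw [h1]
  refine (isLattice_comap_iff φ.symm.continuous φ.symm.toHomeomorph.isOpenMap φ.symm.surjective
    ?_).2 h
  rw [(MonoidHom.ker_eq_bot_iff _).2 hinj]
  infer_instance

/-- A dilation carries the intersection of a lattice with the centre onto a group containing
`2πℤ`. -/
theorem IsLattice.exists_continuousMulEquiv {d : ℕ} {Γ : Subgroup (SCGroup d)} (h : IsLattice Γ) :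
    ∃ φ : SCGroup d ≃ₜ* SCGroup d, IsLattice ((Γ.map φ.toMonoidHom).map (proj d)) ∧
      ((Γ.map φ.toMonoidHom).map (proj d)).comap (proj d) = Γ.map φ.toMonoidHom := by
  obtain ⟨r, hr, hr0⟩ : ∃ r ∈ SCGroup.centralPart Γ, 0 < r := by
    obtain ⟨r, hr, hr0⟩ := h.exists_mem_centralPart
    rcases lt_or_gt_of_ne hr0 with h | h
    · exact ⟨-r, neg_mem hr, by linarith⟩
    · exact ⟨r, hr, h⟩
  have hpos : 0 < 2 * Real.pi / r := by positivity
  have hc : √(2 * Real.pi / r) ≠ 0 := (Real.sqrt_pos.2 hpos).ne'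
  obtain ⟨φ, hφ⟩ : ∃ φ, φ = SCGroup.dilation d _ hc := ⟨_, rfl⟩
  have h2π : 2 * Real.pi ∈ SCGroup.centralPart (Γ.map φ.toMonoidHom) := by
    refine ⟨SCGroup.mk r 0, hr, ?_⟩
    rw [hφ]
    refine Prod.ext ?_ (smul_zero _)
    change √(2 * Real.pi / r) ^ 2 * r = 2 * Real.pi
    rw [Real.sq_sqrt hpos.le, div_mul_cancel₀ _ hr0.ne']
  refine ⟨φ, (h.map_equiv φ).map_proj (inf_ker_proj_ne_bot_iff.2 ⟨1, one_ne_zero, by simpa⟩),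
    Subgroup.comap_map_eq_self fun x hx => ?_⟩
  obtain ⟨⟨n, hn⟩, h2⟩ := (mem_ker_proj x).1 hx
  have hxe : x = SCGroup.mk (n • (2 * Real.pi)) 0 := Prod.ext (by rw [hn, ← zsmul_eq_mul]; rfl) h2
  rw [hxe]
  exact (SCGroup.centralPart _).zsmul_mem h2π n

/-! ### Lattices of the Heisenberg group give lattices of the semidirect product -/

section
variable {d : ℕ} (ψ : CircleAction d)

instance : IsTopologicalGroup (Semidirect ψ) := topologicalGroup_of_lieGroup (SCorners d) ∞

instance : T2Space (Semidirect ψ) := inferInstanceAs (T2Space (HGroup d × Circle))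

instance : SecondCountableTopology (Semidirect ψ) :=
  inferInstanceAs (SecondCountableTopology (HGroup d × Circle))

/-- The element of `He_d ⋊ S^1` with given components. -/
def Semidirect.mk (x : HGroup d) (θ : Circle) : Semidirect ψ := ((x, θ) : HGroup d × Circle)

theorem Semidirect.continuous_mk :
    Continuous fun p : HGroup d × Circle => Semidirect.mk ψ p.1 p.2 := continuous_id

theorem Semidirect.mk_mul (x y : HGroup d) (θ η : Circle) :
    Semidirect.mk ψ x θ * Semidirect.mk ψ y η = Semidirect.mk ψ (x * ψ.toHom θ y) (θ * η) := rfl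

theorem Semidirect.isInducing_inl : Topology.IsInducing (Semidirect.inl ψ) := by
  have h : Topology.IsInducing fun x : HGroup d => (x, (1 : Circle)) :=
    (isEmbedding_prodMkLeft 1).isInducing
  exact h

theorem Semidirect.inl_injective : Function.Injective (Semidirect.inl ψ) :=
  fun _ _ h => congrArg Prod.fst h

/-- The quotient of `He_d ⋊ S^1` by a subgroup `Λ` of `He_d` is `S^1 × (He_d ⧸ Λ)`, on which the
group acts by skew products over the rotations of `S^1`. -/
theorem IsLattice.map_inl {Λ : Subgroup (HGroup d)} (h : IsLattice Λ) :
    IsLattice (Λ.map (Semidirect.inl ψ)) := by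
  refine ⟨discreteTopology_map_of_isInducing (Semidirect.isInducing_inl ψ) h.1, ?_⟩
  let Γ := Λ.map (Semidirect.inl ψ)
  let f : Circle × HGroup d → Semidirect ψ := fun p =>
    Semidirect.mk ψ 1 p.1 * Semidirect.inl ψ p.2
  have hf : Continuous f :=
    ((Semidirect.continuous_mk ψ).comp (continuous_const.prodMk continuous_fst)).mul
      ((Semidirect.isInducing_inl ψ).continuous.comp continuous_snd)
  let e : Circle × (HGroup d ⧸ Λ) → Semidirect ψ ⧸ Γ := fun p =>
    Quotient.lift (fun x => (f (p.1, x) : Semidirect ψ ⧸ Γ)) (fun a b hab => by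
      have hab' : a⁻¹ * b ∈ Λ := QuotientGroup.leftRel_apply.1 hab
      refine QuotientGroup.eq.2 ?_
      change (Semidirect.mk ψ 1 p.1 * Semidirect.inl ψ a)⁻¹
        * (Semidirect.mk ψ 1 p.1 * Semidirect.inl ψ b) ∈ Γ
      rw [mul_inv_rev, mul_assoc, inv_mul_cancel_left, ← map_inv, ← map_mul]
      exact ⟨_, hab', rfl⟩) p.2
  have he : Continuous e := by
    rw [← (IsOpenQuotientMap.id.prodMap QuotientGroup.isOpenQuotientMap_mk).continuous_comp_iff]
    exact QuotientGroup.continuous_mk.comp hf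
  obtain ⟨_, _, μ, _, hμ0, hμ⟩ := h.2
  let _ : MeasurableSpace Circle := borel Circle
  have _ : BorelSpace Circle := ⟨rfl⟩
  let ν : Measure Circle := Measure.haarMeasure ⊤
  borelize (Semidirect ψ ⧸ Γ)
  refine ⟨inferInstance, inferInstance, (ν.prod μ).map e, inferInstance, ?_, fun g => ?_⟩
  · rw [Ne, Measure.map_eq_zero_iff he.aemeasurable, ← Measure.measure_univ_eq_zero,
      Measure.prod_apply MeasurableSet.univ]
    simp [NeZero.ne, hμ0]
  · obtain ⟨⟨a, η⟩, rfl⟩ : ∃ p : HGroup d × Circle, g = Semidirect.mk ψ p.1 p.2 := ⟨g, rfl⟩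
    have hc : Continuous fun p : Circle × (HGroup d ⧸ Λ) => ψ.toHom (η * p.1)⁻¹ a • p.2 := by
      have : Continuous fun p : Circle × (HGroup d ⧸ Λ) => ψ.toHom (η * p.1)⁻¹ a :=
        ψ.continuous_toHom.comp (Continuous.prodMk (by fun_prop) continuous_const)
      exact this.smul continuous_snd
    have hT : MeasurePreserving (fun p : Circle × (HGroup d ⧸ Λ) =>
        (η * p.1, ψ.toHom (η * p.1)⁻¹ a • p.2)) (ν.prod μ) (ν.prod μ) :=
      (measurePreserving_mul_left ν η).skew_product
        (g := fun θ x => ψ.toHom (η * θ)⁻¹ a • x) hc.measurable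
        (Filter.Eventually.of_forall fun θ => hμ _)
    have heq : ∀ p, Semidirect.mk ψ a η • e p
        = e (η * p.1, ψ.toHom (η * p.1)⁻¹ a • p.2) := by
      rintro ⟨θ, x⟩
      obtain ⟨x, rfl⟩ := QuotientGroup.mk_surjective x
      refine congrArg (fun y : Semidirect ψ => (y : Semidirect ψ ⧸ Γ)) ?_
      change Semidirect.mk ψ a η * (Semidirect.mk ψ 1 θ * Semidirect.mk ψ x 1)
        = Semidirect.mk ψ 1 (η * θ) * Semidirect.mk ψ (ψ.toHom (η * θ)⁻¹ a * x) 1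
      have h1 : ψ.toHom (η * θ) (ψ.toHom (η * θ)⁻¹ a) = a := by
        rw [← MulAut.mul_apply, ← map_mul, mul_inv_cancel, map_one, MulAut.one_apply]
      have h2 : ψ.toHom η (ψ.toHom θ x) = ψ.toHom (η * θ) x := by
        rw [map_mul, MulAut.mul_apply]
      rw [Semidirect.mk_mul, Semidirect.mk_mul, Semidirect.mk_mul, one_mul, one_mul, map_mul, h1,
        h2, mul_assoc]
    rw [Measure.map_map (continuous_const_smul _).measurable he.measurable]
    conv_rhs => rw [← hT.map_eq]
    rw [Measure.map_map he.measurable hT.measurable]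
    congr 1
    exact funext heq

end

/-! ### Spanning discrete subgroups of the Heisenberg group -/

/-- Translations of `He_d`, on either side, are skew products over the translations of `ℂ^d`. -/
theorem measurePreserving_translation {d : ℕ} [MeasurableSpace Circle] [BorelSpace Circle]
    (ν : Measure Circle) [IsFiniteMeasure ν] [ν.IsMulLeftInvariant] {c : Cd d → Circle}
    (hc : Continuous c) (A : Cd d) :
    MeasurePreserving (fun p : Circle × Cd d => (c p.2 * p.1, A + p.2))
      (ν.prod volume) (ν.prod volume) := by
  have h : MeasurePreserving (fun p : Cd d × Circle => (A + p.1, c p.1 * p.2))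
      (volume.prod ν) (volume.prod ν) := by
    have hm : Measurable (Function.uncurry fun (X : Cd d) (z : Circle) => c X * z) := by
      have : Continuous (Function.uncurry fun (X : Cd d) (z : Circle) => c X * z) := by
        unfold Function.uncurry
        fun_prop
      exact this.measurable
    exact (measurePreserving_add_left volume A).skew_product hm
      (Filter.Eventually.of_forall fun X => map_mul_left_eq_self ν (c X))
  exact (Measure.measurePreserving_swap.comp h).comp Measure.measurePreserving_swap

/-- The Heisenberg group is unimodular. -/
theorem exists_biinvariant_measure (d : ℕ) :
    ∃ (_ : MeasurableSpace (HGroup d)) (_ : BorelSpace (HGroup d)) (ν : Measure (HGroup d)),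
      IsLocallyFiniteMeasure ν ∧ ν.IsMulLeftInvariant ∧ ν.IsMulRightInvariant ∧ ν ≠ 0 := by
  let _ : MeasurableSpace Circle := borel Circle
  have _ : BorelSpace Circle := ⟨rfl⟩
  let ν : Measure Circle := Measure.haarMeasure ⊤
  let _ : MeasurableSpace (HGroup d) := inferInstanceAs (MeasurableSpace (Circle × Cd d))
  have _ : BorelSpace (HGroup d) := inferInstanceAs (BorelSpace (Circle × Cd d))
  let ν' : Measure (HGroup d) := (ν.prod volume : Measure (Circle × Cd d))
  refine ⟨inferInstance, inferInstance, ν',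
    inferInstanceAs (IsLocallyFiniteMeasure (ν.prod volume : Measure (Circle × Cd d))),
    ⟨fun a => ?_⟩, ⟨fun a => ?_⟩, fun h0 => ?_⟩
  · have hc : Continuous fun X : Cd d => a.1 * Circle.exp (omega a.2 X / 2) := by
      have : Continuous fun X : Cd d => omega a.2 X := (omegaL d a.2).continuous
      fun_prop
    refine Eq.trans ?_ (measurePreserving_translation ν hc a.2).map_eq
    refine congrArg (fun F => Measure.map F (ν.prod volume : Measure (Circle × Cd d)))
      (funext fun p => Prod.ext ?_ rfl)
    change a.1 * p.1 * Circle.exp (omega a.2 p.2 / 2) = a.1 * Circle.exp (omega a.2 p.2 / 2) * p.1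
    rw [mul_right_comm]
  · have hc : Continuous fun X : Cd d => a.1 * Circle.exp (omega X a.2 / 2) := by
      have : Continuous fun X : Cd d => omega X a.2 := ((omegaL d).flip a.2).continuous
      fun_prop
    refine Eq.trans ?_ (measurePreserving_translation ν hc a.2).map_eq
    refine congrArg (fun F => Measure.map F (ν.prod volume : Measure (Circle × Cd d)))
      (funext fun p => Prod.ext ?_ (add_comm p.2 a.2))
    change p.1 * a.1 * Circle.exp (omega p.2 a.2 / 2) = a.1 * Circle.exp (omega p.2 a.2 / 2) * p.1
    rw [mul_comm p.1, mul_right_comm]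
  · have h1 : (ν.prod volume : Measure (Circle × Cd d)) univ = 0 := by
      rw [show (ν.prod volume : Measure (Circle × Cd d)) = 0 from h0]
      rfl
    rw [Measure.prod_apply MeasurableSet.univ] at h1
    simp [NeZero.ne] at h1

/-- A subgroup of `He_d` whose projection spans `ℂ^d` is cocompact: modulo the lattice generated by a
basis contained in the projection, all elements have a bounded projection. -/
theorem exists_isCompact_of_span_eq_top {d : ℕ} {Γ : Subgroup (HGroup d)}
    (h : Submodule.span ℝ {X : Cd d | ∃ γ ∈ Γ, γ.2 = X} = ⊤) :
    ∃ K : Set (HGroup d), IsCompact K ∧ ∀ x, ∃ γ ∈ Γ, x * γ ∈ K := by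
  let A : AddSubgroup (Cd d) :=
    { carrier := {X : Cd d | ∃ γ ∈ Γ, γ.2 = X}
      zero_mem' := ⟨1, Γ.one_mem, rfl⟩
      add_mem' := by
        rintro _ _ ⟨γ, hγ, rfl⟩ ⟨δ, hδ, rfl⟩
        exact ⟨γ * δ, Γ.mul_mem hγ hδ, rfl⟩
      neg_mem' := by
        rintro _ ⟨γ, hγ, rfl⟩
        exact ⟨γ⁻¹, Γ.inv_mem hγ, rfl⟩ }
  let b := Module.Basis.ofSpan h.ge
  have : Fintype (LinearIndepOn.extend (linearIndepOn_empty ℝ id) (empty_subset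
      {X : Cd d | ∃ γ ∈ Γ, γ.2 = X})) := FiniteDimensional.fintypeBasisIndex b
  have hb : ∀ X ∈ Submodule.span ℤ (range b), X ∈ A := by
    have : Submodule.span ℤ (range b) ≤ AddSubgroup.toIntSubmodule A :=
      Submodule.span_le.2 (Module.Basis.ofSpan_subset h.ge)
    exact this
  have hK : IsCompact (range fun p : Circle × Metric.closedBall (0 : Cd d) (∑ i, ‖b i‖) =>
      HGroup.mk p.1 p.2.1) := by
    have : CompactSpace (Metric.closedBall (0 : Cd d) (∑ i, ‖b i‖)) :=
      isCompact_iff_compactSpace.1 (isCompact_closedBall _ _)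
    exact isCompact_range (HGroup.continuous_mk.comp
      (continuous_fst.prodMk (continuous_subtype_val.comp continuous_snd)))
  refine ⟨_, hK, fun x => ?_⟩
  obtain ⟨γ, hγ, hγX⟩ := A.neg_mem (hb _ (ZSpan.floor b x.2).2)
  refine ⟨γ, hγ, ⟨(x * γ).1, ⟨ZSpan.fract b x.2, ?_⟩⟩, Prod.ext rfl ?_⟩
  · rw [mem_closedBall_zero_iff]
    exact ZSpan.norm_fract_le b x.2
  · change x.2 - (ZSpan.floor b x.2 : Cd d) = x.2 + γ.2
    rw [hγX, sub_eq_add_neg]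

theorem isLattice_of_span_eq_top {d : ℕ} {Γ : Subgroup (HGroup d)} (hΓ : DiscreteTopology Γ)
    (h : Submodule.span ℝ {X : Cd d | ∃ γ ∈ Γ, γ.2 = X} = ⊤) : IsLattice Γ := by
  obtain ⟨K, hK, hKΓ⟩ := exists_isCompact_of_span_eq_top h
  obtain ⟨_, _, ν, _, _, _, hν⟩ := exists_biinvariant_measure d
  exact isLattice_of_cocompact ν hν hΓ hK hKΓ

/-! ### Lattices of a twisted Heisenberg group -/

theorem finite_setOf_zpow_eq {n : ℤ} (hn : n ≠ 0) (w : Circle) :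
    {θ : Circle | θ ^ n = w}.Finite := by
  have key : ∀ (k : ℕ), 0 < k → ∀ v : Circle, {θ : Circle | θ ^ k = v}.Finite := fun k hk v => by
    have h1 : {z : ℂ | z ∈ Polynomial.nthRoots k (v : ℂ)}.Finite := Multiset.finite_toSet _
    refine (h1.preimage (f := fun θ : Circle => (θ : ℂ))
      fun a _ b _ h => Circle.ext h).subset fun θ hθ => ?_
    change (θ : ℂ) ∈ Polynomial.nthRoots k (v : ℂ)
    have h2 : θ ^ k = v := hθ
    rw [Polynomial.mem_nthRoots hk, ← Circle.coe_pow, h2]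
  rcases Int.natAbs_eq n with h | h
  · rw [h]
    simpa only [zpow_natCast] using key _ (Int.natAbs_pos.2 hn) w
  · rw [h]
    simpa only [zpow_neg, zpow_natCast, inv_eq_iff_eq_inv] using key _ (Int.natAbs_pos.2 hn) w⁻¹

/-- The projection of `He_d ⋊ S^1` onto `S^1`. -/
def Semidirect.rightHom {d : ℕ} (ψ : CircleAction d) : Semidirect ψ →* Circle where
  toFun x := x.2
  map_one' := rfl
  map_mul' _ _ := rfl

theorem norm_rot_apply {d : ℕ} (lam : Fin d → ℤ) (θ : Circle) (X : Cd d) (j : Fin d) :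
    ‖rot lam θ X j‖ = ‖X j‖ := by
  rw [rot_apply, norm_mul, Circle.norm_coe, one_mul]

theorem norm_rot {d : ℕ} (lam : Fin d → ℤ) (θ : Circle) (X : Cd d) : ‖rot lam θ X‖ = ‖X‖ := by
  refine le_antisymm ((pi_norm_le_iff_of_nonneg (norm_nonneg X)).2 fun j => ?_)
    ((pi_norm_le_iff_of_nonneg (norm_nonneg _)).2 fun j => ?_)
  · rw [norm_rot_apply]; exact norm_le_pi_norm X j
  · rw [← norm_rot_apply lam θ]; exact norm_le_pi_norm _ j

section
variable {d : ℕ} {ψ : CircleAction d} {g : Cd d ≃ₗ[ℝ] Cd d} {lam : Fin d → ℤ}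

/-- The component of an element of `He_d ⋊ S^1` in `ℂ^d`, in the linear coordinates `g`. -/
def planar (ψ : CircleAction d) (g : Cd d ≃ₗ[ℝ] Cd d) (x : Semidirect ψ) : Cd d := g x.1.2

theorem continuous_planar : Continuous (planar ψ g) := by
  have h : Continuous fun x : (Circle × Cd d) × Circle => g x.1.2 :=
    (LinearMap.continuous_of_finiteDimensional g.toLinearMap).comp
      (continuous_snd.comp continuous_fst)
  exact h

theorem planar_mul (hψ : ∀ (θ : Circle) (x : HGroup d) (j : Fin d),
      g (ψ.toHom θ x).2 j = ((θ ^ lam j : Circle) : ℂ) * g x.2 j) (x y : Semidirect ψ) :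
    planar ψ g (x * y)
      = planar ψ g x + rot lam (Semidirect.rightHom ψ x) (planar ψ g y) := by
  change g (x.1.2 + (ψ.toHom x.2 y.1).2) = _
  rw [map_add]
  exact congrArg _ (funext fun j => hψ x.2 y.1 j)

theorem isCompact_setOf_norm_planar_le (C : ℝ) :
    IsCompact {x : Semidirect ψ | ‖planar ψ g x‖ ≤ C} := by
  have hc : Continuous fun p : (Circle × Metric.closedBall (0 : Cd d) C) × Circle =>
      Semidirect.mk ψ (HGroup.mk p.1.1 (g.symm p.1.2.1)) p.2 := by
    have : Continuous g.symm := LinearMap.continuous_of_finiteDimensional g.symm.toLinearMap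
    refine (Semidirect.continuous_mk ψ).comp (Continuous.prodMk
      (HGroup.continuous_mk.comp (Continuous.prodMk ?_ ?_)) continuous_snd)
    · fun_prop
    · exact this.comp (continuous_subtype_val.comp (continuous_snd.comp continuous_fst))
  have : CompactSpace (Metric.closedBall (0 : Cd d) C) :=
    isCompact_iff_compactSpace.1 (isCompact_closedBall _ _)
  have hK := isCompact_range hc
  convert hK using 1
  ext x
  constructor
  · intro hx
    exact ⟨((x.1.1, ⟨planar ψ g x, mem_closedBall_zero_iff.2 hx⟩), x.2),
      Prod.ext (Prod.ext rfl (g.symm_apply_apply _)) rfl⟩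
  · rintro ⟨⟨⟨z, X⟩, θ⟩, rfl⟩
    have h1 : planar ψ g (Semidirect.mk ψ (HGroup.mk z (g.symm X.1)) θ) = X.1 :=
      g.apply_symm_apply _
    rw [mem_ofPred_eq, h1]
    exact mem_closedBall_zero_iff.1 X.2

theorem finite_setOf_norm_planar_le {Γ : Subgroup (Semidirect ψ)} [DiscreteTopology Γ] (C : ℝ) :
    {x : Semidirect ψ | x ∈ Γ ∧ ‖planar ψ g x‖ ≤ C}.Finite :=
  (finite_inter_of_isCompact (Γ := Γ)
    (isCompact_setOf_norm_planar_le (ψ := ψ) (g := g) C)).subset fun _ hx => ⟨hx.2, hx.1⟩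

/-- A discrete subgroup of a twisted Heisenberg group has a finite image in `S^1`: this image acts
on the planar components of the elements of the Heisenberg group, with finite orbits; if these
components vanish, the image of the subgroup in `ℂ^d ⋊ S^1` is abelian, and centralizes an element
whose centralizer is compact. -/
theorem finite_image_rightHom (hlam : ∀ j, lam j ≠ 0)
    (hψ : ∀ (θ : Circle) (x : HGroup d) (j : Fin d),
      g (ψ.toHom θ x).2 j = ((θ ^ lam j : Circle) : ℂ) * g x.2 j)
    {Γ : Subgroup (Semidirect ψ)} [DiscreteTopology Γ] :
    (Semidirect.rightHom ψ '' (Γ : Set (Semidirect ψ))).Finite := by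
  obtain ⟨V, hV⟩ : ∃ V, V = planar ψ g := ⟨_, rfl⟩
  obtain ⟨r, hr⟩ : ∃ r, r = Semidirect.rightHom ψ := ⟨_, rfl⟩
  have hmul : ∀ x y, V (x * y) = V x + rot lam (r x) (V y) := by
    rw [hV, hr]; exact planar_mul hψ
  have hfin : ∀ C : ℝ, {x : Semidirect ψ | x ∈ Γ ∧ ‖V x‖ ≤ C}.Finite := by
    rw [hV]; exact finite_setOf_norm_planar_le
  rw [← hr]
  by_cases hA : ∃ γ ∈ Γ, r γ = 1 ∧ V γ ≠ 0
  · obtain ⟨γ, hγ, hγ1, hγV⟩ := hA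
    obtain ⟨j, hj⟩ := Function.ne_iff.1 hγV
    have hF := ((hfin ‖V γ‖).image fun x => V x j / V γ j).preimage
      (Circle.coe_injective.injOn)
    refine (hF.preimage' fun w _ => finite_setOf_zpow_eq (hlam j) w).subset ?_
    rintro _ ⟨δ, hδ, rfl⟩
    -- Conjugation by `δ` rotates the planar component of `γ` by `r δ`.
    have hconj : V (δ * γ * δ⁻¹) = rot lam (r δ) (V γ) := by
      have h1 := hmul (δ * γ * δ⁻¹) δ
      have h2 : r (δ * γ * δ⁻¹) = 1 := by
        rw [map_mul, map_mul, map_inv, hγ1, mul_one, mul_inv_cancel]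
      rw [inv_mul_cancel_right, hmul, h2, rot_one, add_comm] at h1
      exact (add_right_cancel h1).symm
    refine ⟨δ * γ * δ⁻¹, ⟨Γ.mul_mem (Γ.mul_mem hδ hγ) (Γ.inv_mem hδ), ?_⟩, ?_⟩
    · rw [hconj, norm_rot]
    · change V (δ * γ * δ⁻¹) j / V γ j = _
      rw [hconj, rot_apply, mul_div_cancel_right₀ _ hj]
  · push Not at hA
    by_contra hinf
    have hbad : (⋃ j, {θ : Circle | θ ^ lam j = 1}).Finite :=
      Set.finite_iUnion fun j => finite_setOf_zpow_eq (hlam j) 1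
    obtain ⟨_, ⟨γ, hγ, rfl⟩, hγbad⟩ := Set.Infinite.exists_notMem_finite hinf hbad
    have hne : ∀ j, ((r γ ^ lam j : Circle) : ℂ) - 1 ≠ 0 := fun j h =>
      hγbad (mem_iUnion.2 ⟨j, Circle.ext (sub_eq_zero.1 h)⟩)
    have hbound : ∀ δ ∈ Γ, ∀ j, ‖V δ j‖ ≤ 2 * ‖V γ j‖ / ‖((r γ ^ lam j : Circle) : ℂ) - 1‖ := by
      intro δ hδ j
      have h1 : V (γ * δ) = V (δ * γ) := by
        have h2 := hmul (γ * δ * (δ * γ)⁻¹) (δ * γ)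
        have h3 : r (γ * δ * (δ * γ)⁻¹) = 1 := by
          rw [map_mul, map_inv, map_mul, map_mul, mul_comm (r γ), mul_inv_cancel]
        rw [inv_mul_cancel_right, h3, rot_one, hA _ (Γ.mul_mem (Γ.mul_mem hγ hδ)
          (Γ.inv_mem (Γ.mul_mem hδ hγ))) h3, zero_add] at h2
        exact h2
      have h2 := congrFun (((hmul γ δ).symm.trans h1).trans (hmul δ γ)) j
      simp only [Pi.add_apply, rot_apply] at h2
      have h3 : V δ j * (((r γ ^ lam j : Circle) : ℂ) - 1)
          = (((r δ ^ lam j : Circle) : ℂ) - 1) * V γ j := by linear_combination h2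
      rw [le_div_iff₀ (norm_pos_iff.2 (hne j)), ← norm_mul, h3, norm_mul]
      refine mul_le_mul_of_nonneg_right ((norm_sub_le _ _).trans ?_) (norm_nonneg _)
      rw [Circle.norm_coe, norm_one]
      norm_num
    obtain ⟨C, hC⟩ : ∃ C, C = ∑ j, 2 * ‖V γ j‖ / ‖((r γ ^ lam j : Circle) : ℂ) - 1‖ := ⟨_, rfl⟩
    have hpos : ∀ j, 0 ≤ 2 * ‖V γ j‖ / ‖((r γ ^ lam j : Circle) : ℂ) - 1‖ := fun j => by positivity
    refine hinf (((hfin C).image r).subset (image_mono fun δ hδ => ⟨hδ, ?_⟩))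
    rw [pi_norm_le_iff_of_nonneg (hC ▸ Finset.sum_nonneg fun j _ => hpos j)]
    intro j
    rw [hC]
    exact (hbound δ hδ j).trans (Finset.single_le_sum
      (f := fun j => 2 * ‖V γ j‖ / ‖((r γ ^ lam j : Circle) : ℂ) - 1‖)
      (fun j _ => hpos j) (Finset.mem_univ j))

/-- The intersection with `He_d` is the kernel of the projection to `S^1`. -/
theorem isFiniteRelIndex_map_comap_inl {Γ : Subgroup (Semidirect ψ)}
    (h : (Semidirect.rightHom ψ '' (Γ : Set (Semidirect ψ))).Finite) :
    ((Γ.comap (Semidirect.inl ψ)).map (Semidirect.inl ψ)).IsFiniteRelIndex Γ := by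
  let f : Γ →* Circle := (Semidirect.rightHom ψ).comp Γ.subtype
  have : Finite f.range := by
    refine (h.subset ?_).to_subtype
    rintro _ ⟨γ, rfl⟩
    exact ⟨γ, γ.2, rfl⟩
  rw [Subgroup.isFiniteRelIndex_iff_finiteIndex]
  refine Subgroup.finiteIndex_of_le (H := f.ker) fun γ hγ => ?_
  have h1 : (γ : Semidirect ψ) = Semidirect.inl ψ γ.1.1 := Prod.ext rfl hγ
  exact ⟨γ.1.1, by
    change Semidirect.inl ψ γ.1.1 ∈ Γ
    rw [← h1]
    exact γ.2, h1.symm⟩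

/-- A vector with infinitely many multiples at a bounded distance from a subspace belongs to it. -/
theorem mem_of_frequently_norm_sub_le {V : Type*} [NormedAddCommGroup V] [NormedSpace ℝ V]
    [FiniteDimensional ℝ V] (W : Submodule ℝ V) {u : V} {C : ℝ}
    (h : ∃ᶠ k : ℕ in Filter.atTop, ∃ w ∈ W, ‖(k : ℝ) • u - w‖ ≤ C) : u ∈ W := by
  have hW : IsClosed (W : Set V) := W.closed_of_finiteDimensional
  refine hW.closure_subset (Metric.mem_closure_iff.2 fun ε hε => ?_)
  have hlim : ∀ᶠ k : ℕ in Filter.atTop, C / ε < k := by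
    filter_upwards [Filter.eventually_gt_atTop ⌈C / ε⌉₊] with k hk
    exact (Nat.le_ceil _).trans_lt (by exact_mod_cast hk)
  obtain ⟨k, ⟨w, hw, hkw⟩, hk, hk0⟩ :=
    (h.and_eventually (hlim.and (Filter.eventually_gt_atTop 0))).exists
  have hk0' : (0 : ℝ) < k := by exact_mod_cast hk0
  refine ⟨(k : ℝ)⁻¹ • w, W.smul_mem _ hw, ?_⟩
  have h1 : u - (k : ℝ)⁻¹ • w = (k : ℝ)⁻¹ • ((k : ℝ) • u - w) := by
    rw [smul_sub, inv_smul_smul₀ hk0'.ne']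
  rw [dist_eq_norm, h1, norm_smul, norm_inv, Real.norm_of_nonneg hk0'.le, inv_mul_lt_iff₀ hk0']
  refine hkw.trans_lt ?_
  rwa [div_lt_iff₀ hε] at hk

/-- If a lattice of the semidirect product has finite image in `S^1`, its intersection with the
Heisenberg group has a spanning projection: by Poincaré recurrence, each translation of the
Heisenberg group brings almost every point of the quotient back into one and the same set of
bounded points infinitely often. -/
theorem IsLattice.span_planar_eq_top
    (hψ : ∀ (θ : Circle) (x : HGroup d) (j : Fin d),
      g (ψ.toHom θ x).2 j = ((θ ^ lam j : Circle) : ℂ) * g x.2 j)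
    {Γ : Subgroup (Semidirect ψ)} (hΓ : IsLattice Γ)
    (hfin : (Semidirect.rightHom ψ '' (Γ : Set (Semidirect ψ))).Finite) :
    Submodule.span ℝ {X | ∃ γ ∈ Γ, Semidirect.rightHom ψ γ = 1 ∧ planar ψ g γ = X} = ⊤ := by
  obtain ⟨V, hV⟩ : ∃ V, V = planar ψ g := ⟨_, rfl⟩
  obtain ⟨r, hr⟩ : ∃ r, r = Semidirect.rightHom ψ := ⟨_, rfl⟩
  have hmul : ∀ x y, V (x * y) = V x + rot lam (r x) (V y) := by
    rw [hV, hr]; exact planar_mul hψ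
  have hVc : Continuous V := hV ▸ continuous_planar
  rw [← hr] at hfin ⊢
  rw [← hV]
  obtain ⟨W, hW⟩ : ∃ W, W = Submodule.span ℝ {X | ∃ γ ∈ Γ, r γ = 1 ∧ V γ = X} := ⟨_, rfl⟩
  rw [← hW]
  have hmem : ∀ γ ∈ Γ, r γ = 1 → V γ ∈ W := fun γ hγ h1 =>
    hW ▸ Submodule.subset_span ⟨γ, hγ, h1, rfl⟩
  -- `W` is invariant under the image of `Γ` in the circle.
  have hrot : ∀ δ ∈ Γ, ∀ w ∈ W, rot lam (r δ) w ∈ W := fun δ hδ => by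
    have : W ≤ W.comap (rot lam (r δ)) := by
      conv_lhs => rw [hW]
      refine Submodule.span_le.2 ?_
      rintro _ ⟨γ, hγ, hγ1, rfl⟩
      have h1 := hmul (δ * γ * δ⁻¹) δ
      have h2 : r (δ * γ * δ⁻¹) = 1 := by
        rw [map_mul, map_mul, map_inv, hγ1, mul_one, mul_inv_cancel]
      rw [inv_mul_cancel_right, hmul, h2, rot_one, add_comm] at h1
      change rot lam (r δ) (V γ) ∈ W
      rw [add_right_cancel h1]
      exact hmem _ (Γ.mul_mem (Γ.mul_mem hδ hγ) (Γ.inv_mem hδ)) h2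
    exact this
  -- The planar components of `Γ` are bounded modulo `W`.
  have hbdd : ∃ C, ∀ γ ∈ Γ, ∃ w ∈ W, ‖V γ - w‖ ≤ C := by
    choose! s hsΓ hs using fun (θ : Circle) (hθ : θ ∈ r '' (Γ : Set (Semidirect ψ))) => hθ
    obtain ⟨C, hC⟩ := (hfin.image fun θ => ‖V (s θ)‖).bddAbove
    refine ⟨C, fun γ hγ => ⟨rot lam (r γ) (V ((s (r γ))⁻¹ * γ)), ?_, ?_⟩⟩
    · refine hrot γ hγ _ (hmem _ (Γ.mul_mem (Γ.inv_mem (hsΓ _ ⟨γ, hγ, rfl⟩)) hγ) ?_)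
      rw [map_mul, map_inv, hs _ ⟨γ, hγ, rfl⟩, inv_mul_cancel]
    · have h1 := hmul (s (r γ)) ((s (r γ))⁻¹ * γ)
      rw [mul_inv_cancel_left, hs _ ⟨γ, hγ, rfl⟩] at h1
      rw [h1, add_sub_cancel_right]
      exact hC ⟨_, ⟨γ, hγ, rfl⟩, rfl⟩
  obtain ⟨C, hC⟩ := hbdd
  obtain ⟨_, _, μ, _, hμ0, hμ⟩ := hΓ.2
  -- The classes of the points with planar component smaller than `N`.
  let O : ℕ → Set (Semidirect ψ ⧸ Γ) := fun N =>
    (fun x : Semidirect ψ => (x : Semidirect ψ ⧸ Γ)) '' (V ⁻¹' Metric.ball 0 N)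
  have hO : ∀ N, IsOpen (O N) := fun N =>
    QuotientGroup.isOpenMap_coe _ (Metric.isOpen_ball.preimage hVc)
  let τ : Cd d → Semidirect ψ := fun u => Semidirect.inl ψ (HGroup.mk 1 (g.symm u))
  have hrτ : ∀ u, r (τ u) = 1 := fun u => by rw [hr]; rfl
  have hτ : ∀ u (k : ℕ) y, V (τ u ^ k * y) = (k : ℝ) • u + V y := fun u k y => by
    have h1 : ∀ y, V (τ u * y) = u + V y := fun y => by
      have h2 : V (τ u) = u := by rw [hV]; exact g.apply_symm_apply u
      rw [hmul, h2, hrτ, rot_one]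
    induction k with
    | zero => simp
    | succ k ih =>
      rw [pow_succ', mul_assoc, h1, ih]
      push_cast
      module
  have hrec : ∀ u : Cd d, ∀ᵐ x ∂μ, ∀ N, x ∈ O N →
      ∃ᶠ k : ℕ in Filter.atTop, τ u ^ k • x ∈ O N := fun u => by
    have hpres : MeasurePreserving (fun x : Semidirect ψ ⧸ Γ => τ u • x) μ μ :=
      ⟨(continuous_const_smul _).measurable, hμ _⟩
    rw [ae_all_iff]
    intro N
    have := hpres.conservative.ae_mem_imp_frequently_image_mem
      (hO N).measurableSet.nullMeasurableSet
    simpa only [smul_iterate] using this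
  have : (ae μ).NeBot := ae_neBot.2 hμ0
  obtain ⟨x, hx⟩ := (ae_all_iff.2 fun i => hrec (Module.finBasis ℝ (Cd d) i)).exists
  obtain ⟨y, rfl⟩ := QuotientGroup.mk_surjective x
  have hbasis : ∀ i, rot lam (r y)⁻¹ (Module.finBasis ℝ (Cd d) i) ∈ W := fun i => by
    obtain ⟨N, hN⟩ := exists_nat_gt ‖V y‖
    have hf := hx i N ⟨y, mem_ball_zero_iff.2 hN, rfl⟩
    -- Up to a bounded error, the translates `k u` lie in `rot lam (r y) W` for infinitely many `k`.
    refine mem_of_frequently_norm_sub_le W (C := N + C + ‖V y‖) (hf.mono fun k hk => ?_)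
    obtain ⟨z, hz, hzk⟩ := hk
    obtain ⟨γ, hγ, hγz⟩ : ∃ γ ∈ Γ, z * γ = τ (Module.finBasis ℝ (Cd d) i) ^ k * y :=
      ⟨z⁻¹ * (τ (Module.finBasis ℝ (Cd d) i) ^ k * y), QuotientGroup.eq.1 hzk,
        mul_inv_cancel_left _ _⟩
    obtain ⟨w, hw, hwC⟩ := hC γ hγ
    have hV1 := hτ (Module.finBasis ℝ (Cd d) i) k y
    have hr1 : r z * r γ = r y := by
      rw [← map_mul, hγz, map_mul, map_pow, hrτ, one_pow, one_mul]
    rw [← hγz, hmul] at hV1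
    have hzr : (r y)⁻¹ * r z = r γ⁻¹ := by
      rw [← hr1, map_inv, mul_inv_rev, inv_mul_cancel_right]
    refine ⟨rot lam (r γ⁻¹) w, hrot _ (Γ.inv_mem hγ) w hw, ?_⟩
    have h2 : (k : ℝ) • rot lam (r y)⁻¹ (Module.finBasis ℝ (Cd d) i) - rot lam (r γ⁻¹) w
        = rot lam (r y)⁻¹ (V z) + rot lam (r γ⁻¹) (V γ - w) - rot lam (r y)⁻¹ (V y) := by
      have h3 : (k : ℝ) • Module.finBasis ℝ (Cd d) i = V z + rot lam (r z) (V γ) - V y :=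
        eq_sub_of_add_eq hV1.symm
      rw [← map_smul, h3, map_sub, map_add, ← rot_mul, hzr, map_sub]
      abel
    rw [h2]
    refine (norm_sub_le _ _).trans (add_le_add ((norm_add_le _ _).trans (add_le_add ?_ ?_)) ?_)
    · rw [norm_rot]; exact (mem_ball_zero_iff.1 hz).le
    · rw [norm_rot]; exact hwC
    · rw [norm_rot]
  have htop : W.comap (rot lam (r y)⁻¹) = ⊤ := by
    rw [← top_le_iff, ← (Module.finBasis ℝ (Cd d)).span_eq]
    refine Submodule.span_le.2 ?_
    rintro _ ⟨i, rfl⟩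
    exact hbasis i
  refine Submodule.eq_top_iff'.2 fun v => ?_
  have h1 : rot lam (r y) v ∈ W.comap (rot lam (r y)⁻¹) := htop ▸ Submodule.mem_top
  rwa [Submodule.mem_comap, rot_inv_apply_rot] at h1

end

theorem CircleAction.IsTwisted.isLattice_comap_inl {d : ℕ} {ψ : CircleAction d} (hψ : ψ.IsTwisted)
    {Γ : Subgroup (Semidirect ψ)} (hΓ : IsLattice Γ) :
    IsLattice (Γ.comap (Semidirect.inl ψ)) ∧
      ((Γ.comap (Semidirect.inl ψ)).map (Semidirect.inl ψ)).IsFiniteRelIndex Γ := by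
  obtain ⟨g, lam, -, hsign, hg⟩ := hψ
  have hlam : ∀ j, lam j ≠ 0 := fun j => hsign.elim (fun h => (h j).ne') fun h => (h j).ne
  have := hΓ.1
  have hfin := finite_image_rightHom hlam hg (Γ := Γ)
  refine ⟨isLattice_of_span_eq_top (discreteTopology_comap_of_injective
    (Semidirect.isInducing_inl ψ).continuous (Semidirect.inl_injective ψ) hΓ.1) ?_,
    isFiniteRelIndex_map_comap_inl hfin⟩
  have hspan := hΓ.span_planar_eq_top hg hfin
  have hle : Submodule.span ℝ {X | ∃ γ ∈ Γ, Semidirect.rightHom ψ γ = 1 ∧ planar ψ g γ = X}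
      ≤ (Submodule.span ℝ {X : Cd d | ∃ γ ∈ Γ.comap (Semidirect.inl ψ), γ.2 = X}).map
        g.toLinearMap := by
    refine Submodule.span_le.2 ?_
    rintro _ ⟨γ, hγ, h1, rfl⟩
    have h2 : γ = Semidirect.inl ψ γ.1 := Prod.ext rfl h1
    refine ⟨γ.1.2, Submodule.subset_span ⟨γ.1, ?_, rfl⟩, rfl⟩
    rw [Subgroup.mem_comap, ← h2]
    exact hγ
  rw [hspan] at hle
  refine Submodule.eq_top_iff'.2 fun X => ?_
  obtain ⟨Y, hY, hYX⟩ := hle (Submodule.mem_top (x := g X))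
  rwa [← g.injective hYX]

end Heisenberg

end

theorem mainTheorem7 (d : ℕ) :
    -- (i), existence
    (∀ ψ : Heisenberg.CircleAction d, ψ.IsTwisted →
      Nonempty (Heisenberg.BiinvariantLorentzMetric (Heisenberg.SCorners d)
        (Heisenberg.Semidirect ψ))) ∧
    -- (i), converse
    (∀ (ρ : Heisenberg.AlgebraCircleAction d)
      (B : LinearMap.BilinForm ℝ ρ.SemidirectAlgebra),
      Heisenberg.IsLorentzian B → B.lieInvariant ρ.SemidirectAlgebra →
      ∃ ψ : Heisenberg.CircleAction d, ψ.IsTwisted ∧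
        Nonempty (GroupLieAlgebra (Heisenberg.SCorners d) (Heisenberg.Semidirect ψ)
          ≃ₗ⁅ℝ⁆ ρ.SemidirectAlgebra)) ∧
    -- (ii), lattices of a twisted Heisenberg group and of `He_d`
    (∀ ψ : Heisenberg.CircleAction d, ψ.IsTwisted →
      (∀ Λ : Subgroup (Heisenberg.HGroup d), Heisenberg.IsLattice Λ →
        Heisenberg.IsLattice (Λ.map (Heisenberg.Semidirect.inl ψ))) ∧
      (∀ Γ : Subgroup (Heisenberg.Semidirect ψ), Heisenberg.IsLattice Γ →
        Heisenberg.IsLattice (Γ.comap (Heisenberg.Semidirect.inl ψ)) ∧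
        ((Γ.comap (Heisenberg.Semidirect.inl ψ)).map
          (Heisenberg.Semidirect.inl ψ)).IsFiniteRelIndex Γ)) ∧
    -- (ii), lattices of `He_d` and of the simply connected Heisenberg group
    (∀ Λ : Subgroup (Heisenberg.HGroup d), Heisenberg.IsLattice Λ →
      Heisenberg.IsLattice (Λ.comap (Heisenberg.proj d))) ∧
    (∀ Γ : Subgroup (Heisenberg.SCGroup d), Heisenberg.IsLattice Γ →
      (Heisenberg.IsLattice (Γ.map (Heisenberg.proj d)) ↔ Γ ⊓ (Heisenberg.proj d).ker ≠ ⊥) ∧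
      (Heisenberg.IsLattice (Γ.map (Heisenberg.proj d)) →
        Γ.IsFiniteRelIndex ((Γ.map (Heisenberg.proj d)).comap (Heisenberg.proj d))) ∧
      ∃ φ : Heisenberg.SCGroup d ≃ₜ* Heisenberg.SCGroup d,
        Heisenberg.IsLattice ((Γ.map φ.toMonoidHom).map (Heisenberg.proj d)) ∧
        ((Γ.map φ.toMonoidHom).map (Heisenberg.proj d)).comap (Heisenberg.proj d)
          = Γ.map φ.toMonoidHom) := by
  refine ⟨fun ψ hψ => hψ.nonempty_metric,
    fun ρ B hB hinv => ρ.exists_isTwisted_of_isLorentzian hB hinv,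
    fun ψ hψ => ⟨fun Λ hΛ => hΛ.map_inl ψ, fun Γ hΓ => hψ.isLattice_comap_inl hΓ⟩,
    fun Λ hΛ => Heisenberg.isLattice_comap_proj_iff.2 hΛ,
    fun Γ hΓ => ⟨⟨fun h => hΓ.inf_ker_proj_ne_bot h.1, hΓ.map_proj⟩,
      fun h => Heisenberg.isFiniteRelIndex_comap_map_proj (hΓ.inf_ker_proj_ne_bot h.1),
      hΓ.exists_continuousMulEquiv⟩⟩
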